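/- Let $\mathbf U$ be the open unit disk, $\mathbf T$ the unit circle, $d\sigma=dt/2\pi$. For $p>1$ let $\mathbf h^p$ be the space of harmonic maps $f=g+\bar h$ with $g,h$ holomorphic in $\mathbf U$ and $\sup_{0<r<1}\int_{\mathbf T}|f(r\zeta)|^p\,d\sigma(\zeta)<\infty$; on $\mathbf T$ the symbols $g,h,f$ denote radial limits. A $k$-quasiconformal harmonic map ($0\le k<1$) is a harmonic homeomorphism $f$ of $\mathbf U$ onto a plane domain such that either $|f_{\bar z}|\le k|f_z|$ on $\mathbf U$, or $|f_z|\le k|f_{\bar z}|$ on $\mathbf U$. Let $p\in[2,\infty)$, $c>0$, and $$a_{p,c}=2^{-1/2}\left(\left(1+c+\sqrt{1+c^2+2c\cos\tfrac{2\pi}{p}}\right)\csc^2\tfrac{\pi}{p}\right)^{1/2}.$$ (0) If $f=g+\bar h\in\mathbf h^p$, then the radial limits of $g$ and $h$ exist almost everywhere on $\mathbf T$, and $(|g|^2+c|h|^2)^{p/2}$ and $|g+\bar h|^p$ are integrable on $\mathbf T$. (1) If $f=g+\bar h\in\mathbf h^p$ and $\operatorname{Re}(g(0)h(0))=0$, then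 $$\left(\int_{\mathbf T}(|g|^2+c|h|^2)^{p/2}\,d\sigma\right)^{1/p}\le a_{p,c}\left(\int_{\mathbf T}|g+\bar h|^p\,d\sigma\right)^{1/p}.\qquad(*)$$ (2) The constant is sharp: if $(*)$ holds for all these $f$ with a constant $C$ in place of $a_{p,c}$, then $C\ge a_{p,c}$. (3) If $p>2$, equality in $(*)$ is never attained, except for $f=0$ on $\mathbf U$. (4) If $c\ne1$, there are $k\in[0,1)$ and nonzero $k$-quasiconformal harmonic maps $f_n=g_n+\overline{h_n}\in\mathbf h^p$ with $\operatorname{Re}(g_n(0)h_n(0))=0$ for which the quotient of the two sides, $$\left(\int_{\mathbf T}(|g_n|^2+c|h_n|^2)^{p/2}\,d\sigma\right)^{1/p}\Big/\left(\int_{\mathbf T}|f_n|^p\,d\sigma\right)^{1/p},$$ tends to $a_{p,c}$, and which converge locally uniformly in $\mathbf U$ to a $k$-quasiconformal harmonic map that is not in $\mathbf h^p$. If $c=1$, the same holds with "real-valued harmonic" in place of "$k$-quasiconformal harmonic". (5) Let $p>2$, let $$R=\frac{2c\cos(\pi/p)}{-1+c+\sqrt{1+c^2+2c\cos(2\pi/p)}},\qquad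 a=-\frac1R,\qquad g_\gamma(z)=\left(\frac{1-z}{1+z}\right)^\gamma,\qquad f_\gamma=g_\gamma+\overline{a g_\gamma}.$$ For $0<\gamma<1/p$, $f_\gamma$ is a nonzero element of $\mathbf h^p$. As $\gamma\uparrow1/p$, the quotient of the two sides for the pair $(g_\gamma,ag_\gamma)$ tends to $a_{p,c}$. The same holds for the normalized pair $(g_\gamma-1,\,a(g_\gamma-1))$, both members of which vanish at $0$, that is, for the map $f_\gamma-f_\gamma(0)\in\mathbf h^p$. Moreover $f_\gamma\to f_{1/p}$ locally uniformly in $\mathbf U$, and $f_{1/p}\notin\mathbf h^p$. For $0<\gamma\le1/p$, $f_\gamma$ is $\min(R,1/R)$-quasiconformal harmonic if $c\ne1$, and $i f_\gamma$ is real-valued if $c=1$. -/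

import Mathlib

open Set Filter Topology MeasureTheory Complex
open scoped ComplexConjugate Real

noncomputable section

/-- The open unit disk `U`. -/
def unitDisk : Set ℂ := Metric.ball 0 1

/-- The complex-valued map `g + \bar h`. -/
def harmonicMap (g h : ℂ → ℂ) : ℂ → ℂ := fun z => g z + conj (h z)

/-- The integral mean `M_p(f, r) = (∫_T |f(r ζ)|^p dσ(ζ))^{1/p}`, where `dσ = dt / 2π`. -/
def integralMean (p : ℝ) (f : ℂ → ℂ) (r : ℝ) : ℝ :=
  (Real.circleAverage (fun z => ‖f z‖ ^ p) 0 r) ^ (1 / p)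

/-- The Hardy space `h^p` of harmonic maps of the unit disk: maps of the form `g + \bar h` with
`g`, `h` holomorphic in the disk, and with bounded integral means. -/
def MemHarmonicHardy (p : ℝ) (f : ℂ → ℂ) : Prop :=
  (∃ g h : ℂ → ℂ, DifferentiableOn ℂ g unitDisk ∧ DifferentiableOn ℂ h unitDisk ∧
      EqOn f (harmonicMap g h) unitDisk) ∧
    BddAbove (integralMean p f '' Ioo (0 : ℝ) 1)

/-- `F` has a radial limit at the boundary point `ζ`. -/
def HasRadialLimit (F : ℂ → ℂ) (ζ : ℂ) : Prop :=
  ∃ w : ℂ, Tendsto (fun r : ℝ => F ((r : ℂ) * ζ)) (𝓝[<] (1 : ℝ)) (𝓝 w)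

/-- The boundary function of `F`: its radial limit at `ζ`, where that exists. -/
def radialLimit (F : ℂ → ℂ) (ζ : ℂ) : ℂ :=
  limUnder (𝓝[<] (1 : ℝ)) (fun r : ℝ => F ((r : ℂ) * ζ))

/-- The density `(|g|^2 + c |h|^2)^{p/2}` of boundary values. -/
def weightedDensity (p c : ℝ) (g h : ℂ → ℂ) (ζ : ℂ) : ℝ :=
  (‖radialLimit g ζ‖ ^ 2 + c * ‖radialLimit h ζ‖ ^ 2) ^ (p / 2)

/-- `(∫_T (|g|^2 + c |h|^2)^{p/2} dσ)^{1/p}`, with boundary values. -/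
def weightedNorm (p c : ℝ) (g h : ℂ → ℂ) : ℝ :=
  (Real.circleAverage (weightedDensity p c g h) 0 1) ^ (1 / p)

/-- The density `|f|^p` of boundary values. -/
def boundaryDensity (p : ℝ) (f : ℂ → ℂ) (ζ : ℂ) : ℝ := ‖radialLimit f ζ‖ ^ p

/-- `(∫_T |f|^p dσ)^{1/p}`, with boundary values. -/
def boundaryNorm (p : ℝ) (f : ℂ → ℂ) : ℝ :=
  (Real.circleAverage (boundaryDensity p f) 0 1) ^ (1 / p)

/-- `g`, `h` are holomorphic in the disk and `g + \bar h` belongs to `h^p`. -/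
def IsHardyPair (p : ℝ) (g h : ℂ → ℂ) : Prop :=
  DifferentiableOn ℂ g unitDisk ∧ DifferentiableOn ℂ h unitDisk ∧
    MemHarmonicHardy p (harmonicMap g h)

/-- A pair with `g + \bar h ∈ h^p` and `Re (g(0) h(0)) = 0`. -/
def IsAdmissible (p : ℝ) (g h : ℂ → ℂ) : Prop :=
  IsHardyPair p g h ∧ (g 0 * h 0).re = 0

/-- The constant `a_{p,c}`. -/
def rieszConst (p c : ℝ) : ℝ :=
  (2 : ℝ) ^ (-(1 / 2) : ℝ) *
    ((1 + c + √(1 + c ^ 2 + 2 * c * Real.cos (2 * π / p))) *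
      (1 / Real.sin (π / p)) ^ 2) ^ (1 / 2 : ℝ)

/-- The number `R = 2 c cos(π/p) / (-1 + c + √(1 + c² + 2 c cos(2π/p)))`. -/
def extremalRadius (p c : ℝ) : ℝ :=
  2 * c * Real.cos (π / p) / (-1 + c + √(1 + c ^ 2 + 2 * c * Real.cos (2 * π / p)))

/-- `g_γ(z) = ((1 - z) / (1 + z))^γ` (principal branch; the base has positive real part in the
disk). -/
def sectorMap (γ : ℝ) (z : ℂ) : ℂ := ((1 - z) / (1 + z)) ^ (γ : ℂ)

/-- The complex derivative `∂f/∂z` of a real-differentiable map. -/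
def dz (f : ℂ → ℂ) (z : ℂ) : ℂ := (fderiv ℝ f z 1 - I * fderiv ℝ f z I) / 2

/-- The complex derivative `∂f/∂\bar z` of a real-differentiable map. -/
def dzbar (f : ℂ → ℂ) (z : ℂ) : ℂ := (fderiv ℝ f z 1 + I * fderiv ℝ f z I) / 2

/-- `f` is a `k`-quasiconformal harmonic map of the unit disk: harmonic, a homeomorphism onto a
domain, and with complex dilatation bounded by `k < 1`; it may preserve or reverse orientation. -/
structure IsQuasiconformalHarmonic (k : ℝ) (f : ℂ → ℂ) : Prop where
  nonneg : 0 ≤ k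
  lt_one : k < 1
  harmonic : InnerProductSpace.HarmonicOnNhd f unitDisk
  homeo : IsOpenEmbedding (unitDisk.domRestrict f)
  dilatation : (∀ z ∈ unitDisk, ‖dzbar f z‖ ≤ k * ‖dz f z‖) ∨
    (∀ z ∈ unitDisk, ‖dz f z‖ ≤ k * ‖dzbar f z‖)

end

/-! ### Trigonometric monotonicity -/

/-! Put q = p/2, θ = π/p, so that qθ = π/2, and λ = a_{p,c}². The inequality follows from a
pointwise one, `pointwise_riesz`: for some B ≥ 0 and all complex z, w, (|z|² + c|w|²)^q + B V(zw) ≤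
λ^q |z + w̄|^p, where V = `angleFun q` satisfies the sub-mean value inequality along holomorphic
functions (`angleFun_le_circleAverage`). Take z = g, w = h and integrate over circles: the mean of
V(gh) is at least V(g(0)h(0)), which is nonnegative because g(0)h(0) is purely imaginary, so the
V-term can be dropped.

Passing to the boundary uses that the mean of Re(gh) is Re(g(0)h(0)). Hence ∫(|g|² + |h|²) differs
from ∫|f|² by a constant, and for p ≥ 2 both g and h have bounded square means. Bessel's inequality
and Fatou's theorem for Poisson integrals then give boundary values that reproduce g and h. Fatou's
lemma is applied to λ^q|f|^p − B V(gh), which the pointwise inequality makes nonnegative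
(`HasBoundaryValues.fatou_sub`). If p > 2, pointwise equality forces z = w = 0 or Re(zw) < 0; since
the boundary mean of Re(gh) is not below Re(g(0)h(0)) = 0, equality in the integrated inequality
leaves only the zero map.

By homogeneity the pointwise inequality involves only x = |z|/|w| and the angle τ between zw and the
negative real axis. The extremal ratio R satisfies 1/λ = 1 − cos θ/R and c/λ = 1 − R cos θ. These
relations turn the weighted term into a multiple of a convex combination of x/R and R/x, and
convexity of t^q (`rpow_le_of_between`) reduces everything to an inequality free of c: `gapFun` is
at least 1 when τ ≤ θ and y ≤ cos θ, and exceeds 1 when θ < τ ≤ 2θ and y ≥ cos θ. At a minimizer off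
the easy edges, the first-order conditions in y and τ combine into a comparison of `criticalLog` at
τ and at θ that contradicts its strict monotonicity.

For sharpness, (1 − z)/(1 + z) is purely imaginary on the circle, so the square of its γ-th power
has argument ±γπ. If αβ is real, |αg_γ + conj(βg_γ)| is therefore a constant multiple of |g_γ| on
the circle, and the quotient of the norms is explicit. With the right coefficients (1 and −1/R for p
> 2) it tends to a_{p,c} as γ increases to 1/p. The norms of g_γ blow up meanwhile, which makes the
bounded normalization harmless and pushes the limit out of h^p. -/

theorem mul_sin_lt_mul_sin {a b : ℝ} (ha : 0 < a) (hab : a < b) (hb : b ≤ π) :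
    a * Real.sin b < b * Real.sin a := by
  -- Strict concavity at a = (1 − a/b)·0 + (a/b)·b; in other words sin t / t strictly decreases.
  have h := strictConcaveOn_sin_Icc.2 ⟨le_rfl, Real.pi_pos.le⟩
    ⟨(ha.trans hab).le, hb⟩ (ha.trans hab).ne (show 0 < 1 - a / b by rw [sub_pos, div_lt_one (ha.trans hab)]; exact hab) (div_pos ha (ha.trans hab))
    (by ring)
  have hb0 : 0 < b := ha.trans hab
  simp only [smul_eq_mul, mul_zero, Real.sin_zero, zero_add] at h
  rw [div_mul_cancel₀ _ hb0.ne', div_mul_eq_mul_div, div_lt_iff₀ hb0] at h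
  linarith

/-- For `a, b > 0` with `a + b < π`, in cotangents:
`a² cot a + (a + b)² cot (a + b) < b (2a + b) cot b`. -/
theorem cot_sum_lt {a b : ℝ} (ha : 0 < a) (hb : 0 < b) (hab : a + b < π) :
    a ^ 2 * (Real.cos a / Real.sin a) + (a + b) ^ 2 * (Real.cos (a + b) / Real.sin (a + b)) <
      b * (2 * a + b) * (Real.cos b / Real.sin b) := by
  have sa : 0 < Real.sin a := Real.sin_pos_of_pos_of_lt_pi ha (by linarith)
  have sb : 0 < Real.sin b := Real.sin_pos_of_pos_of_lt_pi hb (by linarith)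
  have sab : 0 < Real.sin (a + b) := Real.sin_pos_of_pos_of_lt_pi (by linarith) hab
  have h := mul_sin_lt_mul_sin ha (by linarith : a < a + b) hab.le
  have h2 : (a * Real.sin (a + b)) ^ 2 < ((a + b) * Real.sin a) ^ 2 := by
    apply pow_lt_pow_left₀ h (by positivity) (by norm_num)
  have hs := Real.sin_add a b
  have hc := Real.cos_add a b
  have e1 := Real.sin_sq_add_cos_sq a
  have e2 := Real.sin_sq_add_cos_sq b
  rw [← sub_pos]
  -- Over a common denominator the numerator is a difference of squares, whose sign is the
  -- monotonicity of sin t / t.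
  have key : b * (2 * a + b) * (Real.cos b / Real.sin b) -
      (a ^ 2 * (Real.cos a / Real.sin a) + (a + b) ^ 2 * (Real.cos (a + b) / Real.sin (a + b))) =
      (((a + b) * Real.sin a) ^ 2 - (a * Real.sin (a + b)) ^ 2) /
        (Real.sin a * Real.sin b * Real.sin (a + b)) := by
    field_simp
    rw [hc, hs]
    linear_combination (a + b) ^ 2 * Real.sin a ^ 2 * e2
  rw [key]
  apply div_pos (by linarith) (by positivity)

/-- The logarithmic form of the one-variable function governing the critical points. -/
noncomputable def criticalLog (q τ : ℝ) : ℝ :=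
  (2 * q - 1) * Real.log (Real.sin τ) - (q - 1) * Real.log (Real.sin ((q - 1) * τ)) -
    q * Real.log (Real.sin (q * τ))

theorem strictMonoOn_criticalLog {q : ℝ} (hq : 1 < q) :
    StrictMonoOn (criticalLog q) (Ioo 0 (π / q)) := by
  have hq0 : 0 < q := by linarith
  have hd : ∀ τ ∈ Ioo 0 (π / q), HasDerivAt (criticalLog q)
      ((2 * q - 1) * (Real.cos τ / Real.sin τ) -
        (q - 1) * (Real.cos ((q - 1) * τ) * (q - 1) / Real.sin ((q - 1) * τ)) -
        q * (Real.cos (q * τ) * q / Real.sin (q * τ))) τ ∧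
      0 < ((2 * q - 1) * (Real.cos τ / Real.sin τ) -
        (q - 1) * (Real.cos ((q - 1) * τ) * (q - 1) / Real.sin ((q - 1) * τ)) -
        q * (Real.cos (q * τ) * q / Real.sin (q * τ))) := by
    rintro τ ⟨h0, h1⟩
    have hqτ : q * τ < π := by rwa [lt_div_iff₀ hq0, mul_comm] at h1
    have ha : 0 < (q - 1) * τ := mul_pos (by linarith) h0
    have sa : 0 < Real.sin ((q - 1) * τ) := Real.sin_pos_of_pos_of_lt_pi ha (by nlinarith)
    have sb : 0 < Real.sin τ := Real.sin_pos_of_pos_of_lt_pi h0 (by nlinarith)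
    have sab : 0 < Real.sin (q * τ) := Real.sin_pos_of_pos_of_lt_pi (by positivity) hqτ
    constructor
    · unfold criticalLog
      have e : ∀ k : ℝ, 0 < Real.sin (k * τ) →
          HasDerivAt (fun x => Real.log (Real.sin (k * x)))
            (Real.cos (k * τ) * k / Real.sin (k * τ)) τ := fun k hk => by
        have := ((hasDerivAt_id τ).const_mul k).sin.log hk.ne'
        simpa using this
      exact ((((Real.hasDerivAt_sin τ).log sb.ne').const_mul _).sub ((e _ sa).const_mul _)).sub
        ((e _ sab).const_mul _)
    -- With a = (q − 1)τ and b = τ, hence a + b = qτ, the cotangent inequality is τ² times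
    -- positivity of the derivative.
    · have h := cot_sum_lt ha h0 (by linarith)
      have e : (q - 1) * τ + τ = q * τ := by ring
      rw [e] at h
      have e2 : τ * (2 * ((q - 1) * τ) + τ) = τ ^ 2 * (2 * q - 1) := by ring
      rw [e2] at h
      have : 0 < τ ^ 2 * ((2 * q - 1) * (Real.cos τ / Real.sin τ) -
        (q - 1) * (Real.cos ((q - 1) * τ) * (q - 1) / Real.sin ((q - 1) * τ)) -
        q * (Real.cos (q * τ) * q / Real.sin (q * τ))) := by
        rw [← sub_pos] at h
        convert h using 1
        ring
      exact (mul_pos_iff_of_pos_left (by positivity)).1 this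
  apply strictMonoOn_of_deriv_pos (convex_Ioo _ _)
  · exact fun τ hτ => (hd τ hτ).1.continuousAt.continuousWithinAt
  · intro τ hτ
    rw [interior_Ioo] at hτ
    rw [(hd τ hτ).1.deriv]
    exact (hd τ hτ).2

/-- First-order conditions at an endpoint. The minimizers of `gapFun` studied below may sit on an
extreme angle of their rectangle, where only the sign of the derivative in τ is known. -/
theorem HasDerivAt.nonneg_of_forall_right {f : ℝ → ℝ} {f' x b : ℝ} (h : HasDerivAt f f' x)
    (hxb : x < b) (hf : ∀ y ∈ Icc x b, f x ≤ f y) : 0 ≤ f' := by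
  have h1 := h.hasDerivWithinAt (s := Ioi x)
  rw [hasDerivWithinAt_iff_tendsto_slope' (by simp)] at h1
  refine ge_of_tendsto h1 ?_
  filter_upwards [Ioo_mem_nhdsGT hxb] with y hy
  rw [slope_def_field]
  exact div_nonneg (sub_nonneg.2 (hf y ⟨hy.1.le, hy.2.le⟩)) (sub_nonneg.2 hy.1.le)

theorem HasDerivAt.nonpos_of_forall_left {f : ℝ → ℝ} {f' x a : ℝ} (h : HasDerivAt f f' x)
    (hxa : a < x) (hf : ∀ y ∈ Icc a x, f x ≤ f y) : f' ≤ 0 := by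
  have h1 := h.hasDerivWithinAt (s := Iio x)
  rw [hasDerivWithinAt_iff_tendsto_slope' (by simp)] at h1
  refine le_of_tendsto h1 ?_
  filter_upwards [Ioo_mem_nhdsLT hxa] with y hy
  rw [slope_def_field]
  exact div_nonpos_of_nonneg_of_nonpos (sub_nonneg.2 (hf y ⟨hy.1.le, hy.2.le⟩))
    (sub_nonpos.2 hy.2.le)

/-! ### The two-variable inequality behind the projection constant -/

/-- The squared distance between `1` and `y e^{iτ}`. -/
noncomputable def chordSq (y τ : ℝ) : ℝ := 1 + y ^ 2 - 2 * y * Real.cos τ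

/-- The function whose minimum value is `1`, attained at `τ = θ`, `y = cos θ`. -/
noncomputable def gapFun (q θ y τ : ℝ) : ℝ :=
  (chordSq y τ / Real.sin θ ^ 2) ^ q +
    2 * (Real.cos θ / Real.sin θ) * (y / Real.cos θ) ^ q * Real.cos (q * τ)

theorem chordSq_eq (y τ : ℝ) : chordSq y τ = (y - Real.cos τ) ^ 2 + Real.sin τ ^ 2 := by
  have := Real.sin_sq_add_cos_sq τ
  unfold chordSq
  linear_combination -this

theorem hasDerivAt_gapFun_left {q θ y τ : ℝ} (hq : 1 ≤ q) :
    HasDerivAt (fun y => gapFun q θ y τ)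
      (2 * (y - Real.cos τ) / Real.sin θ ^ 2 * q * (chordSq y τ / Real.sin θ ^ 2) ^ (q - 1) +
        2 * (Real.cos θ / Real.sin θ) * (1 / Real.cos θ * q * (y / Real.cos θ) ^ (q - 1)) *
          Real.cos (q * τ)) y := by
  unfold gapFun chordSq
  have h1 : HasDerivAt (fun y : ℝ => (1 + y ^ 2 - 2 * y * Real.cos τ) / Real.sin θ ^ 2)
      (2 * (y - Real.cos τ) / Real.sin θ ^ 2) y := by
    refine (((((hasDerivAt_id y).pow 2).const_add 1).sub
      (((hasDerivAt_id y).const_mul 2).mul_const (Real.cos τ))).div_const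
        (Real.sin θ ^ 2)).congr_deriv ?_
    simp
    ring
  exact (h1.rpow_const (Or.inr hq)).add
    (((((hasDerivAt_id y).div_const (Real.cos θ)).rpow_const (Or.inr hq)).const_mul _).mul_const _)

theorem hasDerivAt_gapFun_right {q θ y τ : ℝ} (hq : 1 ≤ q) :
    HasDerivAt (fun τ => gapFun q θ y τ)
      (2 * y * Real.sin τ / Real.sin θ ^ 2 * q * (chordSq y τ / Real.sin θ ^ 2) ^ (q - 1) -
        2 * (Real.cos θ / Real.sin θ) * (y / Real.cos θ) ^ q * (Real.sin (q * τ) * q)) τ := by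
  unfold gapFun chordSq
  have h1 : HasDerivAt (fun τ : ℝ => (1 + y ^ 2 - 2 * y * Real.cos τ) / Real.sin θ ^ 2)
      (2 * y * Real.sin τ / Real.sin θ ^ 2) τ := by
    refine ((((Real.hasDerivAt_cos τ).const_mul (2 * y)).const_sub (1 + y ^ 2)).div_const
      (Real.sin θ ^ 2)).congr_deriv ?_
    ring
  have h2 : HasDerivAt (fun τ : ℝ => Real.cos (q * τ)) (-(Real.sin (q * τ) * q)) τ := by
    simpa using ((hasDerivAt_id τ).const_mul q).cos
  refine ((h1.rpow_const (Or.inr hq)).add (h2.const_mul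
    (2 * (Real.cos θ / Real.sin θ) * (y / Real.cos θ) ^ q))).congr_deriv ?_
  ring

theorem continuous_gapFun {q θ : ℝ} (hq : 0 ≤ q) :
    Continuous (fun x : ℝ × ℝ => gapFun q θ x.1 x.2) := by
  unfold gapFun chordSq
  refine Continuous.add (Continuous.rpow_const (by fun_prop) fun _ => Or.inr hq)
    (Continuous.mul (Continuous.mul continuous_const
      (Continuous.rpow_const (by fun_prop) fun _ => Or.inr hq)) (by fun_prop))

theorem angle_bounds {q θ : ℝ} (hq : 1 < q) (hθ : q * θ = π / 2) : 0 < θ ∧ θ < π / 2 := by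
  have h0 : 0 < θ := by
    by_contra! h
    nlinarith [Real.pi_pos]
  exact ⟨h0, by nlinarith⟩

theorem lt_div_of_mul_lt {a b c : ℝ} (ha : 0 < a) (h : a * b < c) : b < c / a := by
  rwa [lt_div_iff₀ ha, mul_comm]

/-- With l = s/θ, the quotient sin(lx)/sin x increases on (0, π/2]; compare its values at x = θ and
at x = π/2 = qθ. -/
theorem sin_le_sin_mul_sin {q θ s : ℝ} (hq : 1 < q) (hθ : q * θ = π / 2) (h0 : 0 ≤ s)
    (hs : s ≤ θ) : Real.sin s ≤ Real.sin θ * Real.sin (q * s) := by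
  obtain ⟨t0, t1⟩ := angle_bounds hq hθ
  rcases h0.eq_or_lt with rfl | h0
  · simp
  rcases hs.eq_or_lt with rfl | hs
  · simp [hθ]
  set l := s / θ with hl
  have hl0 : 0 < l := div_pos h0 t0
  have hl1 : l < 1 := (div_lt_one t0).2 hs
  have hd : ∀ x ∈ Ioo 0 π, HasDerivAt (fun x => Real.sin (l * x) / Real.sin x)
      ((Real.cos (l * x) * l * Real.sin x - Real.sin (l * x) * Real.cos x) / Real.sin x ^ 2) x := by
    intro x hx
    have h1 : HasDerivAt (fun x : ℝ => Real.sin (l * x)) (Real.cos (l * x) * l) x := by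
      simpa using ((hasDerivAt_id x).const_mul l).sin
    exact h1.div (Real.hasDerivAt_sin x) (Real.sin_pos_of_mem_Ioo hx).ne'
  have hmono : MonotoneOn (fun x => Real.sin (l * x) / Real.sin x) (Ioc 0 (π / 2)) := by
    apply monotoneOn_of_deriv_nonneg (convex_Ioc _ _)
    · exact fun x hx => (hd x ⟨hx.1, by linarith [hx.2, Real.pi_pos]⟩).continuousAt.continuousWithinAt
    · rw [interior_Ioc]
      exact fun x hx => (hd x ⟨hx.1, by linarith [hx.2, Real.pi_pos]⟩).differentiableAt.differentiableWithinAt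
    · rw [interior_Ioc]
      intro x hx
      rw [(hd x ⟨hx.1, by linarith [hx.2, Real.pi_pos]⟩).deriv]
      apply div_nonneg _ (sq_nonneg _)
      have hx0 := hx.1
      have hx1 := hx.2
      -- Expanding sin(x ± lx) here yields twice the numerator of the derivative.
      have h := mul_sin_lt_mul_sin (a := (1 - l) * x) (b := (1 + l) * x) (by
        apply mul_pos _ hx0; linarith) (by nlinarith) (by nlinarith)
      have e1 : (1 - l) * x = x - l * x := by ring
      have e2 : (1 + l) * x = x + l * x := by ring
      rw [e1, e2, Real.sin_add, Real.sin_sub] at h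
      have h' : 0 < x * (2 * (Real.cos (l * x) * l * Real.sin x - Real.sin (l * x) * Real.cos x)) := by
        linarith
      have := (mul_pos_iff_of_pos_left hx0).1 h'
      linarith
  have h := hmono ⟨t0, t1.le⟩ (right_mem_Ioc.2 (by linarith)) t1.le
  have e1 : l * θ = s := by rw [hl]; field_simp
  have e2 : l * (π / 2) = q * s := by rw [← hθ, hl]; field_simp
  simp only [e1, e2, Real.sin_pi_div_two, div_one] at h
  rwa [div_le_iff₀ (Real.sin_pos_of_pos_of_lt_pi t0 (by linarith)), mul_comm] at h

theorem hasDerivAt_edge (q θ τ : ℝ) :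
    HasDerivAt (fun τ => Real.sin θ * Real.cos (q * τ) - q * (Real.cos τ - Real.cos θ))
      (q * (Real.sin τ - Real.sin θ * Real.sin (q * τ))) τ := by
  have h2 : HasDerivAt (fun τ : ℝ => Real.cos (q * τ)) (-(Real.sin (q * τ) * q)) τ := by
    simpa using ((hasDerivAt_id τ).const_mul q).cos
  refine ((h2.const_mul _).sub
    (((Real.hasDerivAt_cos τ).sub_const (Real.cos θ)).const_mul q)).congr_deriv ?_
  ring

theorem edge_nonneg {q θ τ : ℝ} (hq : 1 < q) (hθ : q * θ = π / 2) (h0 : 0 ≤ τ) (hτ : τ ≤ θ) :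
    0 ≤ Real.sin θ * Real.cos (q * τ) - q * (Real.cos τ - Real.cos θ) := by
  have hanti : AntitoneOn
      (fun τ => Real.sin θ * Real.cos (q * τ) - q * (Real.cos τ - Real.cos θ)) (Icc 0 θ) := by
    apply antitoneOn_of_deriv_nonpos (convex_Icc _ _)
    · exact fun x _ => (hasDerivAt_edge q θ x).continuousAt.continuousWithinAt
    · exact fun x _ => (hasDerivAt_edge q θ x).differentiableAt.differentiableWithinAt
    · rw [interior_Icc]
      intro x hx
      rw [(hasDerivAt_edge q θ x).deriv]
      have := sin_le_sin_mul_sin hq hθ hx.1.le hx.2.le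
      apply mul_nonpos_of_nonneg_of_nonpos <;> linarith
  have := hanti ⟨h0, hτ⟩ (right_mem_Icc.2 (h0.trans hτ)) hτ
  simpa [hθ] using this

theorem edge_pos {q θ τ : ℝ} (hq : 1 < q) (hθ : q * θ = π / 2) (h0 : θ < τ) (hτ : τ ≤ 2 * θ) :
    0 < Real.sin θ * Real.cos (q * τ) - q * (Real.cos τ - Real.cos θ) := by
  obtain ⟨t0, t1⟩ := angle_bounds hq hθ
  have hanti : StrictMonoOn
      (fun τ => Real.sin θ * Real.cos (q * τ) - q * (Real.cos τ - Real.cos θ))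
        (Icc θ (2 * θ)) := by
    apply strictMonoOn_of_deriv_pos (convex_Icc _ _)
    · exact fun x _ => (hasDerivAt_edge q θ x).continuousAt.continuousWithinAt
    · rw [interior_Icc]
      intro x hx
      rw [(hasDerivAt_edge q θ x).deriv]
      apply mul_pos (by linarith)
      obtain ⟨d, rfl⟩ : ∃ d, x = θ + d := ⟨x - θ, by ring⟩
      have hd0 : 0 < d := by linarith [hx.1]
      have hd1 : d < θ := by linarith [hx.2]
      have e : Real.sin (q * (θ + d)) = Real.cos (q * d) := by
        rw [mul_add, hθ, add_comm, Real.sin_add_pi_div_two]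
      rw [e, Real.sin_add]
      have hc : Real.cos (q * d) ≤ Real.cos d :=
        Real.cos_le_cos_of_nonneg_of_le_pi hd0.le (by nlinarith) (by nlinarith)
      have s0 := Real.sin_pos_of_pos_of_lt_pi t0 (by linarith)
      have sd := Real.sin_pos_of_pos_of_lt_pi hd0 (by linarith)
      have c0 := Real.cos_pos_of_mem_Ioo ⟨by linarith, t1⟩
      nlinarith [mul_le_mul_of_nonneg_left hc s0.le, mul_pos c0 sd]
  have := hanti (left_mem_Icc.2 (by linarith)) ⟨h0.le, hτ⟩ h0
  simpa [hθ] using this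

/-- Bernoulli's inequality linearizes the power on the edge y = cos θ; what is left is the
trigonometric function whose sign `edge_nonneg` and `edge_pos` determine. -/
theorem gapFun_edge {q θ τ : ℝ} (hq : 1 < q) (hθ : q * θ = π / 2) :
    1 + 2 * Real.cos θ / Real.sin θ ^ 2 *
      (Real.sin θ * Real.cos (q * τ) - q * (Real.cos τ - Real.cos θ)) ≤
      gapFun q θ (Real.cos θ) τ := by
  obtain ⟨t0, t1⟩ := angle_bounds hq hθ
  have s0 := Real.sin_pos_of_pos_of_lt_pi t0 (by linarith)
  have c0 := Real.cos_pos_of_mem_Ioo ⟨by linarith, t1⟩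
  have e : chordSq (Real.cos θ) τ / Real.sin θ ^ 2 =
      1 + 2 * Real.cos θ / Real.sin θ ^ 2 * (Real.cos θ - Real.cos τ) := by
    have := Real.sin_sq_add_cos_sq θ
    unfold chordSq
    field_simp
    linear_combination -this
  have hb := one_add_mul_self_le_rpow_one_add
    (s := 2 * Real.cos θ / Real.sin θ ^ 2 * (Real.cos θ - Real.cos τ)) (by
      have : 0 ≤ chordSq (Real.cos θ) τ / Real.sin θ ^ 2 := by
        rw [chordSq_eq]; positivity
      linarith) hq.le
  unfold gapFun
  rw [e, div_self c0.ne', Real.one_rpow]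
  have e2 : 2 * Real.cos θ / Real.sin θ ^ 2 * (Real.sin θ * Real.cos (q * τ)) =
    2 * (Real.cos θ / Real.sin θ) * Real.cos (q * τ) := by field_simp
  linarith

/-- On the ray τ = θ the cosine term vanishes, and the distance from 1 to the ray is sin θ. -/
theorem gapFun_edge_right {q θ y : ℝ} (hq : 1 < q) (hθ : q * θ = π / 2) :
    1 ≤ gapFun q θ y θ := by
  obtain ⟨t0, t1⟩ := angle_bounds hq hθ
  have s0 := Real.sin_pos_of_pos_of_lt_pi t0 (by linarith)
  unfold gapFun
  rw [hθ, Real.cos_pi_div_two, mul_zero, add_zero, chordSq_eq]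
  apply Real.one_le_rpow _ (by linarith)
  rw [one_le_div (by positivity)]
  nlinarith [sq_nonneg (y - Real.cos θ)]

/-- At a critical point in `y`, the logarithm of the balance equation. -/
theorem log_balance {q θ τ y m : ℝ} (hs : 0 < Real.sin θ) (hc : 0 < Real.cos θ) (hy : 0 < y)
    (hτ : 0 < Real.sin τ) {C : ℝ} (hC : 0 < C) (hm : 0 < m)
    (h : m / Real.sin θ ^ 2 * (chordSq y τ / Real.sin θ ^ 2) ^ (q - 1) =
      Real.cos θ / Real.sin θ * (1 / Real.cos θ * (y / Real.cos θ) ^ (q - 1)) * C) :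
    Real.log m + (q - 1) * (Real.log (chordSq y τ) - Real.log y) =
      (2 * q - 1) * Real.log (Real.sin θ) - (q - 1) * Real.log (Real.cos θ) + Real.log C := by
  have hD : 0 < chordSq y τ := by rw [chordSq_eq]; positivity
  have h := congrArg Real.log h
  rw [Real.log_mul (by positivity) (by positivity), Real.log_div (by positivity) (by positivity),
    Real.log_rpow (by positivity), Real.log_div (by positivity) (by positivity),
    Real.log_mul (by positivity) (by positivity), Real.log_mul (by positivity) (by positivity),
    Real.log_div (by positivity) (by positivity), Real.log_mul (by positivity) (by positivity),
    Real.log_rpow (by positivity), Real.log_div (by positivity) (by positivity),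
    Real.log_div hy.ne' hc.ne', Real.log_pow, Real.log_one] at h
  push_cast at h
  linarith

theorem criticalLog_angle {q θ : ℝ} (hθ : q * θ = π / 2) :
    criticalLog q θ =
      (2 * q - 1) * Real.log (Real.sin θ) - (q - 1) * Real.log (Real.cos θ) := by
  have e : (q - 1) * θ = π / 2 - θ := by rw [sub_mul, hθ, one_mul]
  simp [criticalLog, hθ, e, Real.sin_pi_div_two_sub]

/-- If both partial derivatives of `gapFun` vanish, their quotient forces (cos τ − y)/sin τ =
cot(qτ), that is, y = sin((q − 1)τ)/sin(qτ). This critical radius is the reference value below. -/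
theorem cos_sub_critical {q τ : ℝ} (h : Real.sin (q * τ) ≠ 0) :
    Real.cos τ - Real.sin ((q - 1) * τ) / Real.sin (q * τ) =
      Real.sin τ * Real.cos (q * τ) / Real.sin (q * τ) := by
  have : (q - 1) * τ = q * τ - τ := by ring
  rw [this, Real.sin_sub]
  field_simp
  ring

/-! ### The region of small angle and small radius -/

set_option maxHeartbeats 1000000 in
-- Minimize over a rectangle. On the edges y = 0, y = cos θ and τ = θ the bound is direct. Elsewhere
-- stationarity in y and the sign of the derivative in τ give `criticalLog q θ ≤ criticalLog q x` at
-- some x < θ, which is impossible.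
theorem one_le_gapFun_of_le_of_pos {q θ τ y : ℝ} (hq : 1 < q) (hθ : q * θ = π / 2) (hτ0 : 0 < τ)
    (hτ : τ ≤ θ) (hy : 0 ≤ y) (hyc : y ≤ Real.cos θ) : 1 ≤ gapFun q θ y τ := by
  obtain ⟨t0, t1⟩ := angle_bounds hq hθ
  have s0 := Real.sin_pos_of_pos_of_lt_pi t0 (by linarith)
  have c0 := Real.cos_pos_of_mem_Ioo ⟨by linarith, t1⟩
  -- The rectangle starts at the given τ, not at 0, so that all sines at the minimizer are positive;
  -- the price is a one-sided derivative in the angle.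
  obtain ⟨⟨y0, x⟩, ⟨⟨hy0, hy1⟩, ⟨hx0, hx1⟩⟩, hmin⟩ :=
    (isCompact_Icc.prod isCompact_Icc : IsCompact (Icc 0 (Real.cos θ) ×ˢ Icc τ θ)).exists_isMinOn
      ⟨(y, τ), ⟨hy, hyc⟩, ⟨le_rfl, hτ⟩⟩ (continuous_gapFun (θ := θ) (q := q)
        (by linarith)).continuousOn
  have hmin' : ∀ y' ∈ Icc 0 (Real.cos θ), ∀ x' ∈ Icc τ θ, gapFun q θ y0 x ≤ gapFun q θ y' x' :=
    fun y' h1 x' h2 => hmin (show (y', x') ∈ _ from ⟨h1, h2⟩)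
  refine le_trans ?_ (hmin' y ⟨hy, hyc⟩ τ ⟨le_rfl, hτ⟩)
  simp only at hy0 hy1 hx0 hx1
  have hxpos : 0 < x := by linarith
  rcases hx1.eq_or_lt with rfl | hx1
  · exact gapFun_edge_right hq hθ
  rcases hy1.eq_or_lt with rfl | hy1
  · refine le_trans ?_ (gapFun_edge hq hθ)
    have := edge_nonneg hq hθ hxpos.le hx1.le
    have : 0 ≤ 2 * Real.cos θ / Real.sin θ ^ 2 *
      (Real.sin θ * Real.cos (q * x) - q * (Real.cos x - Real.cos θ)) := by positivity
    linarith
  rcases hy0.eq_or_lt with rfl | hy0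
  · unfold gapFun
    rw [zero_div, Real.zero_rpow (by linarith)]
    simp only [mul_zero, zero_mul, add_zero]
    apply Real.one_le_rpow _ (by linarith)
    rw [one_le_div (by positivity)]
    unfold chordSq
    nlinarith [Real.sin_sq_add_cos_sq θ]
  exfalso
  have sx := Real.sin_pos_of_pos_of_lt_pi hxpos (by linarith)
  have hqx : q * x < π / 2 := by rw [← hθ]; exact mul_lt_mul_of_pos_left hx1 (by linarith)
  have hqx0 : 0 < q * x := by positivity
  have sqx := Real.sin_pos_of_pos_of_lt_pi hqx0 (by linarith)
  have cqx := Real.cos_pos_of_mem_Ioo ⟨by linarith, hqx⟩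
  have sqx1 : 0 < Real.sin ((q - 1) * x) :=
    Real.sin_pos_of_pos_of_lt_pi (mul_pos (by linarith) hxpos) (by nlinarith)
  have hD : 0 < chordSq y0 x := by rw [chordSq_eq]; positivity
  have d1 := IsLocalMin.hasDerivAt_eq_zero (f := fun y => gapFun q θ y x) (a := y0) (by
    filter_upwards [Ioo_mem_nhds hy0 hy1] with y' hy'
    exact hmin' y' ⟨hy'.1.le, hy'.2.le⟩ x ⟨hx0, hx1.le⟩) (hasDerivAt_gapFun_left hq.le)
  have d2 := HasDerivAt.nonneg_of_forall_right (hasDerivAt_gapFun_right (q := q) (θ := θ)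
    (y := y0) (τ := x) hq.le) hx1 (fun x' hx' => hmin' y0 ⟨hy0.le, hy1.le⟩ x' ⟨hx0.trans hx'.1, hx'.2⟩)
  have hW : 0 < (chordSq y0 x / Real.sin θ ^ 2) ^ (q - 1) := by positivity
  have hV : 0 < (y0 / Real.cos θ) ^ (q - 1) := by positivity
  have hpow : (y0 / Real.cos θ) ^ q = (y0 / Real.cos θ) * (y0 / Real.cos θ) ^ (q - 1) := by
    rw [Real.rpow_sub_one (by positivity)]; field_simp
  rw [hpow] at d2
  set W := (chordSq y0 x / Real.sin θ ^ 2) ^ (q - 1) with hWd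
  set V := (y0 / Real.cos θ) ^ (q - 1) with hVd
  have E1 : (Real.cos x - y0) / Real.sin θ ^ 2 * W =
      Real.cos θ / Real.sin θ * (1 / Real.cos θ * V) * Real.cos (q * x) := by
    have : 2 * q * ((Real.cos x - y0) / Real.sin θ ^ 2 * W -
      Real.cos θ / Real.sin θ * (1 / Real.cos θ * V) * Real.cos (q * x)) = 0 := by
      linear_combination -d1
    have h2 := (mul_eq_zero.1 this).resolve_left (by positivity)
    linarith
  have E2 : Real.cos θ / Real.sin θ * (1 / Real.cos θ * V) * Real.sin (q * x) ≤
      Real.sin x / Real.sin θ ^ 2 * W := by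
    have : 0 ≤ 2 * q * y0 * (Real.sin x / Real.sin θ ^ 2 * W -
      Real.cos θ / Real.sin θ * (1 / Real.cos θ * V) * Real.sin (q * x)) := by
      convert d2 using 1
      field_simp
    have := nonneg_of_mul_nonneg_right this (by positivity)
    linarith
  have hQ : 0 < Real.cos θ / Real.sin θ * (1 / Real.cos θ * V) := by positivity
  have hP : 0 < W / Real.sin θ ^ 2 := by positivity
  have hm : 0 < Real.cos x - y0 := by
    have : 0 < (Real.cos x - y0) * (W / Real.sin θ ^ 2) := by
      calc (0:ℝ) < _ := mul_pos hQ cqx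
        _ = _ := by rw [← E1]; ring
    exact (mul_pos_iff_of_pos_right hP).1 this
  -- The inequality `E2` divided by the equation `E1`: the radius is at least the critical one.
  have hle : Real.cos x - y0 ≤ Real.sin x * Real.cos (q * x) / Real.sin (q * x) := by
    rw [le_div_iff₀ sqx]
    have : (Real.cos x - y0) * Real.sin (q * x) * (W / Real.sin θ ^ 2) ≤
        Real.sin x * Real.cos (q * x) * (W / Real.sin θ ^ 2) := by
      calc _ = (Real.cos x - y0) / Real.sin θ ^ 2 * W * Real.sin (q * x) := by ring
        _ = Real.cos θ / Real.sin θ * (1 / Real.cos θ * V) * Real.sin (q * x) * Real.cos (q * x) := by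
          rw [E1]; ring
        _ ≤ Real.sin x / Real.sin θ ^ 2 * W * Real.cos (q * x) := by gcongr
        _ = _ := by ring
    exact le_of_mul_le_mul_right this hP
  have hbal := log_balance s0 c0 hy0 sx cqx hm E1
  have hyc' : Real.sin ((q - 1) * x) / Real.sin (q * x) ≤ y0 := by
    have := cos_sub_critical (q := q) (τ := x) sqx.ne'
    linarith
  have hDle : chordSq y0 x ≤ (Real.sin x / Real.sin (q * x)) ^ 2 := by
    rw [chordSq_eq]
    have h1 : (y0 - Real.cos x) ^ 2 ≤ (Real.sin x * Real.cos (q * x) / Real.sin (q * x)) ^ 2 := by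
      rw [← neg_sub, neg_sq]
      exact pow_le_pow_left₀ hm.le hle 2
    have h2 : (Real.sin x * Real.cos (q * x) / Real.sin (q * x)) ^ 2 + Real.sin x ^ 2 =
        (Real.sin x / Real.sin (q * x)) ^ 2 := by
      field_simp
      exact Real.cos_sq_add_sin_sq _
    linarith
  have l1 := Real.log_le_log hm hle
  have l2 := Real.log_le_log hD hDle
  have l3 := Real.log_le_log (by positivity) hyc'
  rw [Real.log_div (by positivity) sqx.ne', Real.log_mul sx.ne' cqx.ne'] at l1
  rw [Real.log_pow, Real.log_div sx.ne' sqx.ne'] at l2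
  rw [Real.log_div sqx1.ne' sqx.ne'] at l3
  push_cast at l2
  -- The three logarithmic bounds inserted in `hbal` sum to `criticalLog q θ ≤ criticalLog q x`; the
  -- term log cos(qx) cancels.
  have hlt := strictMonoOn_criticalLog hq ⟨hxpos, lt_div_of_mul_lt (by linarith) (by linarith)⟩
    ⟨t0, lt_div_of_mul_lt (by linarith) (by linarith)⟩ hx1
  rw [criticalLog_angle hθ] at hlt
  unfold criticalLog at hlt
  have hq1 : 0 < q - 1 := by linarith
  have l2' := mul_le_mul_of_nonneg_left l2 hq1.le
  have l3' := mul_le_mul_of_nonneg_left l3 hq1.le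
  linarith

theorem one_le_gapFun_of_le {q θ τ y : ℝ} (hq : 1 < q) (hθ : q * θ = π / 2) (hτ0 : 0 ≤ τ)
    (hτ : τ ≤ θ) (hy : 0 ≤ y) (hyc : y ≤ Real.cos θ) : 1 ≤ gapFun q θ y τ := by
  obtain ⟨t0, t1⟩ := angle_bounds hq hθ
  rcases hτ0.eq_or_lt with rfl | hτ0
  · have hc : Tendsto (fun τ => gapFun q θ y τ) (𝓝[>] 0) (𝓝 (gapFun q θ y 0)) :=
      (hasDerivAt_gapFun_right hq.le).continuousAt.tendsto.mono_left nhdsWithin_le_nhds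
    refine ge_of_tendsto hc ?_
    filter_upwards [Ioo_mem_nhdsGT t0] with x hx
    exact one_le_gapFun_of_le_of_pos hq hθ hx.1 hx.2.le hy hyc
  · exact one_le_gapFun_of_le_of_pos hq hθ hτ0 hτ hy hyc

/-! ### The region of large angle and large radius -/

theorem balance_deriv_nonneg {q θ x y : ℝ} (hq : 1 < q) (hθ : q * θ = π / 2) (hx0 : θ ≤ x)
    (hx1 : x ≤ 2 * θ) (hy : Real.cos θ ≤ y) (hyx : Real.cos x < y) :
    (q - 1) * (1 - y ^ 2) * (y - Real.cos x) ≤ y * chordSq y x := by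
  obtain ⟨t0, t1⟩ := angle_bounds hq hθ
  have hpi := Real.pi_pos
  have s0 := Real.sin_pos_of_pos_of_lt_pi t0 (by linarith)
  have c0 := Real.cos_pos_of_mem_Ioo ⟨by linarith, t1⟩
  have sx := Real.sin_pos_of_pos_of_lt_pi (by linarith : 0 < x) (by linarith)
  have hD : 0 < chordSq y x := by rw [chordSq_eq]; positivity
  have hy0 : 0 < y := by linarith
  rcases le_or_gt 1 y with h1 | h1
  · have : (q - 1) * (1 - y ^ 2) * (y - Real.cos x) ≤ 0 := by
      apply mul_nonpos_of_nonpos_of_nonneg _ (by linarith)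
      apply mul_nonpos_of_nonneg_of_nonpos <;> nlinarith
    have : 0 < y * chordSq y x := by positivity
    linarith
  set ψ := π / 2 - θ with hψ
  have hψ0 : 0 < ψ := by linarith
  have hcψ : Real.sin ψ = Real.cos θ := by rw [hψ, Real.sin_pi_div_two_sub]
  have hqψ : (q - 1) * θ = ψ := by rw [hψ, ← hθ]; ring
  -- If sin θ ≤ sin x, use 2 sin x (y − cos x) ≤ `chordSq y x` together with (q − 1) sin θ ≤ 2 cos
  -- θ. Otherwise x > π − θ, which with x ≤ 2θ forces θ > π/3, so q is close enough to 1 that q − 1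
  -- ≤ cos θ ≤ y.
  rcases le_or_gt (Real.sin θ) (Real.sin x) with h | h
  · have h2 : (q - 1) * Real.sin θ ≤ 2 * Real.cos θ := by
      have := Real.mul_le_sin hψ0.le (by linarith)
      have h3 := Real.sin_le t0.le
      have h4 : ψ / 2 ≤ 2 / π * ψ := by
        rw [div_mul_eq_mul_div, div_le_div_iff₀ (by norm_num) hpi]
        nlinarith [Real.pi_le_four]
      nlinarith [mul_le_mul_of_nonneg_left h3 (by linarith : 0 ≤ q - 1)]
    have h5 : 1 - y ^ 2 ≤ Real.sin θ ^ 2 := by nlinarith [Real.sin_sq_add_cos_sq θ]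
    have h6 : (q - 1) * (1 - y ^ 2) ≤ y * (2 * Real.sin x) := by
      calc (q - 1) * (1 - y ^ 2) ≤ (q - 1) * Real.sin θ ^ 2 := by
            apply mul_le_mul_of_nonneg_left h5; linarith
        _ = (q - 1) * Real.sin θ * Real.sin θ := by ring
        _ ≤ 2 * Real.cos θ * Real.sin θ := by gcongr
        _ ≤ 2 * y * Real.sin x := by gcongr
        _ = _ := by ring
    have h7 : 2 * Real.sin x * (y - Real.cos x) ≤ chordSq y x := by
      rw [chordSq_eq]; nlinarith [sq_nonneg (y - Real.cos x - Real.sin x)]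
    calc _ ≤ y * (2 * Real.sin x) * (y - Real.cos x) := by
          apply mul_le_mul_of_nonneg_right h6; linarith
      _ = y * (2 * Real.sin x * (y - Real.cos x)) := by ring
      _ ≤ _ := by gcongr
  · have hx : π - θ < x := by
      by_contra! hcon
      rcases le_total x (π / 2) with h3 | h3
      · exact absurd (Real.sin_le_sin_of_le_of_le_pi_div_two (by linarith) h3 hx0) (by linarith)
      · have := Real.sin_le_sin_of_le_of_le_pi_div_two (x := θ) (y := π - x) (by linarith)
          (by linarith) (by linarith)
        rw [Real.sin_pi_sub] at this
        linarith
    have hcx : Real.cos x ≤ 0 :=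
      Real.cos_nonpos_of_pi_div_two_le_of_le (by linarith) (by linarith)
    have hcx1 := Real.neg_one_le_cos x
    have hθ3 : π / 3 < θ := by linarith
    have hqy : q - 1 ≤ y := by
      have h8 := mul_sin_lt_mul_sin hψ0 (by linarith : ψ < π / 6) (by linarith)
      rw [Real.sin_pi_div_six, hcψ] at h8
      have : (q - 1) * (π / 3) ≤ ψ := by
        rw [← hqψ]; apply mul_le_mul_of_nonneg_left hθ3.le; linarith
      nlinarith
    -- The difference of the sides is affine in k = −cos x, with 0 ≤ k ≤ 1; the sign of its slope
    -- decides at which end to bound it.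
    have h9 : (1 - y ^ 2) * (y - Real.cos x) ≤ chordSq y x := by
      unfold chordSq
      obtain ⟨k, hk⟩ : ∃ k, k = -Real.cos x := ⟨_, rfl⟩
      have hk' : Real.cos x = -k := by linarith
      rw [hk'] at hcx hcx1 ⊢
      rcases le_total 0 (1 - y ^ 2 - 2 * y) with h10 | h10
      · nlinarith [mul_le_mul_of_nonneg_right (by linarith : k ≤ 1) h10, pow_pos hy0 3]
      · nlinarith [mul_nonneg (by linarith : 0 ≤ k) (sub_nonneg.2 h10), pow_pos hy0 3]
    calc _ = (q - 1) * ((1 - y ^ 2) * (y - Real.cos x)) := by ring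
      _ ≤ y * ((1 - y ^ 2) * (y - Real.cos x)) := by
          apply mul_le_mul_of_nonneg_right hqy
          apply mul_nonneg <;> nlinarith
      _ ≤ _ := by gcongr

/-- This is the left side of `log_balance`. For small angles its terms could be bounded one by one;
here y appears with competing signs, and `balance_deriv_nonneg` is the sign of the numerator of the
whole derivative. -/
theorem monotoneOn_balance {q θ x : ℝ} (hq : 1 < q) (hθ : q * θ = π / 2) (hx0 : θ ≤ x)
    (hx1 : x ≤ 2 * θ) {b : ℝ} (hb : Real.cos θ ≤ b) (hbx : Real.cos x < b) :
    MonotoneOn (fun y => Real.log (y - Real.cos x) +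
      (q - 1) * (Real.log (chordSq y x) - Real.log y)) (Ici b) := by
  obtain ⟨t0, t1⟩ := angle_bounds hq hθ
  have sx := Real.sin_pos_of_pos_of_lt_pi (by linarith : 0 < x) (by linarith)
  have c0 := Real.cos_pos_of_mem_Ioo ⟨by linarith, t1⟩
  have hd : ∀ y ∈ Ici b, HasDerivAt (fun y => Real.log (y - Real.cos x) +
      (q - 1) * (Real.log (chordSq y x) - Real.log y))
      (1 / (y - Real.cos x) + (q - 1) * (2 * (y - Real.cos x) / chordSq y x - 1 / y)) y := by
    intro y hy
    have hy : b ≤ y := hy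
    have hD : 0 < chordSq y x := by rw [chordSq_eq]; positivity
    have h1 : HasDerivAt (fun y => chordSq y x) (2 * (y - Real.cos x)) y := by
      unfold chordSq
      refine ((((hasDerivAt_id y).pow 2).const_add 1).sub
        (((hasDerivAt_id y).const_mul 2).mul_const (Real.cos x))).congr_deriv ?_
      simp
      ring
    exact (((hasDerivAt_id y).sub_const (Real.cos x)).log (by simp; linarith)).add
      (((h1.log hD.ne').sub ((hasDerivAt_id y).log (by simp; linarith))).const_mul _)
  apply monotoneOn_of_deriv_nonneg (convex_Ici _)
  · exact fun y hy => (hd y hy).continuousAt.continuousWithinAt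
  · exact fun y hy => (hd y (interior_subset hy)).differentiableAt.differentiableWithinAt
  · intro y hy
    have hy := interior_subset hy
    rw [(hd y hy).deriv]
    have hy : b ≤ y := hy
    have hD : 0 < chordSq y x := by rw [chordSq_eq]; positivity
    have h := balance_deriv_nonneg hq hθ hx0 hx1 (hb.trans hy) (by linarith)
    have h1 : 0 < y - Real.cos x := by linarith
    have h2 : 0 < y := by linarith
    have e : 1 / (y - Real.cos x) + (q - 1) * (2 * (y - Real.cos x) / chordSq y x - 1 / y) =
      (y * chordSq y x - (q - 1) * (1 - y ^ 2) * (y - Real.cos x)) /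
        ((y - Real.cos x) * (y * chordSq y x)) := by
      field_simp
      unfold chordSq
      ring
    rw [e]
    apply div_nonneg <;> [linarith; positivity]

/-- Writing x = θ + d, the critical radius is cos x + sin x tan(qd), which is at least cos x + sin x
tan d = cos θ/cos d. -/
theorem cos_le_critical {q θ x : ℝ} (hq : 1 < q) (hθ : q * θ = π / 2) (hx0 : θ ≤ x)
    (hx1 : x < 2 * θ) : Real.cos θ ≤ Real.sin ((q - 1) * x) / Real.sin (q * x) := by
  obtain ⟨t0, t1⟩ := angle_bounds hq hθ
  obtain ⟨d, rfl⟩ : ∃ d, x = θ + d := ⟨x - θ, by ring⟩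
  have hd0 : 0 ≤ d := by linarith
  have hqd : q * d < π / 2 := by nlinarith
  have hqd0 : 0 ≤ q * d := by positivity
  have hdq : d ≤ q * d := by nlinarith
  have c0 := Real.cos_pos_of_mem_Ioo ⟨by linarith, t1⟩
  have cd := Real.cos_pos_of_mem_Ioo (x := d) ⟨by linarith, by linarith⟩
  have cqd := Real.cos_pos_of_mem_Ioo (x := q * d) ⟨by linarith, by linarith⟩
  have sx := Real.sin_pos_of_pos_of_lt_pi (by linarith : 0 < θ + d) (by linarith)
  have e1 : Real.sin (q * (θ + d)) = Real.cos (q * d) := by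
    rw [mul_add, hθ, add_comm, Real.sin_add_pi_div_two]
  have e2 : Real.cos (q * (θ + d)) = -Real.sin (q * d) := by
    rw [mul_add, hθ, add_comm, Real.cos_add_pi_div_two]
  have h := cos_sub_critical (q := q) (τ := θ + d) (by rw [e1]; exact cqd.ne')
  rw [e1, e2] at h
  rw [e1]
  have h2 : Real.sin d / Real.cos d ≤ Real.sin (q * d) / Real.cos (q * d) := by
    rw [div_le_div_iff₀ cd cqd]
    have := Real.sin_nonneg_of_nonneg_of_le_pi (x := q * d - d) (by linarith) (by linarith)
    rw [Real.sin_sub] at this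
    linarith
  have h3 : Real.cos θ ≤ Real.cos (θ + d) + Real.sin (θ + d) * (Real.sin d / Real.cos d) := by
    have : Real.cos (θ + d) + Real.sin (θ + d) * (Real.sin d / Real.cos d) =
        Real.cos θ / Real.cos d := by
      have h4 : Real.cos (θ + d - d) = Real.cos θ := by simp
      rw [Real.cos_sub] at h4
      field_simp
      linarith
    rw [this, le_div_iff₀ cd]
    nlinarith [Real.cos_le_one d]
  have h5 := mul_le_mul_of_nonneg_left h2 sx.le
  have e3 : Real.sin (θ + d) * -Real.sin (q * d) / Real.cos (q * d) =
    -(Real.sin (θ + d) * (Real.sin (q * d) / Real.cos (q * d))) := by ring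
  rw [e3] at h
  linarith

/-- The first term grows like y^{2q} and the second only like y^q, uniformly in the angle. This
makes the unbounded region compact for the purpose of minimization. -/
theorem exists_one_lt_gapFun {q θ : ℝ} (hq : 1 < q) (hθ : q * θ = π / 2) :
    ∃ Y₀, ∀ Y, Y₀ ≤ Y → ∀ x, 1 < gapFun q θ Y x := by
  obtain ⟨t0, t1⟩ := angle_bounds hq hθ
  have s0 := Real.sin_pos_of_pos_of_lt_pi t0 (by linarith)
  have c0 := Real.cos_pos_of_mem_Ioo ⟨by linarith, t1⟩
  set K := 2 * (Real.cos θ / Real.sin θ) * (1 / Real.cos θ) ^ q with hK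
  have hK0 : 0 < K := by positivity
  refine ⟨4 + K, fun Y hY x => ?_⟩
  have hY0 : 0 < Y := by linarith
  have hY1 : 1 < Y ^ q := Real.one_lt_rpow (by linarith) (by linarith)
  have h1 : Y * (2 + K) ≤ chordSq Y x / Real.sin θ ^ 2 := by
    rw [le_div_iff₀ (by positivity)]
    have : Real.sin θ ^ 2 ≤ 1 := by nlinarith [Real.sin_sq_add_cos_sq θ]
    have h2 : Y * (2 + K) * Real.sin θ ^ 2 ≤ Y * (2 + K) := by
      apply mul_le_of_le_one_right (by positivity) this
    unfold chordSq
    nlinarith [Real.cos_le_one x]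
  have h3 : Y ^ q * (2 + K) ≤ (chordSq Y x / Real.sin θ ^ 2) ^ q := by
    calc Y ^ q * (2 + K) ≤ Y ^ q * (2 + K) ^ q := by
          gcongr
          exact Real.self_le_rpow_of_one_le (by linarith) hq.le
      _ = (Y * (2 + K)) ^ q := by rw [Real.mul_rpow (by positivity) (by positivity)]
      _ ≤ _ := by gcongr
  have h4 : 2 * (Real.cos θ / Real.sin θ) * (Y / Real.cos θ) ^ q = K * Y ^ q := by
    rw [hK, div_eq_mul_one_div Y, Real.mul_rpow (by positivity) (by positivity)]; ring
  unfold gapFun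
  rw [h4]
  nlinarith [Real.neg_one_le_cos (q * x), mul_pos hK0 (by linarith : 0 < Y ^ q)]

set_option maxHeartbeats 1000000 in
-- Mirror image of the argument for small angles: a minimizer off the edge y = cos θ has radius at
-- least the critical one, and monotonicity of the balance then gives `criticalLog q x ≤ criticalLog
-- q θ` with x > θ.
theorem one_lt_gapFun_of_minimal {q θ x y0 : ℝ} (hq : 1 < q) (hθ : q * θ = π / 2) {Y : ℝ}
    (hx0 : θ < x) (hx1 : x ≤ 2 * θ) (hy0 : Real.cos θ ≤ y0) (hY : y0 < Y)
    (hmin' : ∀ y' ∈ Icc (Real.cos θ) Y, ∀ x' ∈ Icc θ (2 * θ),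
      gapFun q θ y0 x ≤ gapFun q θ y' x') : 1 < gapFun q θ y0 x := by
  obtain ⟨t0, t1⟩ := angle_bounds hq hθ
  have s0 := Real.sin_pos_of_pos_of_lt_pi t0 (by linarith)
  have c0 := Real.cos_pos_of_mem_Ioo ⟨by linarith, t1⟩
  rcases hy0.eq_or_lt with rfl | hyc
  · refine lt_of_lt_of_le ?_ (gapFun_edge hq hθ)
    have := edge_pos hq hθ hx0 hx1
    have : 0 < 2 * Real.cos θ / Real.sin θ ^ 2 *
      (Real.sin θ * Real.cos (q * x) - q * (Real.cos x - Real.cos θ)) := by positivity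
    linarith
  exfalso
  have hy0 : 0 < y0 := by linarith
  have hxpos : 0 < x := by linarith
  have sx := Real.sin_pos_of_pos_of_lt_pi hxpos (by linarith)
  have hqx : π / 2 < q * x := by rw [← hθ]; exact mul_lt_mul_of_pos_left hx0 (by linarith)
  have hqx1 : q * x ≤ π := by nlinarith
  have cqx : 0 < -Real.cos (q * x) := by
    rw [neg_pos]; exact Real.cos_neg_of_pi_div_two_lt_of_lt hqx (by linarith)
  have hD : 0 < chordSq y0 x := by rw [chordSq_eq]; positivity
  have d1 := IsLocalMin.hasDerivAt_eq_zero (f := fun y => gapFun q θ y x) (a := y0) (by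
    filter_upwards [Ioo_mem_nhds hyc hY] with y' hy'
    exact hmin' y' ⟨hy'.1.le, hy'.2.le⟩ x ⟨hx0.le, hx1⟩) (hasDerivAt_gapFun_left hq.le)
  have d2 := HasDerivAt.nonpos_of_forall_left (hasDerivAt_gapFun_right (q := q) (θ := θ)
    (y := y0) (τ := x) hq.le) hx0
    (fun x' hx' => hmin' y0 ⟨hyc.le, hY.le⟩ x' ⟨hx'.1, hx'.2.trans hx1⟩)
  have hW : 0 < (chordSq y0 x / Real.sin θ ^ 2) ^ (q - 1) := by positivity
  have hV : 0 < (y0 / Real.cos θ) ^ (q - 1) := by positivity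
  have hpow : (y0 / Real.cos θ) ^ q = (y0 / Real.cos θ) * (y0 / Real.cos θ) ^ (q - 1) := by
    rw [Real.rpow_sub_one (by positivity)]; field_simp
  rw [hpow] at d2
  have hbal0 := fun hm => log_balance (q := q) (m := y0 - Real.cos x) s0 c0 hy0 sx cqx hm
  generalize (chordSq y0 x / Real.sin θ ^ 2) ^ (q - 1) = W at *
  generalize (y0 / Real.cos θ) ^ (q - 1) = V at *
  have E1 : (y0 - Real.cos x) / Real.sin θ ^ 2 * W =
      Real.cos θ / Real.sin θ * (1 / Real.cos θ * V) * -Real.cos (q * x) := by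
    have : 2 * q * ((y0 - Real.cos x) / Real.sin θ ^ 2 * W -
      Real.cos θ / Real.sin θ * (1 / Real.cos θ * V) * -Real.cos (q * x)) = 0 := by
      linear_combination d1
    have h2 := (mul_eq_zero.1 this).resolve_left (by positivity)
    linarith
  have E2 : Real.sin x / Real.sin θ ^ 2 * W ≤
      Real.cos θ / Real.sin θ * (1 / Real.cos θ * V) * Real.sin (q * x) := by
    have : 2 * q * y0 * (Real.sin x / Real.sin θ ^ 2 * W -
      Real.cos θ / Real.sin θ * (1 / Real.cos θ * V) * Real.sin (q * x)) ≤ 0 := by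
      convert d2 using 1
      field_simp
    have := nonpos_of_mul_nonpos_right this (by positivity)
    linarith
  have hQ : 0 < Real.cos θ / Real.sin θ * (1 / Real.cos θ * V) := by positivity
  have hP : 0 < W / Real.sin θ ^ 2 := by positivity
  -- The first-order inequality itself excludes the corner value x = 2θ, where sin(qx) = 0.
  have sqx : 0 < Real.sin (q * x) := by
    have : 0 < Real.cos θ / Real.sin θ * (1 / Real.cos θ * V) * Real.sin (q * x) :=
      lt_of_lt_of_le (by positivity) E2
    exact (mul_pos_iff_of_pos_left hQ).1 this
  have hqx1 : q * x < π := by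
    refine lt_of_le_of_ne hqx1 fun h => ?_
    rw [h, Real.sin_pi] at sqx
    exact lt_irrefl _ sqx
  have sqx1 : 0 < Real.sin ((q - 1) * x) :=
    Real.sin_pos_of_pos_of_lt_pi (mul_pos (by linarith) hxpos) (by nlinarith)
  have hx1 : x < 2 * θ := by nlinarith
  have hm : 0 < y0 - Real.cos x := by
    have : 0 < (y0 - Real.cos x) * (W / Real.sin θ ^ 2) := by
      calc (0:ℝ) < _ := mul_pos hQ cqx
        _ = _ := by rw [← E1]; ring
    exact (mul_pos_iff_of_pos_right hP).1 this
  have hle : Real.sin x * -Real.cos (q * x) / Real.sin (q * x) ≤ y0 - Real.cos x := by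
    rw [div_le_iff₀ sqx]
    have : Real.sin x * -Real.cos (q * x) * (W / Real.sin θ ^ 2) ≤
        (y0 - Real.cos x) * Real.sin (q * x) * (W / Real.sin θ ^ 2) := by
      calc _ = Real.sin x / Real.sin θ ^ 2 * W * -Real.cos (q * x) := by ring
        _ ≤ Real.cos θ / Real.sin θ * (1 / Real.cos θ * V) * Real.sin (q * x) *
            -Real.cos (q * x) := by gcongr
        _ = (y0 - Real.cos x) / Real.sin θ ^ 2 * W * Real.sin (q * x) := by rw [E1]; ring
        _ = _ := by ring
    exact le_of_mul_le_mul_right this hP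
  have hbal := hbal0 hm E1
  have hcrit := cos_sub_critical (q := q) (τ := x) sqx.ne'
  have e3 : Real.sin x * -Real.cos (q * x) / Real.sin (q * x) =
    -(Real.sin x * Real.cos (q * x) / Real.sin (q * x)) := by ring
  set b := Real.sin ((q - 1) * x) / Real.sin (q * x) with hb
  have hbm : b - Real.cos x = Real.sin x * -Real.cos (q * x) / Real.sin (q * x) := by linarith
  have hbpos : 0 < Real.sin x * -Real.cos (q * x) / Real.sin (q * x) := by positivity
  have hmono := monotoneOn_balance hq hθ hx0.le hx1.le (cos_le_critical hq hθ hx0.le hx1)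
    (b := b) (by linarith) (mem_Ici.2 le_rfl) (mem_Ici.2 (by linarith : b ≤ y0)) (by linarith)
  have hDb : chordSq b x = (Real.sin x / Real.sin (q * x)) ^ 2 := by
    rw [chordSq_eq, hbm]
    field_simp
    exact Real.cos_sq_add_sin_sq _
  simp only [hbm, hDb] at hmono
  rw [Real.log_div (by positivity) sqx.ne', Real.log_mul sx.ne' cqx.ne', Real.log_pow,
    Real.log_div sx.ne' sqx.ne', hb, Real.log_div sqx1.ne' sqx.ne', hbal] at hmono
  have hlt := strictMonoOn_criticalLog hq ⟨t0, lt_div_of_mul_lt (by linarith) (by linarith)⟩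
    ⟨hxpos, lt_div_of_mul_lt (by linarith) hqx1⟩ hx0
  rw [criticalLog_angle hθ] at hlt
  unfold criticalLog at hlt
  push_cast at hmono
  linarith

set_option maxHeartbeats 1000000 in
theorem one_lt_gapFun_of_lt {q θ τ y : ℝ} (hq : 1 < q) (hθ : q * θ = π / 2) (hτ0 : θ < τ)
    (hτ : τ ≤ 2 * θ) (hyc : Real.cos θ ≤ y) : 1 < gapFun q θ y τ := by
  obtain ⟨t0, t1⟩ := angle_bounds hq hθ
  obtain ⟨Y₀, hY₀⟩ := exists_one_lt_gapFun hq hθ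
  obtain ⟨⟨y0, x⟩, ⟨⟨hy0, hy1⟩, ⟨hx0, hx1⟩⟩, hmin⟩ :=
    (isCompact_Icc.prod isCompact_Icc :
      IsCompact (Icc (Real.cos θ) (max y Y₀) ×ˢ Icc θ (2 * θ))).exists_isMinOn
      ⟨(y, τ), ⟨hyc, le_max_left _ _⟩, ⟨hτ0.le, hτ⟩⟩ (continuous_gapFun (θ := θ) (q := q)
        (by linarith)).continuousOn
  have hmin' : ∀ y' ∈ Icc (Real.cos θ) (max y Y₀), ∀ x' ∈ Icc θ (2 * θ),
      gapFun q θ y0 x ≤ gapFun q θ y' x' :=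
    fun y' h1 x' h2 => hmin (show (y', x') ∈ _ from ⟨h1, h2⟩)
  have hmem : y ∈ Icc (Real.cos θ) (max y Y₀) := ⟨hyc, le_max_left _ _⟩
  simp only at hy0 hy1 hx0 hx1
  have key : ∀ a b, a ∈ Icc (Real.cos θ) (max y Y₀) → θ < b → b ≤ 2 * θ →
      (∀ y' ∈ Icc (Real.cos θ) (max y Y₀), ∀ x' ∈ Icc θ (2 * θ),
        gapFun q θ a b ≤ gapFun q θ y' x') → 1 < gapFun q θ a b := by
    intro a b ha hb0 hb1 hm
    rcases ha.2.eq_or_lt with h | h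
    · exact hY₀ a (h ▸ le_max_right _ _) b
    · exact one_lt_gapFun_of_minimal hq hθ hb0 hb1 ha.1 h hm
  rcases hx0.eq_or_lt with rfl | hx0
  -- On the ray τ = θ the minimum gives only a weak bound. But if the value at the given point were
  -- at most 1, that point would itself be a minimizer with angle beyond θ, and `key` would apply to
  -- it.
  · have h1 : 1 ≤ gapFun q θ y0 θ := gapFun_edge_right hq hθ
    by_contra! hcon
    refine absurd (key y τ hmem hτ0 hτ fun y' hy' x' hx' => ?_) hcon.not_gt
    exact (hcon.trans h1).trans (hmin' y' hy' x' hx')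
  · exact (key y0 x ⟨hy0, hy1⟩ hx0 hx1 hmin').trans_le (hmin' y hmem τ ⟨hτ0.le, hτ⟩)

/-! ### Transfer by convexity to general coefficients -/

theorem ConvexOn.secant_le_secant {S : Set ℝ} {f : ℝ → ℝ} (hf : ConvexOn ℝ S f) {a b a' b' : ℝ}
    (ha : a ∈ S) (hb' : b' ∈ S) (ha' : a' ∈ S) (hb : b ∈ S) (hab : a < b) (hab' : a' < b')
    (h1 : a ≤ a') (h2 : b ≤ b') : (f b - f a) / (b - a) ≤ (f b' - f a') / (b' - a') := by
  have e1 := hf.secant_mono ha hb hb' hab.ne' (hab.trans_le h2).ne' h2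
  have e2 := hf.secant_mono hb' ha ha' (hab.trans_le h2).ne hab'.ne h1
  rw [← neg_div_neg_eq, neg_sub, neg_sub, ← neg_div_neg_eq (f a' - f b'), neg_sub, neg_sub] at e2
  exact e1.trans e2

/-- After this homogenization the bounds for `gapFun` become statements about the increment of t^q
over an interval ending or starting at ω. The increment depends on ω only through ω + 1/ω, so it is
the same for ω and 1/ω. -/
theorem gapFun_mul_rpow {q θ ω τ : ℝ} (hq : 1 < q) (hθ : q * θ = π / 2) (hω : 0 < ω) :
    gapFun q θ (Real.cos θ / ω) τ * ω ^ q =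
      (ω - 2 * Real.cos θ / Real.sin θ ^ 2 * (Real.cos τ - Real.cos θ * ((ω + 1 / ω) / 2))) ^ q +
        2 * Real.cos θ / Real.sin θ ^ 2 * Real.sin θ * Real.cos (q * τ) := by
  obtain ⟨t0, t1⟩ := angle_bounds hq hθ
  have s0 := Real.sin_pos_of_pos_of_lt_pi t0 (by linarith)
  have c0 := Real.cos_pos_of_mem_Ioo ⟨by linarith, t1⟩
  have h1 : (Real.cos θ / ω / Real.cos θ) ^ q * ω ^ q = 1 := by
    rw [← Real.mul_rpow (by positivity) hω.le]
    have : Real.cos θ / ω / Real.cos θ * ω = 1 := by field_simp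
    rw [this, Real.one_rpow]
  have h2 : (chordSq (Real.cos θ / ω) τ / Real.sin θ ^ 2) ^ q * ω ^ q =
      (ω - 2 * Real.cos θ / Real.sin θ ^ 2 *
        (Real.cos τ - Real.cos θ * ((ω + 1 / ω) / 2))) ^ q := by
    rw [← Real.mul_rpow (by rw [chordSq_eq]; positivity) hω.le]
    congr 1
    have := Real.sin_sq_add_cos_sq θ
    unfold chordSq
    field_simp
    linear_combination -ω ^ 2 * this
  unfold gapFun
  rw [add_mul, h2]
  have e : 2 * Real.cos θ / Real.sin θ ^ 2 * Real.sin θ = 2 * (Real.cos θ / Real.sin θ) := by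
    field_simp
  rw [e]
  linear_combination 2 * (Real.cos θ / Real.sin θ) * Real.cos (q * τ) * h1

/-- The bounds for `gapFun` supply the extreme case: endpoint Ω when τ ≤ θ, endpoint 1/Ω when τ > θ,
both with the smallest s. Since secant slopes of t^q increase, moving the endpoint to z and
enlarging s only helps. -/
theorem rpow_le_of_between {q θ τ Ω z s : ℝ} (hq : 1 < q) (hθ : q * θ = π / 2) (hτ0 : 0 ≤ τ)
    (hτ1 : τ ≤ 2 * θ) (hΩ : 1 ≤ Ω) (hz0 : 1 / Ω ≤ z) (hz1 : z ≤ Ω)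
    (hs : 2 * Real.cos θ / Real.sin θ ^ 2 ≤ s)
    (hpos : 0 ≤ z - s * (Real.cos τ - Real.cos θ * ((Ω + 1 / Ω) / 2))) :
    z ^ q ≤ (z - s * (Real.cos τ - Real.cos θ * ((Ω + 1 / Ω) / 2))) ^ q +
      s * Real.sin θ * Real.cos (q * τ) ∧
    (θ < τ → z ^ q < (z - s * (Real.cos τ - Real.cos θ * ((Ω + 1 / Ω) / 2))) ^ q +
      s * Real.sin θ * Real.cos (q * τ)) := by
  obtain ⟨t0, t1⟩ := angle_bounds hq hθ
  have sθ := Real.sin_pos_of_pos_of_lt_pi t0 (by linarith)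
  have cθ := Real.cos_pos_of_mem_Ioo ⟨by linarith, t1⟩
  set s0 := 2 * Real.cos θ / Real.sin θ ^ 2 with hs0
  have hs0pos : 0 < s0 := by positivity
  have hΩ0 : 0 < Ω := by linarith
  have hz : 0 < z := lt_of_lt_of_le (by positivity) hz0
  have hh : 1 ≤ (Ω + 1 / Ω) / 2 := by
    have : (Ω + 1 / Ω) / 2 - 1 = (Ω - 1) ^ 2 / (2 * Ω) := by field_simp; ring
    have h2 : 0 ≤ (Ω - 1) ^ 2 / (2 * Ω) := by positivity
    linarith
  have hconv := convexOn_rpow hq.le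
  rcases le_or_gt τ θ with hτ | hτ
  · refine ⟨?_, fun h => absurd h hτ.not_gt⟩
    have hc : 0 ≤ Real.cos (q * τ) := Real.cos_nonneg_of_mem_Icc
      ⟨by nlinarith [Real.pi_pos, mul_nonneg (by linarith : 0 ≤ q) hτ0], by nlinarith⟩
    have key := gapFun_mul_rpow (τ := τ) hq hθ hΩ0
    have h1 := one_le_gapFun_of_le hq hθ hτ0 hτ (y := Real.cos θ / Ω) (by positivity)
      (div_le_self cθ.le hΩ)
    have h2 := mul_le_mul_of_nonneg_right h1 (by positivity : 0 ≤ Ω ^ q)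
    rw [key, one_mul, ← hs0] at h2
    set η := Real.cos τ - Real.cos θ * ((Ω + 1 / Ω) / 2) with hη
    have hsc : 0 ≤ s * Real.sin θ * Real.cos (q * τ) := by
      have : 0 < s := by linarith
      positivity
    rcases le_or_gt η 0 with h0 | h0
    · have : z ^ q ≤ (z - s * η) ^ q := by
        apply Real.rpow_le_rpow hz.le _ (by linarith)
        nlinarith [mul_nonpos_of_nonneg_of_nonpos (by linarith : 0 ≤ s) h0]
      linarith
    · have hle : s0 * η ≤ s * η := by gcongr
      have hsη : 0 < s0 * η := by positivity
      -- The interval [z − sη, z] lies to the left of [Ω − s₀η, Ω] at both ends.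
      have h3 := hconv.secant_le_secant (a := z - s * η) (b := z) (a' := Ω - s0 * η) (b' := Ω)
        hpos hΩ0.le (show (0:ℝ) ≤ Ω - s0 * η by linarith) hz.le (by linarith) (by linarith)
        (by linarith) hz1
      simp only [sub_sub_cancel] at h3
      rw [div_le_div_iff₀ (by linarith) hsη] at h3
      have h4 : (Ω ^ q - (Ω - s0 * η) ^ q) * (s * η) ≤
          (s0 * Real.sin θ * Real.cos (q * τ)) * (s * η) := by
        apply mul_le_mul_of_nonneg_right _ (by linarith)
        linarith
      have h5 : (z ^ q - (z - s * η) ^ q) * (s0 * η) ≤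
          (s * Real.sin θ * Real.cos (q * τ)) * (s0 * η) := by
        calc _ ≤ _ := h3
          _ ≤ _ := h4
          _ = _ := by ring
      have := le_of_mul_le_mul_right h5 hsη
      linarith
  · suffices h : z ^ q < (z - s * (Real.cos τ - Real.cos θ * ((Ω + 1 / Ω) / 2))) ^ q +
      s * Real.sin θ * Real.cos (q * τ) from ⟨h.le, fun _ => h⟩
    have key := gapFun_mul_rpow (τ := τ) hq hθ (one_div_pos.2 hΩ0)
    have e : 1 / Ω + 1 / (1 / Ω) = Ω + 1 / Ω := by rw [one_div_one_div]; ring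
    have h1 := one_lt_gapFun_of_lt hq hθ hτ hτ1 (y := Real.cos θ / (1 / Ω)) (by
      rw [div_div_eq_mul_div, div_one]; nlinarith)
    have h2 := mul_lt_mul_of_pos_right h1 (by positivity : 0 < (1 / Ω) ^ q)
    rw [key, one_mul, ← hs0, e] at h2
    obtain ⟨η, hη⟩ : ∃ η, η = -(Real.cos τ - Real.cos θ * ((Ω + 1 / Ω) / 2)) := ⟨_, rfl⟩
    have hη' : Real.cos τ - Real.cos θ * ((Ω + 1 / Ω) / 2) = -η := by linarith
    have h0 : 0 < η := by
      have := Real.cos_lt_cos_of_nonneg_of_le_pi t0.le (by linarith) hτ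
      nlinarith
    rw [hη'] at h2 ⊢
    simp only [mul_neg, sub_neg_eq_add] at h2 ⊢
    have hle : s0 * η ≤ s * η := by gcongr
    have hsη : 0 < s0 * η := by positivity
    have hΩi : 0 < 1 / Ω := by positivity
    have h3 := hconv.secant_le_secant (a' := z) (b' := z + s * η) (a := 1 / Ω)
      (b := 1 / Ω + s0 * η) hΩi.le (show (0:ℝ) ≤ z + s * η by linarith) hz.le
      (show (0:ℝ) ≤ 1 / Ω + s0 * η by linarith) (by linarith) (by linarith) hz0 (by linarith)
    simp only [add_sub_cancel_left] at h3
    rw [div_le_div_iff₀ hsη (by linarith)] at h3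
    have h4 : (s0 * Real.sin θ * -Real.cos (q * τ)) * (s * η) <
        ((1 / Ω + s0 * η) ^ q - (1 / Ω) ^ q) * (s * η) := by
      apply mul_lt_mul_of_pos_right _ (by linarith)
      linarith
    have h5 : (s * Real.sin θ * -Real.cos (q * τ)) * (s0 * η) <
        ((z + s * η) ^ q - z ^ q) * (s0 * η) := by
      calc _ = _ := by ring
        _ < _ := h4
        _ ≤ _ := h3
    have := lt_of_mul_lt_mul_right h5 hsη.le
    linarith

/-! ### The constants -/

theorem rieszConst_nonneg (p c : ℝ) (hc : 0 ≤ c) : 0 ≤ rieszConst p c := by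
  unfold rieszConst; positivity

theorem rieszConst_sq (p c : ℝ) (hc : 0 ≤ c) : rieszConst p c ^ 2 =
    (1 + c + √(1 + c ^ 2 + 2 * c * Real.cos (2 * π / p))) / (2 * Real.sin (π / p) ^ 2) := by
  unfold rieszConst
  rw [mul_pow, ← Real.sqrt_eq_rpow ((1 + c + √(1 + c ^ 2 + 2 * c * Real.cos (2 * π / p))) *
      (1 / Real.sin (π / p)) ^ 2), Real.sq_sqrt (by positivity), ← Real.rpow_natCast,
    ← Real.rpow_mul (by norm_num)]
  norm_num [Real.rpow_neg_one]
  rw [div_eq_mul_inv _ (2 * _), mul_inv]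
  ring

/-- The algebra of the constant: with `λ = a²` and `R` the extremal ratio. -/
theorem extremal_relations {p c : ℝ} (hp : 2 < p) (hc : 0 < c) :
    0 < extremalRadius p c ∧ 1 < rieszConst p c ^ 2 ∧ c < rieszConst p c ^ 2 ∧
    1 / rieszConst p c ^ 2 = 1 - Real.cos (π / p) / extremalRadius p c ∧
    c / rieszConst p c ^ 2 = 1 - extremalRadius p c * Real.cos (π / p) := by
  have hpi := Real.pi_pos
  have t0 : 0 < π / p := by positivity
  have t1 : π / p < π / 2 := by gcongr
  have sθ := Real.sin_pos_of_pos_of_lt_pi t0 (by linarith)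
  have cθ := Real.cos_pos_of_mem_Ioo ⟨by linarith, t1⟩
  have hs1 : Real.sin (π / p) < 1 := by nlinarith [Real.sin_sq_add_cos_sq (π / p)]
  have e2 : 2 * π / p = 2 * (π / p) := by ring
  rw [rieszConst_sq p c hc.le]
  unfold extremalRadius
  rw [e2, Real.cos_two_mul]
  have hsc := Real.sin_sq_add_cos_sq (π / p)
  generalize Real.sin (π / p) = S at *
  generalize Real.cos (π / p) = C at *
  have harg : 1 + c ^ 2 + 2 * c * (2 * C ^ 2 - 1) = (1 - c) ^ 2 + 4 * c * C ^ 2 := by ring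
  rw [harg]
  have hΔ := Real.sq_sqrt (by positivity : 0 ≤ (1 - c) ^ 2 + 4 * c * C ^ 2)
  have hΔ1 : |1 - c| < √((1 - c) ^ 2 + 4 * c * C ^ 2) := by
    rw [← Real.sqrt_sq_eq_abs]
    apply Real.sqrt_lt_sqrt (sq_nonneg _)
    have : 0 < 4 * c * C ^ 2 := by positivity
    linarith
  generalize √((1 - c) ^ 2 + 4 * c * C ^ 2) = Δ at *
  obtain ⟨h1, h2⟩ := abs_lt.1 hΔ1
  have hΔ0 : 0 < Δ := (abs_nonneg _).trans_lt hΔ1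
  have hR : 0 < -1 + c + Δ := by linarith
  have hS2 : S ^ 2 < 1 := by nlinarith
  have hL : 0 < 1 + c + Δ := by linarith
  -- Conjugate roots: with sin θ = S and cos θ = C, 1/λ is a root of (1 − t)(1 − ct) = C².
  have e3 : (1 + c + Δ) * (1 + c - Δ) = 4 * c * S ^ 2 := by
    linear_combination (-4 * c) * hsc - hΔ
  have e4 : 1 / ((1 + c + Δ) / (2 * S ^ 2)) = (1 + c - Δ) / (2 * c) := by
    rw [one_div_div, div_eq_div_iff hL.ne' (by positivity)]
    linear_combination -e3
  refine ⟨by positivity, ?_, ?_, ?_, ?_⟩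
  · rw [lt_div_iff₀ (by positivity)]; linarith
  · rw [lt_div_iff₀ (by positivity)]
    nlinarith
  · rw [e4]
    field_simp
    ring
  · rw [← mul_one_div, e4]
    have e5 : (Δ + c - 1) * (Δ + 1 - c) = 4 * c * C ^ 2 := by linear_combination hΔ
    field_simp
    linear_combination (-1) * e5 

theorem rieszConst_sq_two {c : ℝ} (hc : 0 < c) : rieszConst 2 c ^ 2 = max 1 c := by
  rw [rieszConst_sq 2 c hc.le]
  have e : 1 + c ^ 2 + 2 * c * Real.cos (2 * π / 2) = (1 - c) ^ 2 := by
    rw [mul_div_cancel_left₀ _ (by norm_num), Real.cos_pi]; ring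
  rw [e, Real.sqrt_sq_eq_abs, Real.sin_pi_div_two]
  rcases le_total 1 c with h | h
  · rw [abs_of_nonpos (by linarith), max_eq_right h]; ring
  · rw [abs_of_nonneg (by linarith), max_eq_left h]; ring

/-! ### The pointwise inequality -/

/-- A subharmonic function, homogeneous of degree `q`, equal to `-Re ((-ζ)^q)` in the sector of
opening `2π/q` around the negative axis and to `|ζ|^q` outside. -/
noncomputable def angleFun (q : ℝ) (ζ : ℂ) : ℝ :=
  -(‖ζ‖ ^ q * Real.cos (min (q * Real.arccos (-ζ.re / ‖ζ‖)) π))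

theorem cos_arccos_neg_re (ζ : ℂ) : Real.cos (Real.arccos (-ζ.re / ‖ζ‖)) = -ζ.re / ‖ζ‖ := by
  have h := abs_le.1 (Complex.abs_re_div_norm_le_one ζ)
  rw [neg_div]
  exact Real.cos_arccos (by linarith) (by linarith)

theorem norm_mul_cos_arccos (ζ : ℂ) :
    ‖ζ‖ * Real.cos (Real.arccos (-ζ.re / ‖ζ‖)) = -ζ.re := by
  rw [cos_arccos_neg_re]
  rcases eq_or_ne ζ 0 with rfl | h
  · simp
  · rw [mul_div_cancel₀ _ (norm_ne_zero_iff.2 h)]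

theorem angleFun_one (ζ : ℂ) : angleFun 1 ζ = ζ.re := by
  unfold angleFun
  rw [one_mul, min_eq_left (Real.arccos_le_pi _), Real.rpow_one, norm_mul_cos_arccos, neg_neg]

theorem norm_add_conj_sq (z w : ℂ) :
    ‖z + conj w‖ ^ 2 = ‖z‖ ^ 2 + ‖w‖ ^ 2 + 2 * (z * w).re := by
  rw [← Complex.normSq_eq_norm_sq, ← Complex.normSq_eq_norm_sq, ← Complex.normSq_eq_norm_sq,
    Complex.normSq_add, Complex.conj_conj, Complex.normSq_conj]

theorem rpow_eq_sq_rpow {x : ℝ} (hx : 0 ≤ x) (p : ℝ) : x ^ p = (x ^ 2) ^ (p / 2) := by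
  rw [← Real.rpow_natCast, ← Real.rpow_mul hx]; congr 1; push_cast; ring

theorem convex_comb_between {ω u v : ℝ} (hω : 0 < ω) (hu : 0 ≤ u) (hv : 0 ≤ v) (huv : u + v = 1) :
    1 / max ω (1 / ω) ≤ u * ω + v * (1 / ω) ∧ u * ω + v * (1 / ω) ≤ max ω (1 / ω) := by
  have h1 : 1 / max ω (1 / ω) ≤ ω := by
    rw [one_div_le (by positivity) hω]; exact le_max_right _ _
  have h2 : 1 / max ω (1 / ω) ≤ 1 / ω := one_div_le_one_div_of_le hω (le_max_left _ _)
  have h3 := le_max_left ω (1 / ω)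
  have h4 := le_max_right ω (1 / ω)
  constructor
  · calc 1 / max ω (1 / ω) = u * (1 / max ω (1 / ω)) + v * (1 / max ω (1 / ω)) := by
          rw [← add_mul, huv, one_mul]
      _ ≤ _ := by gcongr
  · calc _ ≤ u * max ω (1 / ω) + v * max ω (1 / ω) := by gcongr
      _ = _ := by rw [← add_mul, huv, one_mul]

/-- The two-variable inequality in terms of the ratio `x = |z|/|w|` and the angle. -/
theorem ratio_inequality {q θ R x τ α β Z : ℝ} (hq : 1 < q) (hθ : q * θ = π / 2) (hR : 0 < R)
    (hα : α = 1 - Real.cos θ / R) (hβ : β = 1 - R * Real.cos θ) (hα0 : 0 < α) (hβ0 : 0 < β)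
    (hZ : Z = R + 1 / R - 2 * Real.cos θ) (hx : 0 < x) (hτ0 : 0 ≤ τ) (hτ1 : τ ≤ 2 * θ) :
    (α * x + β / x) ^ q ≤ (x + 1 / x - 2 * Real.cos τ) ^ q +
      2 * Real.sin θ * Z ^ (q - 1) * Real.cos (q * τ) ∧
    (θ < τ → (α * x + β / x) ^ q < (x + 1 / x - 2 * Real.cos τ) ^ q +
      2 * Real.sin θ * Z ^ (q - 1) * Real.cos (q * τ)) := by
  obtain ⟨t0, t1⟩ := angle_bounds hq hθ
  have sθ := Real.sin_pos_of_pos_of_lt_pi t0 (by linarith)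
  have cθ := Real.cos_pos_of_mem_Ioo ⟨by linarith, t1⟩
  have hZ' : Z = α * R + β / R := by rw [hZ, hα, hβ]; field_simp; ring
  have hZ0 : 0 < Z := by rw [hZ']; positivity
  set ω := x / R with hω
  have hω0 : 0 < ω := by positivity
  set Ω := max ω (1 / ω) with hΩ
  have hΩ1 : 1 ≤ Ω := by
    rcases le_total 1 ω with h | h
    · exact h.trans (le_max_left _ _)
    · exact ((one_le_div hω0).2 h).trans (le_max_right _ _)
  have hΩs : Ω + 1 / Ω = x / R + R / x := by
    have e : ω + 1 / ω = x / R + R / x := by rw [hω, one_div_div]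
    rcases le_total ω (1 / ω) with h | h
    · rw [hΩ, max_eq_right h, one_div_one_div, add_comm, e]
    · rw [hΩ, max_eq_left h, e]
  -- The weights αR/Z and β/(RZ) are positive and sum to 1, so the normalized quantity lies between
  -- 1/Ω and Ω.
  have hz : (α * x + β / x) / Z = α * R / Z * ω + β / R / Z * (1 / ω) := by
    rw [hω]; field_simp
  have hbetw := convex_comb_between hω0 (u := α * R / Z) (v := β / R / Z) (by positivity)
    (by positivity) (by rw [← add_div, ← hZ', div_self hZ0.ne'])
  rw [← hz, ← hΩ] at hbetw
  -- Positivity of α and β means cos θ < R and R cos θ < 1, which makes Z cos θ ≤ sin² θ.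
  have hs : 2 * Real.cos θ / Real.sin θ ^ 2 ≤ 2 / Z := by
    rw [div_le_div_iff₀ (by positivity) hZ0]
    have h1 : Real.cos θ ≤ R := by
      have : Real.cos θ / R < 1 := by linarith
      rw [div_lt_one hR] at this
      exact this.le
    have h2 : Real.cos θ * R ≤ 1 := by nlinarith
    have h3 : Real.cos θ * Z = Real.sin θ ^ 2 -
        (R - Real.cos θ) * (1 - Real.cos θ * R) / R := by
      rw [hZ, Real.sin_sq]; field_simp; ring
    have h4 : 0 ≤ (R - Real.cos θ) * (1 - Real.cos θ * R) / R :=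
      div_nonneg (mul_nonneg (by linarith) (by linarith)) hR.le
    linarith
  have hd : (α * x + β / x) / Z -
      2 / Z * (Real.cos τ - Real.cos θ * ((Ω + 1 / Ω) / 2)) =
      (x + 1 / x - 2 * Real.cos τ) / Z := by
    rw [hΩs, hα, hβ]; field_simp; ring
  have hd0 : 0 ≤ x + 1 / x - 2 * Real.cos τ := by
    have : x + 1 / x - 2 = (x - 1) ^ 2 / x := by field_simp; ring
    have h2 : 0 ≤ (x - 1) ^ 2 / x := by positivity
    linarith [Real.cos_le_one τ]
  have hmain := rpow_le_of_between hq hθ hτ0 hτ1 hΩ1 hbetw.1 hbetw.2 hs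
    (by rw [hd]; positivity)
  rw [hd] at hmain
  have hN0 : 0 ≤ α * x + β / x := by positivity
  have e1 : (α * x + β / x) ^ q = ((α * x + β / x) / Z) ^ q * Z ^ q := by
    rw [Real.div_rpow hN0 hZ0.le]; field_simp
  have e2 : (x + 1 / x - 2 * Real.cos τ) ^ q + 2 * Real.sin θ * Z ^ (q - 1) * Real.cos (q * τ) =
      (((x + 1 / x - 2 * Real.cos τ) / Z) ^ q + 2 / Z * Real.sin θ * Real.cos (q * τ)) *
        Z ^ q := by
    rw [Real.div_rpow hd0 hZ0.le, Real.rpow_sub_one hZ0.ne']; field_simp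
  rw [e1, e2]
  have hZq : 0 < Z ^ q := by positivity
  exact ⟨mul_le_mul_of_nonneg_right hmain.1 hZq.le,
    fun h => mul_lt_mul_of_pos_right (hmain.2 h) hZq⟩

set_option maxHeartbeats 1000000 in
-- For nonzero z, w, dividing by (|z||w|)^q turns the claim into `ratio_inequality` at x = |z|/|w|;
-- the constant B is the coefficient of the cosine there, multiplied by λ^q.
theorem pointwise_riesz_of_two_lt {p c : ℝ} (hp : 2 < p) (hc : 0 < c) :
    ∃ B : ℝ, 0 ≤ B ∧ ∀ z w : ℂ,
      (‖z‖ ^ 2 + c * ‖w‖ ^ 2) ^ (p / 2) + B * angleFun (p / 2) (z * w) ≤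
        rieszConst p c ^ p * ‖z + conj w‖ ^ p ∧
      ((‖z‖ ^ 2 + c * ‖w‖ ^ 2) ^ (p / 2) + B * angleFun (p / 2) (z * w) =
        rieszConst p c ^ p * ‖z + conj w‖ ^ p → (z = 0 ∧ w = 0) ∨ (z * w).re < 0) := by
  obtain ⟨hR, hl1, hlc, hα, hβ⟩ := extremal_relations hp hc
  have hl0 : 0 < rieszConst p c ^ 2 := by linarith
  rw [rpow_eq_sq_rpow (rieszConst_nonneg p c hc.le) p]
  simp only [fun z w : ℂ => rpow_eq_sq_rpow (norm_nonneg (z + conj w)) p]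
  have hpi := Real.pi_pos
  set q := p / 2 with hqdef
  have hq : 1 < q := by rw [hqdef]; linarith
  set θ := π / p with hθdef
  have hθ : q * θ = π / 2 := by rw [hqdef, hθdef]; field_simp
  obtain ⟨t0, t1⟩ := angle_bounds hq hθ
  have sθ := Real.sin_pos_of_pos_of_lt_pi t0 (by linarith)
  have cθ := Real.cos_pos_of_mem_Ioo ⟨by linarith, t1⟩
  set l := rieszConst p c ^ 2 with hl
  set R := extremalRadius p c with hRdef
  have hα0 : 0 < 1 / l := by positivity
  have hβ0 : 0 < c / l := by positivity
  set Z := R + 1 / R - 2 * Real.cos θ with hZdef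
  have hZ' : Z = 1 / l * R + c / l / R := by rw [hα, hβ, hZdef]; field_simp; ring
  have hZ0 : 0 < Z := by rw [hZ']; positivity
  refine ⟨2 * l ^ q * Real.sin θ * Z ^ (q - 1), by positivity, fun z w => ?_⟩
  rw [norm_add_conj_sq]
  by_cases hz : z = 0
  · subst hz
    by_cases hw : w = 0
    · subst hw
      simp [angleFun, Real.zero_rpow (by linarith : q ≠ 0)]
    · have hw' : 0 < ‖w‖ := norm_pos_iff.2 hw
      have h1 : (c * ‖w‖ ^ 2) ^ q < l ^ q * (‖w‖ ^ 2) ^ q := by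
        rw [← Real.mul_rpow (by positivity) (by positivity)]
        gcongr
      simp only [norm_zero, zero_mul, angleFun, Real.zero_rpow (by linarith : q ≠ 0), neg_zero,
        mul_zero, add_zero, Complex.zero_re, ne_eq, OfNat.ofNat_ne_zero, not_false_eq_true, zero_pow,
        zero_add]
      exact ⟨h1.le, fun h => absurd h h1.ne⟩
  by_cases hw : w = 0
  · subst hw
    have hz' : 0 < ‖z‖ := norm_pos_iff.2 hz
    have h1 : (‖z‖ ^ 2) ^ q < l ^ q * (‖z‖ ^ 2) ^ q := by
      rw [← Real.mul_rpow (by positivity) (by positivity)]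
      gcongr
      nlinarith [sq_nonneg ‖z‖, pow_pos hz' 2]
    simp only [norm_zero, mul_zero, angleFun, Real.zero_rpow (by linarith : q ≠ 0), neg_zero,
      zero_mul, add_zero, Complex.zero_re, ne_eq, OfNat.ofNat_ne_zero, not_false_eq_true, zero_pow]
    exact ⟨h1.le, fun h => absurd h h1.ne⟩
  have hr : 0 < ‖z‖ := norm_pos_iff.2 hz
  have hs : 0 < ‖w‖ := norm_pos_iff.2 hw
  have hτ := norm_mul_cos_arccos (z * w)
  unfold angleFun
  have hτ0 := Real.arccos_nonneg (-(z * w).re / ‖z * w‖)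
  have hτπ := Real.arccos_le_pi (-(z * w).re / ‖z * w‖)
  set τ := Real.arccos (-(z * w).re / ‖z * w‖) with hτdef
  rw [norm_mul] at hτ ⊢
  have hre : (z * w).re = -(‖z‖ * ‖w‖ * Real.cos τ) := by linarith
  rw [hre]
  have hmin0 : 0 ≤ min τ (2 * θ) := le_min hτ0 (by linarith)
  have hqmin : min (q * τ) π = q * min τ (2 * θ) := by
    rw [mul_min_of_nonneg _ _ (by linarith : 0 ≤ q)]
    congr 1
    linarith
  rw [hqmin]
  have hratio := ratio_inequality hq hθ hR hα hβ hα0 hβ0 hZdef (div_pos hr hs) hmin0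
    (min_le_right _ _)
  have hcos : Real.cos τ ≤ Real.cos (min τ (2 * θ)) :=
    Real.cos_le_cos_of_nonneg_of_le_pi hmin0 hτπ (min_le_left _ _)
  have hprod : 0 < ‖z‖ * ‖w‖ := by positivity
  have e1 : (‖z‖ ^ 2 + c * ‖w‖ ^ 2) ^ q =
      l ^ q * (‖z‖ * ‖w‖) ^ q * (1 / l * (‖z‖ / ‖w‖) + c / l / (‖z‖ / ‖w‖)) ^ q := by
    rw [← Real.mul_rpow (by positivity) (by positivity),
      ← Real.mul_rpow (by positivity) (by positivity)]
    congr 1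
    field_simp
  have hd0 : 0 ≤ ‖z‖ / ‖w‖ + 1 / (‖z‖ / ‖w‖) - 2 * Real.cos (min τ (2 * θ)) := by
    have : ‖z‖ / ‖w‖ + 1 / (‖z‖ / ‖w‖) - 2 = (‖z‖ - ‖w‖) ^ 2 / (‖z‖ * ‖w‖) := by
      field_simp; ring
    have h2 : 0 ≤ (‖z‖ - ‖w‖) ^ 2 / (‖z‖ * ‖w‖) := by positivity
    linarith [Real.cos_le_one (min τ (2 * θ))]
  -- Beyond the angle 2θ the function `angleFun` no longer depends on the angle, while |z + w̄|
  -- keeps growing, so it is enough to treat the angle clipped at 2θ.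
  have e2 : (‖z‖ * ‖w‖) ^ q *
      (‖z‖ / ‖w‖ + 1 / (‖z‖ / ‖w‖) - 2 * Real.cos (min τ (2 * θ))) ^ q ≤
      (‖z‖ ^ 2 + ‖w‖ ^ 2 + 2 * -(‖z‖ * ‖w‖ * Real.cos τ)) ^ q := by
    rw [← Real.mul_rpow (by positivity) hd0]
    apply Real.rpow_le_rpow (by positivity) _ (by linarith)
    have : ‖z‖ * ‖w‖ * (‖z‖ / ‖w‖ + 1 / (‖z‖ / ‖w‖) - 2 * Real.cos (min τ (2 * θ))) =
        ‖z‖ ^ 2 + ‖w‖ ^ 2 - 2 * (‖z‖ * ‖w‖ * Real.cos (min τ (2 * θ))) := by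
      field_simp
    rw [this]
    nlinarith [mul_le_mul_of_nonneg_left hcos hprod.le]
  have hk : 0 < l ^ q * (‖z‖ * ‖w‖) ^ q := by positivity
  have e3 := mul_le_mul_of_nonneg_left e2 (by positivity : 0 ≤ l ^ q)
  rw [e1]
  constructor
  · have e4 := mul_le_mul_of_nonneg_left hratio.1 hk.le
    linarith
  · intro heq
    right
    by_contra! hcon
    -- If Re(zw) ≥ 0, then τ ≥ π/2 > θ, and there the ratio inequality is strict.
    have hcτ : Real.cos τ ≤ 0 := by
      by_contra! h
      have := mul_pos hprod h
      linarith
    have hlt : θ < min τ (2 * θ) := by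
      refine lt_min ?_ (by linarith)
      by_contra! h
      have := Real.cos_le_cos_of_nonneg_of_le_pi hτ0 (by linarith) h
      linarith
    have e4 := mul_lt_mul_of_pos_left (hratio.2 hlt) hk
    linarith

theorem pointwise_riesz {p c : ℝ} (hp : 2 ≤ p) (hc : 0 < c) :
    ∃ B : ℝ, 0 ≤ B ∧ ∀ z w : ℂ,
      (‖z‖ ^ 2 + c * ‖w‖ ^ 2) ^ (p / 2) + B * angleFun (p / 2) (z * w) ≤
        rieszConst p c ^ p * ‖z + conj w‖ ^ p ∧
      (2 < p → (‖z‖ ^ 2 + c * ‖w‖ ^ 2) ^ (p / 2) + B * angleFun (p / 2) (z * w) =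
        rieszConst p c ^ p * ‖z + conj w‖ ^ p → (z = 0 ∧ w = 0) ∨ (z * w).re < 0) := by
  rcases hp.eq_or_lt with rfl | hp
  -- For p = 2 the auxiliary function is Re(zw), and expanding |z + w̄|² leaves |z|² + c|w|² ≤
  -- max(1, c)(|z|² + |w|²).
  · refine ⟨2 * max 1 c, by positivity, fun z w => ⟨?_, fun h => absurd h (lt_irrefl _)⟩⟩
    rw [rpow_eq_sq_rpow (rieszConst_nonneg 2 c hc.le), rpow_eq_sq_rpow (norm_nonneg (z + conj w)),
      norm_add_conj_sq, rieszConst_sq_two hc, div_self (by norm_num), angleFun_one,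
      Real.rpow_one, Real.rpow_one, Real.rpow_one]
    nlinarith [mul_le_mul_of_nonneg_right (le_max_left 1 c) (sq_nonneg ‖z‖),
      mul_le_mul_of_nonneg_right (le_max_right 1 c) (sq_nonneg ‖w‖)]
  · obtain ⟨B, hB, h⟩ := pointwise_riesz_of_two_lt hp hc
    exact ⟨B, hB, fun z w => ⟨(h z w).1, fun _ => (h z w).2⟩⟩

/-! ### Subharmonicity -/

/-- Near `ζ₀`, the function `V` dominates the real part of a holomorphic function, with equality
at `ζ₀`. -/
def HasHolomorphicSupport (V : ℂ → ℝ) (ζ₀ : ℂ) : Prop :=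
  ∃ L : ℂ → ℂ, (∀ᶠ ζ in 𝓝 ζ₀, DifferentiableAt ℂ L ζ) ∧ (∀ᶠ ζ in 𝓝 ζ₀, (L ζ).re ≤ V ζ) ∧
    (L ζ₀).re = V ζ₀

theorem arccos_eq_abs_arg {ζ : ℂ} (h : ζ ≠ 0) :
    Real.arccos (-ζ.re / ‖ζ‖) = |(-ζ).arg| := by
  have h1 : Real.cos |(-ζ).arg| = -ζ.re / ‖ζ‖ := by
    rw [Real.cos_abs, Complex.cos_arg (neg_ne_zero.2 h), norm_neg, Complex.neg_re]
  rw [← h1, Real.arccos_cos (abs_nonneg _) (Complex.abs_arg_le_pi _)]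

theorem continuousAt_arccos_re {ζ : ℂ} (h : ζ ≠ 0) :
    ContinuousAt (fun ζ : ℂ => Real.arccos (-ζ.re / ‖ζ‖)) ζ :=
  Real.continuous_arccos.continuousAt.comp
    ((Complex.continuous_re.neg.continuousAt).div continuous_norm.continuousAt
      (norm_ne_zero_iff.2 h))

theorem abs_angleFun_le (q : ℝ) (ζ : ℂ) : |angleFun q ζ| ≤ ‖ζ‖ ^ q := by
  unfold angleFun
  rw [abs_neg, abs_mul, abs_of_nonneg (by positivity)]
  exact mul_le_of_le_one_right (by positivity) (Real.abs_cos_le_one _)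

theorem continuous_angleFun {q : ℝ} (hq : 0 < q) : Continuous (angleFun q) := by
  rw [continuous_iff_continuousAt]
  intro ζ
  rcases eq_or_ne ζ 0 with rfl | h
  · have h0 : angleFun q 0 = 0 := by simp [angleFun, Real.zero_rpow hq.ne']
    rw [ContinuousAt, h0]
    apply squeeze_zero_norm (fun z => abs_angleFun_le q z)
    have : Tendsto (fun z : ℂ => ‖z‖ ^ q) (𝓝 0) (𝓝 (‖(0:ℂ)‖ ^ q)) :=
      ((Real.continuous_rpow_const hq.le).comp continuous_norm).tendsto 0
    simpa [Real.zero_rpow hq.ne'] using this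
  · unfold angleFun
    refine (ContinuousAt.mul ?_ ?_).neg
    · exact ((Real.continuous_rpow_const hq.le).comp continuous_norm).continuousAt
    · exact Real.continuous_cos.continuousAt.comp
        (((continuousAt_arccos_re h).const_mul q).min continuousAt_const)

theorem cos_min_le (t : ℝ) : Real.cos (min t π) ≤ Real.cos t := by
  rcases le_total t π with h | h
  · rw [min_eq_left h]
  · rw [min_eq_right h, Real.cos_pi]; exact Real.neg_one_le_cos t

/-- In the closed sector the support is −(−ζ)^q, since clipping an angle at π only lowers its
cosine. Outside it is |ζ₀|^q (ζ/ζ₀)^q, whose real part is at most its modulus |ζ|^q. -/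
theorem hasHolomorphicSupport_angleFun {q : ℝ} (hq : 1 < q) {ζ₀ : ℂ} (h0 : ζ₀ ≠ 0) :
    HasHolomorphicSupport (angleFun q) ζ₀ := by
  rcases le_or_gt (q * Real.arccos (-ζ₀.re / ‖ζ₀‖)) π with h | h
  · have hre : ∀ ζ : ℂ, (-((-ζ) ^ (q : ℂ))).re = -(‖ζ‖ ^ q * Real.cos (q * (-ζ).arg)) := by
      intro ζ
      rw [Complex.neg_re, Complex.cpow_ofReal_re, norm_neg, mul_comm q]
    have habs : ∀ ζ : ℂ, Real.cos (q * (-ζ).arg) = Real.cos (q * |(-ζ).arg|) := by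
      intro ζ
      rw [← Real.cos_abs, abs_mul, abs_of_pos (by linarith : 0 < q)]
    have hslit : -ζ₀ ∈ slitPlane := by
      rw [Complex.mem_slitPlane_iff_arg]
      refine ⟨fun hpi => ?_, neg_ne_zero.2 h0⟩
      rw [arccos_eq_abs_arg h0, hpi, abs_of_pos Real.pi_pos] at h
      nlinarith [Real.pi_pos]
    refine ⟨fun ζ => -((-ζ) ^ (q : ℂ)), ?_, ?_, ?_⟩
    · have : ∀ᶠ ζ in 𝓝 ζ₀, -ζ ∈ slitPlane :=
        (continuous_neg.continuousAt (x := ζ₀)).eventually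
          (Complex.isOpen_slitPlane.mem_nhds hslit)
      filter_upwards [this] with ζ hζ
      exact (differentiableAt_id.neg.cpow_const (c := (q : ℂ)) hζ).neg
    · filter_upwards [isOpen_ne.mem_nhds h0] with ζ hζ
      rw [hre, habs]
      unfold angleFun
      rw [arccos_eq_abs_arg hζ, neg_le_neg_iff]
      exact mul_le_mul_of_nonneg_left (cos_min_le _) (by positivity)
    · rw [hre, habs]
      unfold angleFun
      rw [min_eq_left h, arccos_eq_abs_arg h0]
  · have hV : ∀ ζ : ℂ, π < q * Real.arccos (-ζ.re / ‖ζ‖) → angleFun q ζ = ‖ζ‖ ^ q := by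
      intro ζ hζ
      unfold angleFun
      rw [min_eq_right hζ.le, Real.cos_pi]; ring
    refine ⟨fun ζ => ((‖ζ₀‖ ^ q : ℝ) : ℂ) * (ζ / ζ₀) ^ (q : ℂ), ?_, ?_, ?_⟩
    · have : ∀ᶠ ζ in 𝓝 ζ₀, ζ / ζ₀ ∈ slitPlane := by
        have hc : ContinuousAt (fun ζ => ζ / ζ₀) ζ₀ := by fun_prop
        apply hc.eventually (Complex.isOpen_slitPlane.mem_nhds _)
        simp only [div_self h0]; exact Complex.one_mem_slitPlane
      filter_upwards [this] with ζ hζ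
      exact ((differentiableAt_id.div_const ζ₀).cpow_const (c := (q : ℂ)) hζ).const_mul _
    · have : ∀ᶠ ζ in 𝓝 ζ₀, π < q * Real.arccos (-ζ.re / ‖ζ‖) :=
        ((continuousAt_arccos_re h0).const_mul q).eventually (lt_mem_nhds h)
      filter_upwards [this] with ζ hζ
      rw [hV ζ hζ]
      refine (Complex.re_le_norm _).trans ?_
      have h1 : 0 < ‖ζ₀‖ := norm_pos_iff.2 h0
      rw [norm_mul, Complex.norm_real, Complex.norm_cpow_real, norm_div,
        Real.norm_of_nonneg (by positivity), Real.div_rpow (norm_nonneg _) h1.le,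
        mul_div_cancel₀ _ (by positivity)]
    · beta_reduce
      rw [hV ζ₀ h, div_self h0, Complex.one_cpow, mul_one, Complex.ofReal_re]

/-- A maximum principle for `V ∘ F - Re Q`, off the zeros of `F`. -/
theorem le_re_of_lt_on_sphere {V : ℂ → ℝ} (hV : Continuous V)
    (hS : ∀ ζ, ζ ≠ 0 → HasHolomorphicSupport V ζ) {F Q : ℂ → ℂ} {U : Set ℂ} (hU : IsOpen U)
    (hF : DifferentiableOn ℂ F U) (hQ : Differentiable ℂ Q) {r : ℝ}
    (hr : Metric.closedBall 0 r ⊆ U)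
    (hlt : ∀ z ∈ Metric.sphere (0 : ℂ) r, V (F z) < (Q z).re) {z₀ : ℂ}
    (hz₀ : z₀ ∈ Metric.ball (0 : ℂ) r) (hF0 : F z₀ ≠ 0) : V (F z₀) ≤ (Q z₀).re := by
  by_contra! hcon
  have hKc : IsCompact (Metric.closedBall (0 : ℂ) r) := isCompact_closedBall _ _
  have hFc : ContinuousOn F (Metric.closedBall 0 r) := hF.continuousOn.mono hr
  have hwc : ContinuousOn (fun z => V (F z) - (Q z).re) (Metric.closedBall 0 r) :=
    (hV.comp_continuousOn hFc).sub (Complex.continuous_re.comp hQ.continuous).continuousOn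
  obtain ⟨M₀, hM₀⟩ := hKc.exists_bound_of_continuousOn hFc
  obtain ⟨W₀, hW₀⟩ := hKc.exists_bound_of_continuousOn hwc
  set M := max M₀ 1 with hM
  have hM0 : 0 < M := lt_of_lt_of_le one_pos (le_max_right _ _)
  have hFM : ∀ z ∈ Metric.closedBall (0 : ℂ) r, ‖F z‖ ≤ M := fun z hz =>
    (hM₀ z hz).trans (le_max_left _ _)
  have hz₀' := Metric.ball_subset_closedBall hz₀
  have hw0 : 0 < V (F z₀) - (Q z₀).re := by linarith
  have hN0 : 0 < ‖F z₀‖ := norm_pos_iff.2 hF0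
  have hlogle : ∀ z ∈ Metric.closedBall (0 : ℂ) r, Real.log ‖F z‖ - Real.log M ≤ 0 := by
    intro z hz
    rcases eq_or_ne (F z) 0 with h | h
    · rw [h, norm_zero, Real.log_zero, zero_sub, neg_nonpos]
      exact Real.log_nonneg (le_max_right _ _)
    · exact sub_nonpos.2 (Real.log_le_log (norm_pos_iff.2 h) (hFM z hz))
  -- A small multiple of log(|F|/M) ≤ 0 pushes the function down near the zeros of F, where no
  -- support is available, yet keeps it positive at z₀.
  obtain ⟨ε, hε, hε1⟩ : ∃ ε > 0,
      0 < V (F z₀) - (Q z₀).re + ε * (Real.log ‖F z₀‖ - Real.log M) := by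
    have h1 := hlogle z₀ hz₀'
    refine ⟨(V (F z₀) - (Q z₀).re) / (2 * (1 - (Real.log ‖F z₀‖ - Real.log M))),
      by apply div_pos hw0; linarith, ?_⟩
    set a := V (F z₀) - (Q z₀).re
    set b := Real.log ‖F z₀‖ - Real.log M
    have h2 : a + a / (2 * (1 - b)) * b = a * (2 - b) / (2 * (1 - b)) := by
      have : (1 - b) ≠ 0 := by linarith
      field_simp
      ring
    rw [h2]
    apply div_pos <;> nlinarith
  set Ψ : ℂ → ℝ := fun z => V (F z) - (Q z).re + ε * (Real.log ‖F z‖ - Real.log M) with hΨ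
  -- Where 0 < |F| ≤ η, the logarithmic term is at most −|W₀|, which cancels the bound for V ∘ F −
  -- Re Q.
  set η := M * Real.exp (-|W₀| / ε) with hη
  have hη0 : 0 < η := by positivity
  have hsmall : ∀ z ∈ Metric.closedBall (0 : ℂ) r, F z ≠ 0 → ‖F z‖ ≤ η → Ψ z ≤ 0 := by
    intro z hz hne hle
    have h1 := Real.log_le_log (norm_pos_iff.2 hne) hle
    rw [hη, Real.log_mul hM0.ne' (Real.exp_pos _).ne', Real.log_exp] at h1
    have h2 := (le_abs_self _).trans ((hW₀ z hz).trans (le_abs_self _))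
    have h3 : ε * (Real.log ‖F z‖ - Real.log M) ≤ ε * (-|W₀| / ε) :=
      mul_le_mul_of_nonneg_left (by linarith) hε.le
    rw [mul_div_cancel₀ _ hε.ne'] at h3
    simp only [hΨ]
    linarith
  set K := Metric.closedBall (0 : ℂ) r ∩ (fun z => ‖F z‖) ⁻¹' Ici η with hK
  have hKcomp : IsCompact K := by
    refine hKc.of_isClosed_subset ?_ inter_subset_left
    exact hFc.norm.preimage_isClosed_of_isClosed Metric.isClosed_closedBall isClosed_Ici
  have hKne : ∀ z ∈ K, F z ≠ 0 := fun z hz =>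
    norm_pos_iff.1 (hη0.trans_le hz.2)
  have hΨc : ContinuousOn Ψ K := by
    refine (hwc.mono inter_subset_left).add (ContinuousOn.mul continuousOn_const
      (ContinuousOn.sub (ContinuousOn.log ((hFc.mono inter_subset_left).norm) ?_)
        continuousOn_const))
    exact fun z hz => norm_ne_zero_iff.2 (hKne z hz)
  have hz₀K : z₀ ∈ K := by
    refine ⟨hz₀', ?_⟩
    by_contra h
    exact absurd (hsmall z₀ hz₀' hF0 (not_le.1 h).le) (not_le.2 hε1)
  obtain ⟨z₁, hz₁, hmax⟩ := hKcomp.exists_isMaxOn ⟨z₀, hz₀K⟩ hΨc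
  have hm0 : 0 < Ψ z₁ := hε1.trans_le (hmax hz₀K)
  have hK1 : IsCompact (K ∩ Ψ ⁻¹' {Ψ z₁}) :=
    hKcomp.of_isClosed_subset (hΨc.preimage_isClosed_of_isClosed hKcomp.isClosed
      isClosed_singleton) inter_subset_left
  -- Among the maximum points take one of largest modulus. The strong maximum principle will make Ψ
  -- constant around it, so |z| would have a local maximum there, which is absurd.
  obtain ⟨z₂, ⟨hz₂, hz₂m⟩, hmax2⟩ := hK1.exists_isMaxOn ⟨z₁, hz₁, rfl⟩
    continuous_norm.continuousOn
  have hz₂m : Ψ z₂ = Ψ z₁ := hz₂m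
  have hz₂b : z₂ ∈ Metric.ball (0 : ℂ) r := by
    rcases (mem_closedBall_zero_iff.1 hz₂.1).lt_or_eq with h | h
    · exact mem_ball_zero_iff.2 h
    · exfalso
      have h1 := hlt z₂ (mem_sphere_zero_iff_norm.2 h)
      have h2 := mul_nonpos_of_nonneg_of_nonpos hε.le (hlogle z₂ hz₂.1)
      have h3 : Ψ z₂ ≤ 0 := by simp only [hΨ]; linarith
      linarith
  have hFz₂ : F z₂ ≠ 0 := hKne z₂ hz₂
  have hηlt : η < ‖F z₂‖ := by
    by_contra! h
    have := hsmall z₂ hz₂.1 hFz₂ h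
    linarith
  have hUnhds : ∀ᶠ z in 𝓝 z₂, z ∈ U := hU.mem_nhds (hr hz₂.1)
  have hFat : ContinuousAt F z₂ := (hF.differentiableAt (hU.mem_nhds (hr hz₂.1))).continuousAt
  have hKnhds : ∀ᶠ z in 𝓝 z₂, z ∈ K := by
    filter_upwards [Metric.isOpen_ball.mem_nhds hz₂b, hFat.norm.eventually (lt_mem_nhds hηlt)]
      with z h1 h2
    exact ⟨Metric.ball_subset_closedBall h1, h2.le⟩
  obtain ⟨L, hL1, hL2, hL3⟩ := hS (F z₂) hFz₂
  set H : ℂ → ℂ := fun z => L (F z) - Q z + ε * Complex.log (F z / F z₂) with hH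
  have hslit : ∀ᶠ z in 𝓝 z₂, F z / F z₂ ∈ slitPlane := by
    apply (hFat.div_const (F z₂)).eventually (Complex.isOpen_slitPlane.mem_nhds _)
    simp only [div_self hFz₂]; exact Complex.one_mem_slitPlane
  have hHd : ∀ᶠ z in 𝓝 z₂, DifferentiableAt ℂ (fun z => Complex.exp (H z)) z := by
    filter_upwards [hUnhds, hslit, hFat.eventually hL1] with z h1 h2 h3
    have hFd := hF.differentiableAt (hU.mem_nhds h1)
    exact ((((h3.comp z hFd).sub hQ.differentiableAt).add
      (((hFd.div_const _).clog h2).const_mul _))).cexp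
  have hHre : ∀ z, F z ≠ 0 → (H z).re =
      (L (F z)).re - (Q z).re + ε * (Real.log ‖F z‖ - Real.log ‖F z₂‖) := by
    intro z hz
    simp only [hH, Complex.add_re, Complex.sub_re, Complex.re_ofReal_mul, Complex.log_re,
      norm_div]
    rw [Real.log_div (norm_ne_zero_iff.2 hz) (norm_ne_zero_iff.2 hFz₂)]
  have hHle : ∀ᶠ z in 𝓝 z₂, (H z).re + ε * (Real.log ‖F z₂‖ - Real.log M) ≤ Ψ z := by
    filter_upwards [hKnhds, hFat.eventually hL2] with z h1 h2
    rw [hHre z (hKne z h1)]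
    simp only [hΨ]
    linarith
  have hHeq : (H z₂).re + ε * (Real.log ‖F z₂‖ - Real.log M) = Ψ z₂ := by
    rw [hHre z₂ hFz₂, hL3]
    simp only [hΨ]
    ring
  -- Since |exp H| = exp(Re H), the maximum modulus principle applies to the support of Ψ.
  have hloc : IsLocalMax (norm ∘ fun z => Complex.exp (H z)) z₂ := by
    filter_upwards [hKnhds, hHle] with z h1 h2
    simp only [Function.comp, Complex.norm_exp]
    apply Real.exp_le_exp.2
    have := hmax h1
    simp only [mem_ofPred_eq] at this
    linarith
  have hconst := Complex.eventually_eq_of_isLocalMax_norm hHd hloc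
  have hloc2 : IsLocalMax (norm ∘ fun z : ℂ => z) z₂ := by
    filter_upwards [hKnhds, hHle, hconst] with z h1 h2 h3
    have h4 : (H z).re = (H z₂).re := by
      have := congrArg norm h3
      simp only [Complex.norm_exp] at this
      exact Real.exp_injective this
    have h5 := hmax h1
    simp only [mem_ofPred_eq] at h5
    exact hmax2 ⟨h1, show Ψ z = Ψ z₁ by linarith⟩
  have hid := Complex.eventually_eq_of_isLocalMax_norm
    (Eventually.of_forall fun z => differentiableAt_id) hloc2
  have := (hid.filter_mono (nhdsWithin_le_nhds (s := {z₂}ᶜ))).and self_mem_nhdsWithin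
  obtain ⟨z, h1, h2⟩ := this.exists
  exact h2 h1

/-- Real parts of polynomials are dense in the continuous real functions on a circle. -/
theorem exists_entire_re_approx {u : ℂ → ℝ} {r : ℝ} (hr : 0 < r)
    (hu : ContinuousOn u (Metric.sphere 0 r)) {ε : ℝ} (hε : 0 < ε) :
    ∃ Q : ℂ → ℂ, Differentiable ℂ Q ∧ ∀ z ∈ Metric.sphere (0 : ℂ) r, |u z - (Q z).re| < ε := by
  have : Fact (0 < 2 * π) := ⟨Real.two_pi_pos⟩
  have hmem : ∀ x : AddCircle (2 * π), (r : ℂ) * (x.toCircle : ℂ) ∈ Metric.sphere (0 : ℂ) r := by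
    intro x
    rw [mem_sphere_zero_iff_norm, norm_mul, Circle.norm_coe, Complex.norm_real,
      Real.norm_of_nonneg hr.le, mul_one]
  have hcont : Continuous fun x : AddCircle (2 * π) => ((u (r * (x.toCircle : ℂ)) : ℝ) : ℂ) := by
    refine Complex.continuous_ofReal.comp (hu.comp_continuous ?_ hmem)
    exact continuous_const.mul (by fun_prop)
  let φ : C(AddCircle (2 * π), ℂ) := ⟨_, hcont⟩
  have hφ : φ ∈ (Submodule.span ℂ (Set.range (fourier (T := 2 * π)))).topologicalClosure := by
    rw [span_fourier_closure_eq_top]; trivial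
  obtain ⟨ψ, hψ, hdist⟩ := Metric.mem_closure_iff.1 hφ ε hε
  have hrep : ∃ Q₁ Q₂ : ℂ → ℂ, Differentiable ℂ Q₁ ∧ Differentiable ℂ Q₂ ∧
      ∀ x, ψ x = Q₁ (x.toCircle : ℂ) + conj (Q₂ (x.toCircle : ℂ)) := by
    clear hdist
    induction hψ using Submodule.span_induction with
    | mem f hf =>
      obtain ⟨n, rfl⟩ := hf
      rcases n with n | n
      · refine ⟨fun z => z ^ n, fun _ => 0, by fun_prop, by fun_prop, fun x => ?_⟩
        simp [fourier_apply, AddCircle.toCircle_nsmul]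
      · refine ⟨fun _ => 0, fun z => z ^ (n + 1), by fun_prop, by fun_prop, fun x => ?_⟩
        rw [fourier_apply, AddCircle.toCircle_zsmul, zpow_negSucc, zero_add, map_pow,
          ← Circle.coe_inv_eq_conj]
        simp
    | zero => exact ⟨fun _ => 0, fun _ => 0, by fun_prop, by fun_prop, fun x => by simp⟩
    | add f g _ _ hf hg =>
      obtain ⟨P, P', h1, h2, h3⟩ := hf
      obtain ⟨R, R', h4, h5, h6⟩ := hg
      refine ⟨fun z => P z + R z, fun z => P' z + R' z, h1.add h4, h2.add h5, fun x => ?_⟩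
      rw [ContinuousMap.add_apply, h3, h6, map_add]; ring
    | smul a f _ hf =>
      obtain ⟨P, P', h1, h2, h3⟩ := hf
      refine ⟨fun z => a * P z, fun z => conj a * P' z, h1.const_mul _, h2.const_mul _,
        fun x => ?_⟩
      rw [ContinuousMap.smul_apply, h3, map_mul, Complex.conj_conj, smul_eq_mul]; ring
  obtain ⟨Q₁, Q₂, hQ₁, hQ₂, hrep⟩ := hrep
  -- The negative frequencies are conjugates of polynomials on the circle, and conjugation does not
  -- change the real part.
  refine ⟨fun z => Q₁ (z / r) + Q₂ (z / r), by fun_prop, fun z hz => ?_⟩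
  have hr' : (r : ℂ) ≠ 0 := Complex.ofReal_ne_zero.2 hr.ne'
  obtain ⟨x, hx⟩ : ∃ x : AddCircle (2 * π), (x.toCircle : ℂ) = z / r := by
    refine ⟨((z / r).arg : ℝ), ?_⟩
    rw [AddCircle.toCircle_apply_mk, div_self Real.two_pi_pos.ne', one_mul, Circle.coe_exp]
    have hn : ‖z / r‖ = 1 := by
      rw [norm_div, mem_sphere_zero_iff_norm.1 hz, Complex.norm_real, Real.norm_of_nonneg hr.le,
        div_self hr.ne']
    have := Complex.norm_mul_exp_arg_mul_I (z / r)
    rwa [hn, Complex.ofReal_one, one_mul] at this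
  have h1 : dist (φ x) (ψ x) < ε := (ContinuousMap.dist_apply_le_dist x).trans_lt hdist
  have hz' : (r : ℂ) * (z / r) = z := mul_div_cancel₀ _ hr'
  have h2 : φ x = (u z : ℂ) := by
    change ((u (r * (x.toCircle : ℂ)) : ℝ) : ℂ) = _
    rw [hx, hz']
  rw [h2, hrep, hx, dist_eq_norm] at h1
  refine lt_of_le_of_lt ?_ h1
  have h3 := Complex.abs_re_le_norm ((u z : ℂ) - (Q₁ (z / r) + conj (Q₂ (z / r))))
  simpa using h3

theorem DiffContOnCl.circleAverage_re {F : ℂ → ℂ} {r : ℝ} (hr : 0 ≤ r)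
    (hF : DiffContOnCl ℂ F (Metric.ball 0 r)) (hc : ContinuousOn F (Metric.closedBall 0 r)) :
    Real.circleAverage (fun z => (F z).re) 0 r = (F 0).re := by
  have h1 : CircleIntegrable F 0 r :=
    (hc.mono Metric.sphere_subset_closedBall).circleIntegrable hr
  have h2 := Complex.reCLM.circleAverage_comp_comm h1
  have h3 : Real.circleAverage F 0 r = F 0 := DiffContOnCl.circleAverage (by rwa [abs_of_nonneg hr])
  rw [h3] at h2
  exact h2

/-- Squeeze the real part of an entire Q between V ∘ F and V ∘ F + ε on the circle; the maximum
principle compares V ∘ F with Re Q inside, and Re Q has the mean value property. -/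
theorem le_circleAverage_comp {V : ℂ → ℝ} (hV : Continuous V)
    (hS : ∀ ζ, ζ ≠ 0 → HasHolomorphicSupport V ζ) {F : ℂ → ℂ} {R : ℝ}
    (hF : DifferentiableOn ℂ F (Metric.ball 0 R)) {r : ℝ} (hr0 : 0 < r) (hr : r < R) :
    V (F 0) ≤ Real.circleAverage (fun z => V (F z)) 0 r := by
  have hsub : Metric.closedBall (0 : ℂ) r ⊆ Metric.ball 0 R := Metric.closedBall_subset_ball hr
  have h0R : (0 : ℂ) ∈ Metric.ball 0 R := Metric.mem_ball_self (hr0.trans hr)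
  have hFc : ContinuousOn F (Metric.sphere 0 r) :=
    hF.continuousOn.mono (Metric.sphere_subset_closedBall.trans hsub)
  have hVF : ContinuousOn (fun z => V (F z)) (Metric.sphere 0 r) := hV.comp_continuousOn hFc
  have hFan := hF.analyticOnNhd Metric.isOpen_ball
  by_cases hzero : ∀ᶠ z in 𝓝 (0 : ℂ), F z = 0
  · have h1 := hFan.eqOn_zero_of_preconnected_of_eventuallyEq_zero
      (convex_ball (0 : ℂ) R).isPreconnected h0R hzero
    have h2 : Real.circleAverage (fun z => V (F z)) 0 r = V 0 := by
      apply Real.circleAverage_const_on_circle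
      intro z hz
      rw [abs_of_pos hr0] at hz
      rw [h1 (hsub (Metric.sphere_subset_closedBall hz))]
      rfl
    rw [h2, h1 h0R]
    rfl
  have hne : ∀ᶠ z in 𝓝[≠] (0 : ℂ), F z ≠ 0 :=
    (hFan 0 h0R).eventually_eq_zero_or_eventually_ne_zero.resolve_left hzero
  apply le_of_forall_pos_le_add
  intro ε hε
  obtain ⟨Q, hQ, hQu⟩ := exists_entire_re_approx (u := fun z => V (F z) + ε / 2) hr0
    (hVF.add continuousOn_const) (half_pos hε)
  have hlt : ∀ z ∈ Metric.sphere (0 : ℂ) r, V (F z) < (Q z).re := fun z hz => by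
    have := (abs_lt.1 (hQu z hz)).2
    linarith
  have hgt : ∀ z ∈ Metric.sphere (0 : ℂ) r, (Q z).re ≤ V (F z) + ε := fun z hz => by
    have := (abs_lt.1 (hQu z hz)).1
    linarith
  -- F may vanish at 0, so the comparison is made at nearby points with F ≠ 0 and carried to 0 by
  -- continuity.
  have h0 : V (F 0) ≤ (Q 0).re := by
    have hFat : ContinuousAt F 0 :=
      (hF.differentiableAt (Metric.isOpen_ball.mem_nhds h0R)).continuousAt
    have t1 : Tendsto (fun z => V (F z)) (𝓝[≠] 0) (𝓝 (V (F 0))) :=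
      (hV.continuousAt.comp hFat).tendsto.mono_left nhdsWithin_le_nhds
    have t2 : Tendsto (fun z => (Q z).re) (𝓝[≠] 0) (𝓝 ((Q 0).re)) :=
      ((Complex.continuous_re.comp hQ.continuous).tendsto 0).mono_left nhdsWithin_le_nhds
    refine le_of_tendsto_of_tendsto t1 t2 ?_
    filter_upwards [hne, nhdsWithin_le_nhds (Metric.ball_mem_nhds (0 : ℂ) hr0)] with z h1 h2
    exact le_re_of_lt_on_sphere hV hS Metric.isOpen_ball hF hQ hsub hlt h2 h1
  have hcV : CircleIntegrable (fun z => V (F z)) 0 r := hVF.circleIntegrable hr0.le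
  have hcC : CircleIntegrable (fun _ : ℂ => ε) 0 r := circleIntegrable_const _ _ _
  calc V (F 0) ≤ (Q 0).re := h0
    _ = Real.circleAverage (fun z => (Q z).re) 0 r :=
      (DiffContOnCl.circleAverage_re hr0.le hQ.diffContOnCl hQ.continuous.continuousOn).symm
    _ ≤ Real.circleAverage (fun z => V (F z) + ε) 0 r := by
      apply Real.circleAverage_mono
      · exact (Complex.continuous_re.comp hQ.continuous).continuousOn.circleIntegrable hr0.le
      · exact (hVF.add continuousOn_const).circleIntegrable hr0.le
      · intro z hz
        rw [abs_of_pos hr0] at hz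
        exact hgt z hz
    _ = Real.circleAverage (fun z => V (F z)) 0 r + ε := by
      rw [Real.circleAverage_fun_add hcV hcC, Real.circleAverage_const]

theorem angleFun_le_circleAverage {q : ℝ} (hq : 1 ≤ q) {F : ℂ → ℂ}
    (hF : DifferentiableOn ℂ F unitDisk) {r : ℝ} (hr0 : 0 < r) (hr : r < 1) :
    angleFun q (F 0) ≤ Real.circleAverage (fun z => angleFun q (F z)) 0 r := by
  rcases hq.eq_or_lt with rfl | hq
  · simp only [angleFun_one]
    have hsub : Metric.closedBall (0 : ℂ) r ⊆ unitDisk := Metric.closedBall_subset_ball hr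
    exact (DiffContOnCl.circleAverage_re hr0.le
      (DifferentiableOn.diffContOnCl_ball (U := unitDisk) hF hsub) (hF.continuousOn.mono hsub)).ge
  · exact le_circleAverage_comp (continuous_angleFun (by linarith))
      (fun ζ hζ => hasHolomorphicSupport_angleFun hq hζ) hF hr0 hr

/-! ### The Poisson kernel and radial limits of Poisson integrals -/

/-- The Poisson kernel of the unit disk in polar form. -/
noncomputable def diskKernel (r s : ℝ) : ℝ := (1 - r ^ 2) / (1 - 2 * r * Real.cos s + r ^ 2)

theorem diskKernel_den_pos {r : ℝ} (h0 : 0 ≤ r) (h1 : r < 1) (s : ℝ) :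
    0 < 1 - 2 * r * Real.cos s + r ^ 2 := by
  nlinarith [mul_le_mul_of_nonneg_left (Real.cos_le_one s) h0]

theorem diskKernel_pos {r : ℝ} (h0 : 0 ≤ r) (h1 : r < 1) (s : ℝ) : 0 < diskKernel r s :=
  div_pos (by nlinarith) (diskKernel_den_pos h0 h1 s)

theorem contDiff_diskKernel {r : ℝ} (h0 : 0 ≤ r) (h1 : r < 1) : ContDiff ℝ 1 (diskKernel r) := by
  unfold diskKernel
  exact contDiff_const.div (by fun_prop) fun s => (diskKernel_den_pos h0 h1 s).ne'

theorem norm_circleMap_sub_sq (r t₀ t : ℝ) :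
    ‖circleMap 0 1 t - circleMap 0 r t₀‖ ^ 2 = 1 - 2 * r * Real.cos (t - t₀) + r ^ 2 := by
  rw [← Complex.normSq_eq_norm_sq, Complex.normSq_apply]
  simp only [circleMap, zero_add, Complex.ofReal_one, one_mul, Complex.sub_re, Complex.sub_im,
    Complex.exp_ofReal_mul_I_re, Complex.exp_ofReal_mul_I_im, Complex.re_ofReal_mul,
    Complex.im_ofReal_mul]
  rw [Real.cos_sub]
  linear_combination Real.sin_sq_add_cos_sq t + r ^ 2 * Real.sin_sq_add_cos_sq t₀

theorem poissonKernel_circleMap {r : ℝ} (h0 : 0 ≤ r) (t₀ t : ℝ) :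
    poissonKernel 0 (circleMap 0 r t₀) (circleMap 0 1 t) = diskKernel r (t - t₀) := by
  rw [poissonKernel_def, sub_zero, sub_zero, norm_circleMap_sub_sq, norm_circleMap_zero,
    norm_circleMap_zero, abs_one, abs_of_nonneg h0, one_pow]
  rfl

theorem circleMap_mem_unitBall {r : ℝ} (h0 : 0 ≤ r) (h1 : r < 1) (t : ℝ) :
    circleMap 0 r t ∈ Metric.ball (0 : ℂ) 1 := by
  rw [mem_ball_zero_iff, norm_circleMap_zero, abs_of_nonneg h0]; exact h1

theorem integral_diskKernel {r : ℝ} (h0 : 0 ≤ r) (h1 : r < 1) (t₀ : ℝ) :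
    (2 * π)⁻¹ * ∫ t in (0 : ℝ)..2 * π, diskKernel r (t - t₀) = 1 := by
  have h := (DiffContOnCl.circleAverage_poissonKernel_smul (f := fun _ => (1 : ℂ))
    (c := 0) (R := 1) diffContOnCl_const (circleMap_mem_unitBall h0 h1 t₀))
  rw [Real.circleAverage_def] at h
  simp only [Pi.smul_apply', poissonKernel_circleMap h0, Complex.real_smul, mul_one,
    intervalIntegral.integral_ofReal] at h
  exact_mod_cast h

/-- Together with `integral_diskKernel` it shows that the Poisson mean of 1 − cos(t − t₀) is 1 − r;
this is how concentration of the kernel at t₀ enters. -/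
theorem integral_diskKernel_mul_cos {r : ℝ} (h0 : 0 ≤ r) (h1 : r < 1) (t₀ : ℝ) :
    (2 * π)⁻¹ * ∫ t in (0 : ℝ)..2 * π, diskKernel r (t - t₀) * Real.cos (t - t₀) = r := by
  have hd : Differentiable ℂ fun z : ℂ => z * Complex.exp (-(t₀ * I)) := by fun_prop
  have h := (DiffContOnCl.circleAverage_poissonKernel_smul
    (c := 0) (R := 1) hd.diffContOnCl (circleMap_mem_unitBall h0 h1 t₀))
  have hint : CircleIntegrable (poissonKernel 0 (circleMap 0 r t₀) •
      fun z : ℂ => z * Complex.exp (-(t₀ * I))) 0 1 := by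
    rw [CircleIntegrable]
    simp only [Pi.smul_apply', poissonKernel_circleMap h0]
    refine (Continuous.intervalIntegrable ?_ _ _)
    refine ((contDiff_diskKernel h0 h1).continuous.comp (by fun_prop)).smul (by fun_prop)
  have h2 := Complex.reCLM.circleAverage_comp_comm hint
  rw [h] at h2
  rw [Real.circleAverage_def] at h2
  have e : ∀ (ρ t : ℝ), circleMap 0 ρ t * Complex.exp (-(t₀ * I)) =
      ρ * Complex.exp (((t - t₀ : ℝ) : ℂ) * I) := by
    intro ρ t
    rw [circleMap, zero_add, mul_assoc, ← Complex.exp_add]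
    push_cast
    ring_nf
  simp only [Function.comp, Pi.smul_apply', poissonKernel_circleMap h0, e, sub_self,
    Complex.ofReal_zero, zero_mul, Complex.exp_zero, mul_one, Complex.ofReal_one, one_mul,
    Complex.reCLM_apply, Complex.ofReal_re, smul_eq_mul, Complex.real_smul,
    Complex.re_ofReal_mul, Complex.exp_ofReal_mul_I_re] at h2
  exact h2

theorem hasDerivAt_diskKernel {r : ℝ} (h0 : 0 ≤ r) (h1 : r < 1) (s : ℝ) :
    HasDerivAt (diskKernel r)
      (-(diskKernel r s * (2 * r * Real.sin s / (1 - 2 * r * Real.cos s + r ^ 2)))) s := by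
  have hd : HasDerivAt (fun s : ℝ => 1 - 2 * r * Real.cos s + r ^ 2) (2 * r * Real.sin s) s := by
    refine ((((Real.hasDerivAt_cos s).const_mul (2 * r)).const_sub 1).add_const
      (r ^ 2)).congr_deriv ?_
    ring
  have := (hasDerivAt_const s (1 - r ^ 2)).div hd (diskKernel_den_pos h0 h1 s).ne'
  refine this.congr_deriv ?_
  have := (diskKernel_den_pos h0 h1 s).ne'
  unfold diskKernel
  field_simp
  ring

/-- Quadratic lower bound for `1 - cos` on a proper subinterval of the period. -/
theorem exists_mul_sq_le_one_sub_cos {t₀ : ℝ} (ht : t₀ ∈ Ioo 0 (2 * π)) :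
    ∃ k > 0, ∀ t ∈ Icc 0 (2 * π), k * (t - t₀) ^ 2 ≤ 1 - Real.cos (t - t₀) := by
  obtain ⟨h0, h1⟩ := ht
  set m := max t₀ (2 * π - t₀) / 2 with hm
  have hm0 : 0 < m := by
    rw [hm]; have := le_max_left t₀ (2 * π - t₀); linarith
  have hmπ : m < π := by
    have : max t₀ (2 * π - t₀) < 2 * π := max_lt h1 (by linarith)
    rw [hm]; linarith
  have hsm := Real.sin_pos_of_pos_of_lt_pi hm0 hmπ
  refine ⟨2 * (Real.sin m / (2 * m)) ^ 2, by positivity, fun t ht => ?_⟩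
  have hx : |t - t₀| / 2 ≤ m := by
    rw [hm]
    gcongr
    rw [abs_le]
    have := le_max_left t₀ (2 * π - t₀)
    have := le_max_right t₀ (2 * π - t₀)
    constructor <;> linarith [ht.1, ht.2]
  have hx0 : 0 ≤ |t - t₀| / 2 := by positivity
  have hsin : |t - t₀| / 2 * Real.sin m ≤ m * Real.sin (|t - t₀| / 2) := by
    rcases hx0.eq_or_lt with h | h
    · rw [← h]; simp
    rcases hx.eq_or_lt with h' | h'
    · rw [h']
    · exact (mul_sin_lt_mul_sin h h' hmπ.le).le
  have h3 : |t - t₀| * (Real.sin m / (2 * m)) ≤ Real.sin (|t - t₀| / 2) := by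
    rw [mul_div_assoc', div_le_iff₀ (by positivity)]
    linarith
  have h4 := pow_le_pow_left₀ (by positivity) h3 2
  have h5 : 1 - Real.cos (t - t₀) = 2 * Real.sin (|t - t₀| / 2) ^ 2 := by
    rw [← Real.cos_abs]
    have := Real.cos_sq' (|t - t₀| / 2)
    have h6 := Real.cos_two_mul (|t - t₀| / 2)
    rw [mul_div_cancel₀ _ (two_ne_zero)] at h6
    linarith
  rw [h5]
  rw [mul_pow, sq_abs] at h4
  linarith

/-- A primitive vanishing to first order at `t₀`, measured against the Poisson kernel. -/
theorem exists_primitive_bound {Φ : ℝ → ℝ} {t₀ : ℝ} (ht : t₀ ∈ Ioo 0 (2 * π))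
    (hΦ : ContinuousOn Φ (Icc 0 (2 * π))) (h0 : Φ t₀ = 0) (hd : HasDerivAt Φ 0 t₀) {ε : ℝ}
    (hε : 0 < ε) : ∃ C ≥ 0, ∀ t ∈ Icc 0 (2 * π),
      |Φ t| ≤ |t - t₀| * (ε + C * (1 - Real.cos (t - t₀))) := by
  obtain ⟨k, hk, hkt⟩ := exists_mul_sq_le_one_sub_cos ht
  obtain ⟨M, hM⟩ := isCompact_Icc.exists_bound_of_continuousOn hΦ
  have hlo := (hasDerivAt_iff_isLittleO.1 hd).bound hε
  simp only [h0, sub_zero, smul_zero] at hlo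
  obtain ⟨δ, hδ, hδt⟩ := Metric.eventually_nhds_iff.1 hlo
  refine ⟨|M| / (δ * (k * δ ^ 2)), by positivity, fun t ht => ?_⟩
  have h1c : 0 ≤ 1 - Real.cos (t - t₀) := sub_nonneg.2 (Real.cos_le_one _)
  rcases lt_or_ge (dist t t₀) δ with h | h
  · refine (hδt h).trans ?_
    rw [Real.norm_eq_abs, mul_comm]
    gcongr
    have : 0 ≤ |M| / (δ * (k * δ ^ 2)) * (1 - Real.cos (t - t₀)) := by positivity
    linarith
  · rw [Real.dist_eq] at h
    have h2 : k * δ ^ 2 ≤ 1 - Real.cos (t - t₀) := by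
      refine le_trans ?_ (hkt t ht)
      rw [← sq_abs (t - t₀)]
      gcongr
    calc |Φ t| ≤ |M| := (hM t ht).trans (le_abs_self _)
      _ = |M| / (δ * (k * δ ^ 2)) * (δ * (k * δ ^ 2)) := by field_simp
      _ ≤ |M| / (δ * (k * δ ^ 2)) * (|t - t₀| * (1 - Real.cos (t - t₀))) := by gcongr
      _ = |t - t₀| * (|M| / (δ * (k * δ ^ 2)) * (1 - Real.cos (t - t₀))) := by ring
      _ ≤ _ := by gcongr; linarith

theorem tendsto_diskKernel_endpoint {s : ℝ} (hs : Real.cos s ≠ 1) :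
    Tendsto (fun r => diskKernel r s) (𝓝[<] 1) (𝓝 0) := by
  have : ContinuousAt (fun r => diskKernel r s) 1 := by
    unfold diskKernel
    refine ContinuousAt.div (by fun_prop) (by fun_prop) ?_
    intro h
    apply hs
    linarith
  have h2 : diskKernel 1 s = 0 := by simp [diskKernel]
  have h3 := this.tendsto.mono_left (nhdsWithin_le_nhds (s := Iio 1))
  rwa [h2] at h3

/-- Integrate by parts against the primitive Φ of u − u(t₀), which vanishes to first order at t₀.
The derivative of the kernel times t − t₀ is dominated by the kernel itself, so the integral is at
most (ε + C(1 − r))/k. -/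
theorem tendsto_poisson_of_hasDerivAt {u : ℝ → ℝ} (hu : IntervalIntegrable u volume 0 (2 * π))
    {t₀ : ℝ} (ht : t₀ ∈ Ioo 0 (2 * π))
    (hd : HasDerivAt (fun x => ∫ t in t₀..x, u t) (u t₀) t₀)
    (hae : ∀ᵐ x, x ∈ uIcc 0 (2 * π) →
      HasDerivAt (fun x => ∫ t in t₀..x, (u t - u t₀)) (u x - u t₀) x) :
    Tendsto (fun r => (2 * π)⁻¹ * ∫ t in (0 : ℝ)..2 * π, diskKernel r (t - t₀) * u t)
      (𝓝[<] 1) (𝓝 (u t₀)) := by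
  have hπ := Real.two_pi_pos
  set Φ : ℝ → ℝ := fun x => ∫ t in t₀..x, (u t - u t₀) with hΦ
  have ht' : t₀ ∈ uIcc 0 (2 * π) := by
    rw [uIcc_of_le hπ.le]; exact ⟨ht.1.le, ht.2.le⟩
  have huc : IntervalIntegrable (fun t => u t - u t₀) volume 0 (2 * π) :=
    hu.sub intervalIntegrable_const
  have hΦac : AbsolutelyContinuousOnInterval Φ 0 (2 * π) :=
    huc.absolutelyContinuousOnInterval_intervalIntegral ht'
  have hΦc : ContinuousOn Φ (Icc 0 (2 * π)) := by
    have := hΦac.continuousOn; rwa [uIcc_of_le hπ.le] at this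
  have hΦ0 : Φ t₀ = 0 := by simp [hΦ]
  have hΦd : HasDerivAt Φ 0 t₀ := by
    have h1 : HasDerivAt (fun x => (∫ t in t₀..x, u t) - (x - t₀) * u t₀) (u t₀ - 1 * u t₀) t₀ :=
      hd.sub (((hasDerivAt_id t₀).sub_const t₀).mul_const (u t₀))
    rw [one_mul, sub_self] at h1
    refine h1.congr_of_eventuallyEq ?_
    filter_upwards [Ioo_mem_nhds ht.1 ht.2] with x hx
    have hsub : IntervalIntegrable u volume t₀ x := by
      apply hu.mono_set
      apply uIcc_subset_uIcc ht'
      rw [uIcc_of_le hπ.le]; exact ⟨hx.1.le, hx.2.le⟩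
    simp only [hΦ]
    rw [intervalIntegral.integral_sub hsub intervalIntegrable_const,
      intervalIntegral.integral_const, smul_eq_mul]
  obtain ⟨k, hk, hkt⟩ := exists_mul_sq_le_one_sub_cos ht
  have hcos : Real.cos (2 * π - t₀) ≠ 1 := by
    have h := hkt (2 * π) ⟨hπ.le, le_rfl⟩
    have h2 : 0 < k * (2 * π - t₀) ^ 2 := by
      have : 0 < 2 * π - t₀ := by linarith [ht.2]
      positivity
    intro h3
    rw [h3] at h
    linarith
  have hcos0 : Real.cos (0 - t₀) ≠ 1 := by
    rwa [zero_sub, Real.cos_neg, ← Real.cos_neg, ← Real.cos_add_two_pi, neg_add_eq_sub]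
  have key : ∀ r ∈ Ioo (0 : ℝ) 1, (2 * π)⁻¹ * (∫ t in (0 : ℝ)..2 * π, diskKernel r (t - t₀) * u t) -
      u t₀ = (2 * π)⁻¹ * (diskKernel r (2 * π - t₀) * Φ (2 * π) - diskKernel r (0 - t₀) * Φ 0) -
        (2 * π)⁻¹ * ∫ t in (0 : ℝ)..2 * π, deriv (fun t => diskKernel r (t - t₀)) t * Φ t := by
    rintro r ⟨h0, h1⟩
    have hKd : ContDiff ℝ 1 fun t => diskKernel r (t - t₀) :=
      (contDiff_diskKernel h0.le h1).comp (by fun_prop)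
    have hparts := hKd.contDiffOn.absolutelyContinuousOnInterval.integral_mul_deriv_eq_deriv_mul
      hΦac
    have hcongr : ∫ t in (0 : ℝ)..2 * π, diskKernel r (t - t₀) * deriv Φ t =
        ∫ t in (0 : ℝ)..2 * π, diskKernel r (t - t₀) * (u t - u t₀) := by
      apply intervalIntegral.integral_congr_ae
      filter_upwards [hae] with x hx hxm
      rw [(hx (uIoc_subset_uIcc hxm)).deriv]
    rw [hcongr] at hparts
    have h3 : ∫ t in (0 : ℝ)..2 * π, diskKernel r (t - t₀) * (u t - u t₀) =
        (∫ t in (0 : ℝ)..2 * π, diskKernel r (t - t₀) * u t) -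
          (∫ t in (0 : ℝ)..2 * π, diskKernel r (t - t₀)) * u t₀ := by
      rw [← intervalIntegral.integral_mul_const, ← intervalIntegral.integral_sub]
      · simp only [mul_sub]
      · exact hu.continuousOn_mul hKd.continuous.continuousOn
      · exact (hKd.continuous.mul continuous_const).intervalIntegrable _ _
    rw [h3] at hparts
    have h4 := integral_diskKernel h0.le h1 t₀
    have h5 : u t₀ = (2 * π)⁻¹ * ((∫ t in (0 : ℝ)..2 * π, diskKernel r (t - t₀)) * u t₀) := by
      rw [← mul_assoc, h4, one_mul]
    rw [← mul_sub, ← hparts, mul_sub, ← h5]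
  have hIbound : ∀ ε > 0, ∃ C ≥ 0, ∀ r ∈ Ioo (0 : ℝ) 1,
      |(2 * π)⁻¹ * ∫ t in (0 : ℝ)..2 * π, deriv (fun t => diskKernel r (t - t₀)) t * Φ t| ≤
        (1 / k) * (ε + C * (1 - r)) := by
    intro ε hε
    obtain ⟨C, hC, hCt⟩ := exists_primitive_bound ht hΦc hΦ0 hΦd hε
    refine ⟨C, hC, ?_⟩
    rintro r ⟨h0, h1⟩
    have hKd : ContDiff ℝ 1 fun t => diskKernel r (t - t₀) :=
      (contDiff_diskKernel h0.le h1).comp (by fun_prop)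
    have hpt : ∀ t ∈ Icc 0 (2 * π), |deriv (fun t => diskKernel r (t - t₀)) t * Φ t| ≤
        (1 / k) * ((ε + C) * diskKernel r (t - t₀) -
          C * (diskKernel r (t - t₀) * Real.cos (t - t₀))) := by
      intro t htm
      have hdt : HasDerivAt (fun t => diskKernel r (t - t₀)) _ t :=
        (hasDerivAt_diskKernel h0.le h1 (t - t₀)).comp_sub_const t t₀
      have hK := diskKernel_pos h0.le h1 (t - t₀)
      have hD := diskKernel_den_pos h0.le h1 (t - t₀)
      rw [hdt.deriv, abs_mul, abs_neg, abs_mul, abs_of_pos hK, abs_div, abs_of_pos hD, abs_mul,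
        abs_of_pos (by linarith : 0 < 2 * r)]
      have h1c : 0 ≤ 1 - Real.cos (t - t₀) := sub_nonneg.2 (Real.cos_le_one _)
      -- The denominator is (1 − r)² + 2r(1 − cos(t − t₀)), hence at least 2rk(t − t₀)².
      have hs : 2 * r * |Real.sin (t - t₀)| / (1 - 2 * r * Real.cos (t - t₀) + r ^ 2) *
          |t - t₀| ≤ 1 / k := by
        rw [div_mul_eq_mul_div, div_le_div_iff₀ hD hk]
        have h2 : |Real.sin (t - t₀)| * |t - t₀| ≤ (t - t₀) ^ 2 := by
          rw [← sq_abs (t - t₀), sq]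
          exact mul_le_mul_of_nonneg_right Real.abs_sin_le_abs (abs_nonneg _)
        calc 2 * r * |Real.sin (t - t₀)| * |t - t₀| * k
            = 2 * r * k * (|Real.sin (t - t₀)| * |t - t₀|) := by ring
          _ ≤ 2 * r * k * (t - t₀) ^ 2 := by gcongr
          _ = 2 * r * (k * (t - t₀) ^ 2) := by ring
          _ ≤ 2 * r * (1 - Real.cos (t - t₀)) := by gcongr; exact hkt t htm
          _ ≤ _ := by nlinarith [sq_nonneg (1 - r)]
      calc diskKernel r (t - t₀) * (2 * r * |Real.sin (t - t₀)| /
            (1 - 2 * r * Real.cos (t - t₀) + r ^ 2)) * |Φ t|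
          ≤ diskKernel r (t - t₀) * (2 * r * |Real.sin (t - t₀)| /
            (1 - 2 * r * Real.cos (t - t₀) + r ^ 2)) *
              (|t - t₀| * (ε + C * (1 - Real.cos (t - t₀)))) := by
            gcongr
            exact hCt t htm
        _ = diskKernel r (t - t₀) * (ε + C * (1 - Real.cos (t - t₀))) *
            (2 * r * |Real.sin (t - t₀)| / (1 - 2 * r * Real.cos (t - t₀) + r ^ 2) *
              |t - t₀|) := by ring
        _ ≤ diskKernel r (t - t₀) * (ε + C * (1 - Real.cos (t - t₀))) * (1 / k) := by gcongr
        _ = _ := by ring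
    have hKc := hKd.continuous
    have hKcos : Continuous fun t => diskKernel r (t - t₀) * Real.cos (t - t₀) :=
      hKc.mul (by fun_prop)
    have hle := intervalIntegral.abs_integral_le_integral_abs (μ := volume) hπ.le
      (f := fun t => deriv (fun t => diskKernel r (t - t₀)) t * Φ t)
    have hKd' : Continuous (deriv fun t => diskKernel r (t - t₀)) :=
      hKd.continuous_deriv le_rfl
    have hle2 := intervalIntegral.integral_mono_on (μ := volume) hπ.le
      (f := fun t => |deriv (fun t => diskKernel r (t - t₀)) t * Φ t|)
      (g := fun t => (1 / k) * ((ε + C) * diskKernel r (t - t₀) -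
          C * (diskKernel r (t - t₀) * Real.cos (t - t₀)))) (by
        apply ContinuousOn.intervalIntegrable
        rw [uIcc_of_le hπ.le]
        exact (hKd'.continuousOn.mul hΦc).abs)
      (by apply Continuous.intervalIntegrable; fun_prop) hpt
    rw [intervalIntegral.integral_const_mul, intervalIntegral.integral_sub
      (by apply Continuous.intervalIntegrable; fun_prop)
      (by apply Continuous.intervalIntegrable; fun_prop), intervalIntegral.integral_const_mul,
      intervalIntegral.integral_const_mul] at hle2
    have e1 := integral_diskKernel h0.le h1 t₀
    have e2 := integral_diskKernel_mul_cos h0.le h1 t₀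
    rw [abs_mul, abs_of_pos (by positivity : 0 < (2 * π)⁻¹)]
    calc _ ≤ (2 * π)⁻¹ * (1 / k * ((ε + C) * (∫ t in (0 : ℝ)..2 * π, diskKernel r (t - t₀)) -
          C * ∫ t in (0 : ℝ)..2 * π, diskKernel r (t - t₀) * Real.cos (t - t₀))) := by
          gcongr
          exact hle.trans hle2
      _ = 1 / k * ((ε + C) * ((2 * π)⁻¹ * ∫ t in (0 : ℝ)..2 * π, diskKernel r (t - t₀)) -
          C * ((2 * π)⁻¹ * ∫ t in (0 : ℝ)..2 * π, diskKernel r (t - t₀) * Real.cos (t - t₀))) := by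
          ring
      _ = 1 / k * (ε + C * (1 - r)) := by rw [e1, e2]; ring
  have hI : Tendsto (fun r => (2 * π)⁻¹ * ∫ t in (0 : ℝ)..2 * π,
      deriv (fun t => diskKernel r (t - t₀)) t * Φ t) (𝓝[<] 1) (𝓝 0) := by
    rw [Metric.tendsto_nhds]
    intro e he
    obtain ⟨C, hC, hCr⟩ := hIbound (e * k / 4) (by positivity)
    have hlim : Tendsto (fun r : ℝ => (1 / k) * (e * k / 4 + C * (1 - r))) (𝓝[<] 1)
        (𝓝 ((1 / k) * (e * k / 4 + C * (1 - 1)))) :=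
      (Continuous.tendsto (by fun_prop) 1).mono_left nhdsWithin_le_nhds
    have hlt : (1 / k) * (e * k / 4 + C * (1 - 1)) < e := by
      have : (1 / k) * (e * k / 4 + C * (1 - 1)) = e / 4 := by field_simp; ring
      rw [this]; linarith
    filter_upwards [hlim.eventually (gt_mem_nhds hlt), Ioo_mem_nhdsLT (zero_lt_one' ℝ)] with r h1 h2
    rw [dist_zero_right]
    exact (hCr r h2).trans_lt h1
  have hB : Tendsto (fun r => (2 * π)⁻¹ * (diskKernel r (2 * π - t₀) * Φ (2 * π) -
      diskKernel r (0 - t₀) * Φ 0)) (𝓝[<] 1) (𝓝 ((2 * π)⁻¹ * (0 * Φ (2 * π) - 0 * Φ 0))) :=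
    (((tendsto_diskKernel_endpoint hcos).mul_const _).sub
      ((tendsto_diskKernel_endpoint hcos0).mul_const _)).const_mul _
  have hfin := (hB.sub hI).add_const (u t₀)
  simp only [zero_mul, sub_self, mul_zero, zero_add] at hfin
  refine hfin.congr' ?_
  filter_upwards [Ioo_mem_nhdsLT (zero_lt_one' ℝ)] with r hr
  rw [← key r hr]
  ring

/-- Fatou's theorem for Poisson integrals of integrable functions. -/
theorem ae_tendsto_poisson {u : ℝ → ℝ} (hu : IntervalIntegrable u volume 0 (2 * π)) :
    ∀ᵐ t₀ : ℝ, t₀ ∈ Ioo 0 (2 * π) →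
      Tendsto (fun r => (2 * π)⁻¹ * ∫ t in (0 : ℝ)..2 * π, diskKernel r (t - t₀) * u t)
        (𝓝[<] 1) (𝓝 (u t₀)) := by
  have hmem : ∀ {t : ℝ}, t ∈ Ioo 0 (2 * π) → t ∈ uIcc 0 (2 * π) := fun {t} h => by
    rw [uIcc_of_le Real.two_pi_pos.le]; exact ⟨h.1.le, h.2.le⟩
  filter_upwards [hu.ae_hasDerivAt_integral] with t₀ h ht₀
  refine tendsto_poisson_of_hasDerivAt hu ht₀ (h (hmem ht₀) _ (hmem ht₀)) ?_
  have hc : IntervalIntegrable (fun t => u t - u t₀) volume 0 (2 * π) :=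
    hu.sub intervalIntegrable_const
  filter_upwards [hc.ae_hasDerivAt_integral] with x hx hxm
  exact hx hxm _ (hmem ht₀)

/-! ### Boundary functions of the holomorphic Hardy space of exponent two -/

/-- The normalized arc-length measure, in the angle coordinate. -/
noncomputable def circleMeasure : Measure ℝ :=
  ENNReal.ofReal (2 * π)⁻¹ • volume.restrict (Ioc 0 (2 * π))

theorem ofReal_two_pi_inv_ne_zero : ENNReal.ofReal (2 * π)⁻¹ ≠ 0 := by
  rw [Ne, ENNReal.ofReal_eq_zero, not_le]; positivity

instance : IsProbabilityMeasure circleMeasure := by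
  constructor
  rw [circleMeasure, Measure.smul_apply, Measure.restrict_apply_univ, Real.volume_Ioc, sub_zero,
    smul_eq_mul, ← ENNReal.ofReal_mul (by positivity), inv_mul_cancel₀ (by positivity),
    ENNReal.ofReal_one]

theorem ae_circleMeasure_iff {P : ℝ → Prop} :
    (∀ᵐ t ∂circleMeasure, P t) ↔ ∀ᵐ t, t ∈ Ioo 0 (2 * π) → P t := by
  rw [circleMeasure, Measure.ae_ennreal_smul_measure_iff ofReal_two_pi_inv_ne_zero,
    ← restrict_Ioo_eq_restrict_Ioc, ae_restrict_iff' measurableSet_Ioo]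

theorem integral_circleMeasure {E : Type*} [NormedAddCommGroup E] [NormedSpace ℝ E] (F : ℝ → E) :
    ∫ t, F t ∂circleMeasure = (2 * π)⁻¹ • ∫ t in (0 : ℝ)..2 * π, F t := by
  rw [circleMeasure, integral_smul_measure, ENNReal.toReal_ofReal (by positivity),
    intervalIntegral.integral_of_le (by positivity)]

theorem circleAverage_eq_integral {E : Type*} [NormedAddCommGroup E] [NormedSpace ℝ E]
    (f : ℂ → E) (r : ℝ) :
    Real.circleAverage f 0 r = ∫ t, f (circleMap 0 r t) ∂circleMeasure := by
  rw [integral_circleMeasure, Real.circleAverage_def]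

theorem integrable_circleMeasure_iff {E : Type*} [NormedAddCommGroup E] (F : ℝ → E) :
    Integrable F circleMeasure ↔ IntervalIntegrable F volume 0 (2 * π) := by
  rw [circleMeasure, integrable_smul_measure ofReal_two_pi_inv_ne_zero ENNReal.ofReal_ne_top,
    intervalIntegrable_iff_integrableOn_Ioc_of_le (by positivity), IntegrableOn]

theorem circleIntegrable_iff_integrable {E : Type*} [NormedAddCommGroup E] (f : ℂ → E) (r : ℝ) :
    CircleIntegrable f 0 r ↔ Integrable (fun t => f (circleMap 0 r t)) circleMeasure :=
  (integrable_circleMeasure_iff _).symm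

theorem Continuous.memLp_circleMeasure {E : Type*} [NormedAddCommGroup E]
    [SecondCountableTopologyEither ℝ E] {F : ℝ → E} (hF : Continuous F) (p : ENNReal) :
    MemLp F p circleMeasure := by
  obtain ⟨C, hC⟩ := (isCompact_Icc (a := (0 : ℝ)) (b := 2 * π)).exists_bound_of_continuousOn
    hF.continuousOn
  refine MemLp.of_bound hF.aestronglyMeasurable C ?_
  rw [ae_circleMeasure_iff]
  exact ae_of_all _ fun t ht => hC t (Ioo_subset_Icc_self ht)

theorem Continuous.integrable_circleMeasure {E : Type*} [NormedAddCommGroup E]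
    [SecondCountableTopologyEither ℝ E] {F : ℝ → E} (hF : Continuous F) :
    Integrable F circleMeasure :=
  memLp_one_iff_integrable.1 (hF.memLp_circleMeasure 1)

theorem ContinuousOn.comp_circleMap {E : Type*} [TopologicalSpace E] {F : ℂ → E}
    (hF : ContinuousOn F unitDisk) {r : ℝ} (h0 : 0 ≤ r) (h1 : r < 1) :
    Continuous fun t => F (circleMap 0 r t) :=
  hF.comp_continuous (continuous_circleMap 0 r) (circleMap_mem_unitBall h0 h1)

theorem inner_toLp_circleMeasure {f g : ℝ → ℂ} (hf : MemLp f 2 circleMeasure)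
    (hg : MemLp g 2 circleMeasure) :
    inner ℂ (hf.toLp f) (hg.toLp g) = ∫ t, conj (f t) * g t ∂circleMeasure := by
  rw [MeasureTheory.L2.inner_def]
  refine integral_congr_ae ?_
  filter_upwards [hf.coeFn_toLp, hg.coeFn_toLp] with t h1 h2
  rw [h1, h2, RCLike.inner_apply']

/-- The character `t ↦ exp(i n t)` in `L²` of the circle. -/
noncomputable def circleChar (n : ℕ) : Lp ℂ 2 circleMeasure :=
  (((continuous_circleMap 0 1).pow n).memLp_circleMeasure 2).toLp fun t => circleMap 0 1 t ^ n

theorem inner_circleChar (n : ℕ) {g : ℝ → ℂ} (hg : MemLp g 2 circleMeasure) :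
    inner ℂ (circleChar n) (hg.toLp g) = ∫ t, conj (circleMap 0 1 t) ^ n * g t ∂circleMeasure := by
  rw [circleChar, inner_toLp_circleMeasure]
  simp only [map_pow]

theorem conj_circleMap_one (t : ℝ) : conj (circleMap 0 1 t) = (circleMap 0 1 t)⁻¹ := by
  rw [Complex.inv_def, Complex.normSq_eq_norm_sq, norm_circleMap_zero]; simp

theorem circleAverage_pow_inv_mul {g : ℂ → ℂ} (hg : DifferentiableOn ℂ g unitDisk) {r : ℝ}
    (h0 : 0 < r) (h1 : r < 1) (n : ℕ) :
    ∫ t, conj (circleMap 0 1 t) ^ n * g (circleMap 0 r t) ∂circleMeasure =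
      ((n.factorial : ℂ)⁻¹ * iteratedDeriv n g 0) * r ^ n := by
  have hsub : Metric.closedBall (0 : ℂ) r ⊆ unitDisk := Metric.closedBall_subset_ball h1
  have h := (hg.mono hsub).circleIntegral_one_div_sub_center_pow_smul h0 n
  have hr : (r : ℂ) ≠ 0 := by exact_mod_cast h0.ne'
  have h2 : ∫ t, conj (circleMap 0 1 t) ^ n * g (circleMap 0 r t) ∂circleMeasure =
      Real.circleAverage (fun z => (r / z) ^ n * g z) 0 r := by
    rw [circleAverage_eq_integral]
    congr 1; ext t
    rw [conj_circleMap_one]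
    congr 2
    simp only [circleMap, zero_add, Complex.ofReal_one, one_mul]
    field_simp
  rw [h2, Real.circleAverage_eq_circleIntegral h0.ne']
  have h3 : (∮ z in C(0, r), (z - 0)⁻¹ • ((r / z) ^ n * g z)) =
      (r : ℂ) ^ n * ∮ z in C(0, r), (1 / (z - 0) ^ (n + 1)) • g z := by
    rw [← circleIntegral.integral_const_mul]
    refine circleIntegral.integral_congr h0.le fun z hz => ?_
    have hz0 : z ≠ 0 := by rintro rfl; simp at hz; exact h0.ne hz
    simp only [sub_zero, smul_eq_mul]
    rw [div_pow, pow_succ]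
    field_simp
  rw [h3, h]
  have : (n.factorial : ℂ) ≠ 0 := by exact_mod_cast n.factorial_ne_zero
  simp only [smul_eq_mul]
  field_simp [Complex.two_pi_I_ne_zero]

theorem orthonormal_circleChar : Orthonormal ℂ circleChar := by
  rw [orthonormal_iff_ite]
  have key : ∀ i j : ℕ, i ≤ j → inner ℂ (circleChar i) (circleChar j) = if i = j then 1 else 0 := by
    intro i j hij
    obtain ⟨k, rfl⟩ := Nat.exists_eq_add_of_le hij
    have h : inner ℂ (circleChar i) (circleChar (i + k)) = ∫ t, circleMap 0 1 t ^ k ∂circleMeasure := by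
      conv_lhs => rw [show circleChar (i + k) = (((continuous_circleMap 0 1).pow
        (i + k)).memLp_circleMeasure 2).toLp fun t => circleMap 0 1 t ^ (i + k) from rfl]
      rw [inner_circleChar]
      congr 1; ext t
      have : circleMap 0 1 t ≠ 0 := circleMap_ne_center one_ne_zero
      rw [conj_circleMap_one, pow_add, ← mul_assoc, ← mul_pow, inv_mul_cancel₀ this, one_pow,
        one_mul]
    have h2 := DiffContOnCl.circleAverage (f := fun z : ℂ => z ^ k) (c := 0) (R := 1)
      (Differentiable.diffContOnCl (by fun_prop))
    rw [circleAverage_eq_integral] at h2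
    rw [h, h2]
    rcases k with _ | k <;> simp
  intro i j
  rcases le_total i j with h | h
  · exact key i j h
  · rw [← inner_conj_symm, key j i h]
    by_cases hij : i = j <;> simp [hij, eq_comm]

/-- Bessel's inequality on circles and r → 1 make the Taylor coefficients square summable. The
boundary function is the L² sum of a_n e^{int}; pairing it with the Poisson kernel, which reproduces
z^n, returns the Taylor series. -/
theorem exists_poisson_of_sq_bounded {g : ℂ → ℂ} (hg : DifferentiableOn ℂ g unitDisk) {M : ℝ}
    (hM : ∀ r ∈ Ioo (0 : ℝ) 1, Real.circleAverage (fun z => ‖g z‖ ^ 2) 0 r ≤ M) :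
    ∃ b : ℝ → ℂ, MemLp b 2 circleMeasure ∧ ∀ w ∈ unitDisk,
      g w = ∫ t, (poissonKernel 0 w (circleMap 0 1 t) : ℂ) * b t ∂circleMeasure := by
  set a : ℕ → ℂ := fun n => (n.factorial : ℂ)⁻¹ * iteratedDeriv n g 0 with ha
  have hsumr : ∀ N : ℕ, ∀ r ∈ Ioo (0 : ℝ) 1, ∑ n ∈ Finset.range N, ‖a n‖ ^ 2 * (r ^ n) ^ 2 ≤ M := by
    intro N r hr
    have hm : MemLp (fun t => g (circleMap 0 r t)) 2 circleMeasure :=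
      (hg.continuousOn.comp_circleMap hr.1.le hr.2).memLp_circleMeasure 2
    have h1 := orthonormal_circleChar.sum_inner_products_le (hm.toLp _) (s := Finset.range N)
    have h2 : ‖hm.toLp _‖ ^ 2 = Real.circleAverage (fun z => ‖g z‖ ^ 2) 0 r := by
      rw [circleAverage_eq_integral]
      have h3 : inner ℂ (hm.toLp _) (hm.toLp _) = ((‖hm.toLp _‖ ^ 2 : ℝ) : ℂ) := by
        rw [inner_self_eq_norm_sq_to_K]; simp
      rw [inner_toLp_circleMeasure] at h3
      have h4 : ∀ t, conj (g (circleMap 0 r t)) * g (circleMap 0 r t) =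
          ((‖g (circleMap 0 r t)‖ ^ 2 : ℝ) : ℂ) := fun t => by
        rw [mul_comm, Complex.mul_conj, Complex.normSq_eq_norm_sq]
      simp only [h4] at h3
      rw [integral_complex_ofReal] at h3
      exact_mod_cast h3.symm
    rw [h2] at h1
    refine le_trans (le_of_eq ?_) (h1.trans (hM r hr))
    refine Finset.sum_congr rfl fun n _ => ?_
    rw [inner_circleChar, circleAverage_pow_inv_mul hg hr.1 hr.2, norm_mul _ ((r : ℂ) ^ n), mul_pow,
      norm_pow, Complex.norm_real, Real.norm_of_nonneg hr.1.le]
  have hsum : Summable fun n => ‖a n‖ ^ 2 := by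
    refine summable_of_sum_range_le (c := M) (fun n => by positivity) fun N => ?_
    have hc : Continuous fun r : ℝ => ∑ n ∈ Finset.range N, ‖a n‖ ^ 2 * (r ^ n) ^ 2 := by fun_prop
    have ht := (hc.tendsto 1).mono_left (nhdsWithin_le_nhds (s := Iio 1))
    simp only [one_pow, mul_one] at ht
    refine le_of_tendsto ht ?_
    filter_upwards [Ioo_mem_nhdsLT (show (0 : ℝ) < 1 by norm_num)] with r hr using hsumr N r hr
  have hsB := (orthonormal_circleChar.orthogonalFamily.summable_iff_norm_sq_summable a).2 hsum
  simp only [LinearIsometry.toSpanSingleton_apply] at hsB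
  set B : Lp ℂ 2 circleMeasure := ∑' n, a n • circleChar n with hB
  refine ⟨B, Lp.memLp B, fun w hw => ?_⟩
  have hKc : Continuous fun t => (poissonKernel 0 w (circleMap 0 1 t) : ℂ) := by
    obtain ⟨r, hr0, hr1, t₀, rfl⟩ : ∃ r : ℝ, 0 ≤ r ∧ r < 1 ∧ ∃ t₀, w = circleMap 0 r t₀ := by
      refine ⟨‖w‖, norm_nonneg _, by simpa [unitDisk] using hw, w.arg, ?_⟩
      rw [circleMap, zero_add, Complex.norm_mul_exp_arg_mul_I]
    simp only [poissonKernel_circleMap hr0]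
    exact Complex.continuous_ofReal.comp
      ((contDiff_diskKernel hr0 hr1).continuous.comp (by fun_prop))
  have hK := hKc.memLp_circleMeasure 2
  have h1 : HasSum (fun n => inner ℂ (hK.toLp _) (a n • circleChar n)) (inner ℂ (hK.toLp _) B) :=
    (innerSL ℂ (hK.toLp _)).hasSum hsB.hasSum
  have h2 : ∀ n, inner ℂ (hK.toLp _) (a n • circleChar n) =
      (n.factorial : ℂ)⁻¹ • (w - 0) ^ n • iteratedDeriv n g 0 := by
    intro n
    rw [inner_smul_right, circleChar, inner_toLp_circleMeasure]
    have h3 := DiffContOnCl.circleAverage_poissonKernel_smul (f := fun z : ℂ => z ^ n) (c := 0)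
      (R := 1) (Differentiable.diffContOnCl (by fun_prop)) hw
    rw [circleAverage_eq_integral] at h3
    simp only [Pi.smul_apply', Complex.real_smul] at h3
    simp only [Complex.conj_ofReal, h3, ha, smul_eq_mul, sub_zero]
    ring
  simp only [h2] at h1
  rw [(hasSum_taylorSeries_on_ball hg hw).unique h1, ← Lp.toLp_coeFn B (Lp.memLp B),
    inner_toLp_circleMeasure]
  refine integral_congr_ae ?_
  filter_upwards [(Lp.memLp B).coeFn_toLp] with t ht
  rw [Complex.conj_ofReal, ht]

theorem circleMap_eq_ofReal_mul (r t : ℝ) : circleMap 0 r t = (r : ℂ) * circleMap 0 1 t := by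
  simp [circleMap]

theorem tendsto_radial_of_poisson {g : ℂ → ℂ} {b : ℝ → ℂ} (hb : Integrable b circleMeasure)
    (h : ∀ w ∈ unitDisk,
      g w = ∫ t, (poissonKernel 0 w (circleMap 0 1 t) : ℂ) * b t ∂circleMeasure) :
    ∀ᵐ t ∂circleMeasure,
      Tendsto (fun r : ℝ => g (r * circleMap 0 1 t)) (𝓝[<] 1) (𝓝 (b t)) := by
  have hre := ae_tendsto_poisson ((integrable_circleMeasure_iff _).1 hb.re)
  have him := ae_tendsto_poisson ((integrable_circleMeasure_iff _).1 hb.im)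
  rw [ae_circleMeasure_iff]
  filter_upwards [hre, him] with t₀ h1 h2 ht
  have hint : ∀ r : ℝ, 0 ≤ r → r < 1 →
      Integrable (fun t => (diskKernel r (t - t₀) : ℂ) * b t) circleMeasure := by
    intro r h0 h1
    have hc : Continuous fun t => (diskKernel r (t - t₀) : ℂ) :=
      Complex.continuous_ofReal.comp ((contDiff_diskKernel h0 h1).continuous.comp (by fun_prop))
    obtain ⟨C, hC⟩ := (isCompact_Icc (a := (0 : ℝ)) (b := 2 * π)).exists_bound_of_continuousOn
      hc.continuousOn
    refine hb.bdd_mul hc.aestronglyMeasurable (c := C) ?_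
    rw [ae_circleMeasure_iff]
    exact ae_of_all _ fun t ht => hC t (Ioo_subset_Icc_self ht)
  have hlim : Tendsto (fun r : ℝ =>
      (((2 * π)⁻¹ * ∫ t in (0 : ℝ)..2 * π, diskKernel r (t - t₀) * (b t).re : ℝ) : ℂ) +
      (((2 * π)⁻¹ * ∫ t in (0 : ℝ)..2 * π, diskKernel r (t - t₀) * (b t).im : ℝ) : ℂ) * I)
      (𝓝[<] 1) (𝓝 (((b t₀).re : ℂ) + ((b t₀).im : ℂ) * I)) :=
    ((Complex.continuous_ofReal.tendsto _).comp (h1 ht)).add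
      (((Complex.continuous_ofReal.tendsto _).comp (h2 ht)).mul_const I)
  rw [Complex.re_add_im] at hlim
  refine hlim.congr' ?_
  filter_upwards [Ioo_mem_nhdsLT (show (0 : ℝ) < 1 by norm_num)] with r hr
  rw [← circleMap_eq_ofReal_mul, h _ (circleMap_mem_unitBall hr.1.le hr.2 t₀)]
  simp only [poissonKernel_circleMap hr.1.le]
  have e1 := integral_re (hint r hr.1.le hr.2)
  have e2 := integral_im (hint r hr.1.le hr.2)
  simp only [RCLike.re_eq_complex_re, RCLike.im_eq_complex_im, Complex.re_ofReal_mul,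
    Complex.im_ofReal_mul] at e1 e2
  rw [integral_circleMeasure, smul_eq_mul] at e1 e2
  rw [e1, e2, Complex.re_add_im]

/-- A holomorphic function with bounded quadratic means is the Poisson integral of its radial
limits, which exist almost everywhere. -/
theorem radialLimit_of_sq_bounded {g : ℂ → ℂ} (hg : DifferentiableOn ℂ g unitDisk) {M : ℝ}
    (hM : ∀ r ∈ Ioo (0 : ℝ) 1, Real.circleAverage (fun z => ‖g z‖ ^ 2) 0 r ≤ M) :
    MemLp (fun t => radialLimit g (circleMap 0 1 t)) 2 circleMeasure ∧
    (∀ w ∈ unitDisk, g w = ∫ t, (poissonKernel 0 w (circleMap 0 1 t) : ℂ) *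
      radialLimit g (circleMap 0 1 t) ∂circleMeasure) ∧
    ∀ᵐ t ∂circleMeasure, Tendsto (fun r : ℝ => g (r * circleMap 0 1 t)) (𝓝[<] 1)
      (𝓝 (radialLimit g (circleMap 0 1 t))) := by
  obtain ⟨b, hb, hP⟩ := exists_poisson_of_sq_bounded hg hM
  have hT := tendsto_radial_of_poisson (hb.integrable (by norm_num)) hP
  have hae : b =ᵐ[circleMeasure] fun t => radialLimit g (circleMap 0 1 t) := by
    filter_upwards [hT] with t ht using ht.limUnder_eq.symm
  refine ⟨(memLp_congr_ae hae).1 hb, fun w hw => ?_, ?_⟩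
  · rw [hP w hw]
    refine integral_congr_ae ?_
    filter_upwards [hae] with t ht
    rw [ht]
  · filter_upwards [hT, hae] with t ht h2
    rw [← h2]; exact ht

/-! ### Hardy pairs and their boundary values -/

/-- `g` is holomorphic in the disk and is the Poisson integral of its radial limits `G ∈ L²`. -/
structure HasBoundaryValues (g : ℂ → ℂ) (G : ℝ → ℂ) : Prop where
  diff : DifferentiableOn ℂ g unitDisk
  memLp : MemLp G 2 circleMeasure
  poisson : ∀ w ∈ unitDisk,
    g w = ∫ t, (poissonKernel 0 w (circleMap 0 1 t) : ℂ) * G t ∂circleMeasure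
  tendsto : ∀ᵐ t ∂circleMeasure,
    Tendsto (fun r : ℝ => g (r * circleMap 0 1 t)) (𝓝[<] 1) (𝓝 (G t))

theorem le_one_add_rpow {x p : ℝ} (hx : 0 ≤ x) (hp : 2 ≤ p) : x ^ 2 ≤ 1 + x ^ p := by
  rcases le_total x 1 with h | h
  · have := Real.rpow_nonneg hx p
    nlinarith
  · have := Real.rpow_le_rpow_of_exponent_le h hp
    rw [Real.rpow_two] at this
    linarith

theorem MemHarmonicHardy.exists_circleAverage_le {p : ℝ} (hp : 0 < p) {f : ℂ → ℂ}
    (h : MemHarmonicHardy p f) :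
    ∃ K, ∀ r ∈ Ioo (0 : ℝ) 1, Real.circleAverage (fun z => ‖f z‖ ^ p) 0 r ≤ K := by
  obtain ⟨C, hC⟩ := h.2
  refine ⟨C ^ p, fun r hr => ?_⟩
  have h1 : integralMean p f r ≤ C := hC ⟨r, hr, rfl⟩
  have h0 : 0 ≤ Real.circleAverage (fun z => ‖f z‖ ^ p) 0 r := by
    rw [circleAverage_eq_integral]
    exact integral_nonneg fun t => by positivity
  have h2 : Real.circleAverage (fun z => ‖f z‖ ^ p) 0 r = integralMean p f r ^ p := by
    rw [integralMean, ← Real.rpow_mul h0, one_div_mul_cancel hp.ne', Real.rpow_one]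
  rw [h2]
  exact Real.rpow_le_rpow (Real.rpow_nonneg h0 _) h1 hp.le

theorem circleAverage_re_mul {g h : ℂ → ℂ} (hg : DifferentiableOn ℂ g unitDisk)
    (hh : DifferentiableOn ℂ h unitDisk) {r : ℝ} (h0 : 0 ≤ r) (h1 : r < 1) :
    ∫ t, (g (circleMap 0 r t) * h (circleMap 0 r t)).re ∂circleMeasure = (g 0 * h 0).re := by
  have hsub : Metric.closedBall (0 : ℂ) r ⊆ unitDisk := Metric.closedBall_subset_ball h1
  have hd := (hg.mul hh).mono hsub
  have := DiffContOnCl.circleAverage_re (F := fun z => g z * h z) h0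
    (hd.mono Metric.closure_ball_subset_closedBall).diffContOnCl hd.continuousOn
  rwa [circleAverage_eq_integral] at this

/-- The cross term 2 Re(gh) is harmonic, so its mean is known. This is how control of f = g + h̄
becomes control of g and h separately. -/
theorem circleAverage_norm_add_conj_sq {g h : ℂ → ℂ} (hg : DifferentiableOn ℂ g unitDisk)
    (hh : DifferentiableOn ℂ h unitDisk) {r : ℝ} (h0 : 0 ≤ r) (h1 : r < 1) :
    ∫ t, (‖g (circleMap 0 r t)‖ ^ 2 + ‖h (circleMap 0 r t)‖ ^ 2) ∂circleMeasure =
      ∫ t, ‖harmonicMap g h (circleMap 0 r t)‖ ^ 2 ∂circleMeasure - 2 * (g 0 * h 0).re := by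
  have cg := hg.continuousOn.comp_circleMap h0 h1
  have ch := hh.continuousOn.comp_circleMap h0 h1
  rw [← circleAverage_re_mul hg hh h0 h1, ← integral_const_mul, ← integral_sub]
  · congr 1; ext t
    rw [harmonicMap, norm_add_conj_sq]; ring
  · refine Continuous.integrable_circleMeasure ?_
    unfold harmonicMap
    exact (cg.add (Complex.continuous_conj.comp ch)).norm.pow 2
  · exact (continuous_const.mul (Complex.continuous_re.comp (cg.mul ch))).integrable_circleMeasure

theorem IsHardyPair.exists_sq_le {p : ℝ} (hp : 2 ≤ p) {g h : ℂ → ℂ} (H : IsHardyPair p g h) :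
    ∃ M, ∀ r ∈ Ioo (0 : ℝ) 1, Real.circleAverage (fun z => ‖g z‖ ^ 2) 0 r ≤ M ∧
      Real.circleAverage (fun z => ‖h z‖ ^ 2) 0 r ≤ M := by
  obtain ⟨hg, hh, hm⟩ := H
  obtain ⟨K, hK⟩ := hm.exists_circleAverage_le (by linarith)
  refine ⟨1 + K - 2 * (g 0 * h 0).re, fun r hr => ?_⟩
  have cg := hg.continuousOn.comp_circleMap hr.1.le hr.2
  have ch := hh.continuousOn.comp_circleMap hr.1.le hr.2
  have cf : Continuous fun t => ‖harmonicMap g h (circleMap 0 r t)‖ := by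
    unfold harmonicMap
    exact (cg.add (Complex.continuous_conj.comp ch)).norm
  have e := circleAverage_norm_add_conj_sq hg hh hr.1.le hr.2
  have hK := hK r hr
  rw [circleAverage_eq_integral] at hK
  have hf2 : ∫ t, ‖harmonicMap g h (circleMap 0 r t)‖ ^ 2 ∂circleMeasure ≤
      ∫ t, (1 + ‖harmonicMap g h (circleMap 0 r t)‖ ^ p) ∂circleMeasure :=
    integral_mono (cf.pow 2).integrable_circleMeasure
      (continuous_const.add (cf.rpow_const fun _ => Or.inr (by linarith))).integrable_circleMeasure
      fun t => le_one_add_rpow (norm_nonneg _) hp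
  rw [integral_add (integrable_const _)
    (cf.rpow_const fun _ => Or.inr (by linarith)).integrable_circleMeasure] at hf2
  simp only [integral_const, probReal_univ, one_smul] at hf2
  rw [circleAverage_eq_integral, circleAverage_eq_integral]
  have i1 : Integrable (fun t => ‖g (circleMap 0 r t)‖ ^ 2) circleMeasure :=
    (cg.norm.pow 2).integrable_circleMeasure
  have i2 : Integrable (fun t => ‖h (circleMap 0 r t)‖ ^ 2) circleMeasure :=
    (ch.norm.pow 2).integrable_circleMeasure
  constructor
  · have := integral_mono i1 (i1.add i2) fun t => le_add_of_nonneg_right (sq_nonneg _)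
    simp only [Pi.add_apply] at this
    linarith
  · have := integral_mono i2 (i1.add i2) fun t => le_add_of_nonneg_left (sq_nonneg _)
    simp only [Pi.add_apply] at this
    linarith

theorem IsHardyPair.hasBoundaryValues {p : ℝ} (hp : 2 ≤ p) {g h : ℂ → ℂ} (H : IsHardyPair p g h) :
    HasBoundaryValues g (fun t => radialLimit g (circleMap 0 1 t)) ∧
      HasBoundaryValues h (fun t => radialLimit h (circleMap 0 1 t)) := by
  obtain ⟨M, hM⟩ := H.exists_sq_le hp
  obtain ⟨a1, a2, a3⟩ := radialLimit_of_sq_bounded H.1 fun r hr => (hM r hr).1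
  obtain ⟨b1, b2, b3⟩ := radialLimit_of_sq_bounded H.2.1 fun r hr => (hM r hr).2
  exact ⟨⟨H.1, a1, a2, a3⟩, ⟨H.2.1, b1, b2, b3⟩⟩

theorem integrable_diskKernel_mul {r : ℝ} (h0 : 0 ≤ r) (h1 : r < 1) (t₀ : ℝ) {φ : ℝ → ℝ} (hφ : Integrable φ circleMeasure) :
    Integrable (fun t => diskKernel r (t - t₀) * φ t) circleMeasure := by
  have hc : Continuous fun t => diskKernel r (t - t₀) :=
    (contDiff_diskKernel h0 h1).continuous.comp (by fun_prop)
  obtain ⟨C, hC⟩ := (isCompact_Icc (a := (0 : ℝ)) (b := 2 * π)).exists_bound_of_continuousOn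
    hc.continuousOn
  refine hφ.bdd_mul hc.aestronglyMeasurable (c := C) ?_
  rw [ae_circleMeasure_iff]
  exact ae_of_all _ fun t ht => hC t (Ioo_subset_Icc_self ht)

/-- A rescaled Bernoulli inequality: the tangent of t^p at y. Integrated against a probability
density with y the mean, it becomes Jensen's inequality. -/
theorem rpow_tangent_le {x y p : ℝ} (hx : 0 ≤ x) (hy : 0 ≤ y) (hp : 1 ≤ p) :
    y ^ p + p * y ^ (p - 1) * (x - y) ≤ x ^ p := by
  rcases hy.eq_or_lt with rfl | hy
  · rcases hp.eq_or_lt with rfl | hp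
    · simp
    · rw [Real.zero_rpow (by linarith), Real.zero_rpow (by linarith)]
      simpa using Real.rpow_nonneg hx p
  · have h := one_add_mul_self_le_rpow_one_add (s := x / y - 1) (by
      have := div_nonneg hx hy.le; linarith) hp
    rw [add_sub_cancel, Real.div_rpow hx hy.le, le_div_iff₀ (by positivity)] at h
    refine le_trans (le_of_eq ?_) h
    rw [Real.rpow_sub_one hy.ne']
    field_simp

/-- Jensen's inequality for the Poisson integral. -/
theorem HasBoundaryValues.norm_rpow_le {g h : ℂ → ℂ} {G H : ℝ → ℂ} (hg : HasBoundaryValues g G)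
    (hh : HasBoundaryValues h H) {p : ℝ} (hp : 1 ≤ p)
    (hi : Integrable (fun t => ‖G t + conj (H t)‖ ^ p) circleMeasure) {r : ℝ} (h0 : 0 ≤ r)
    (h1 : r < 1) (t₀ : ℝ) :
    ‖harmonicMap g h (circleMap 0 r t₀)‖ ^ p ≤
      ∫ t, diskKernel r (t - t₀) * ‖G t + conj (H t)‖ ^ p ∂circleMeasure := by
  have iG := hg.memLp.integrable (by norm_num)
  have iH := hh.memLp.integrable (by norm_num)
  have hK0 : ∀ t, 0 < diskKernel r (t - t₀) := fun t => diskKernel_pos h0 h1 _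
  have iK : ∀ {φ : ℝ → ℝ}, Integrable φ circleMeasure →
      Integrable (fun t => diskKernel r (t - t₀) * φ t) circleMeasure := fun hφ =>
    integrable_diskKernel_mul h0 h1 t₀ hφ
  have iN : Integrable (fun t => ‖G t + conj (H t)‖) circleMeasure := by
    refine (iG.add ?_).norm
    exact (Complex.conjCLE : ℂ →L[ℝ] ℂ).integrable_comp iH
  have hKc : Continuous fun t => (diskKernel r (t - t₀) : ℂ) :=
    Complex.continuous_ofReal.comp ((contDiff_diskKernel h0 h1).continuous.comp (by fun_prop))
  have iC : ∀ {φ : ℝ → ℂ}, Integrable φ circleMeasure →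
      Integrable (fun t => (diskKernel r (t - t₀) : ℂ) * φ t) circleMeasure := by
    intro φ hφ
    refine (iK hφ.norm).mono' (hKc.aestronglyMeasurable.mul hφ.aestronglyMeasurable) ?_
    exact ae_of_all _ fun t => by rw [norm_mul, Complex.norm_real, Real.norm_of_nonneg (hK0 t).le]
  have hle : ‖harmonicMap g h (circleMap 0 r t₀)‖ ≤
      ∫ t, diskKernel r (t - t₀) * ‖G t + conj (H t)‖ ∂circleMeasure := by
    have e : harmonicMap g h (circleMap 0 r t₀) =
        ∫ t, (diskKernel r (t - t₀) : ℂ) * (G t + conj (H t)) ∂circleMeasure := by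
      rw [harmonicMap, hg.poisson _ (circleMap_mem_unitBall h0 h1 t₀),
        hh.poisson _ (circleMap_mem_unitBall h0 h1 t₀), ← integral_conj, ← integral_add]
      · congr 1; ext t
        rw [poissonKernel_circleMap h0, map_mul, Complex.conj_ofReal]; ring
      · simp only [poissonKernel_circleMap h0]
        exact iC iG
      · simp only [poissonKernel_circleMap h0]
        exact (Complex.conjCLE : ℂ →L[ℝ] ℂ).integrable_comp (iC iH)
    rw [e]
    refine (norm_integral_le_integral_norm _).trans (le_of_eq ?_)
    congr 1; ext t
    rw [norm_mul, Complex.norm_real, Real.norm_of_nonneg (hK0 t).le]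
  set y := ∫ t, diskKernel r (t - t₀) * ‖G t + conj (H t)‖ ∂circleMeasure with hy
  have hy0 : 0 ≤ y := (norm_nonneg _).trans hle
  have h1K : ∫ t, diskKernel r (t - t₀) ∂circleMeasure = 1 := by
    rw [integral_circleMeasure, smul_eq_mul, integral_diskKernel h0 h1]
  have iK1 : Integrable (fun t => diskKernel r (t - t₀)) circleMeasure := by
    simpa using iK (integrable_const (1 : ℝ))
  refine (Real.rpow_le_rpow (norm_nonneg _) hle (by linarith)).trans ?_
  have i3 : Integrable (fun t => (y ^ p - p * y ^ (p - 1) * y) * diskKernel r (t - t₀) +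
      p * y ^ (p - 1) * (diskKernel r (t - t₀) * ‖G t + conj (H t)‖)) circleMeasure :=
    (iK1.const_mul _).add ((iK iN).const_mul _)
  have := integral_mono i3 (iK hi) fun t => by
    have := mul_le_mul_of_nonneg_left (rpow_tangent_le (norm_nonneg (G t + conj (H t))) hy0 hp)
      (hK0 t).le
    refine le_trans (le_of_eq ?_) this
    ring
  rw [integral_add (iK1.const_mul _) ((iK iN).const_mul _), integral_const_mul, integral_const_mul,
    h1K, ← hy] at this
  linarith

theorem integral_integral_diskKernel {r : ℝ} (h0 : 0 ≤ r) (h1 : r < 1) {φ : ℝ → ℝ}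
    (hφ : Integrable φ circleMeasure) :
    Integrable (fun t₀ => ∫ t, diskKernel r (t - t₀) * φ t ∂circleMeasure) circleMeasure ∧
    ∫ t₀, ∫ t, diskKernel r (t - t₀) * φ t ∂circleMeasure ∂circleMeasure =
      ∫ t, φ t ∂circleMeasure := by
  have hc : Continuous fun x : ℝ × ℝ => diskKernel r (x.2 - x.1) :=
    (contDiff_diskKernel h0 h1).continuous.comp (by fun_prop)
  have hi : Integrable (fun x : ℝ × ℝ => diskKernel r (x.2 - x.1) * φ x.2)
      (circleMeasure.prod circleMeasure) := by
    obtain ⟨C, hC⟩ := (isCompact_Icc (a := -(2 * π)) (b := 2 * π)).exists_bound_of_continuousOn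
      (contDiff_diskKernel h0 h1).continuous.continuousOn
    refine (hφ.comp_snd circleMeasure).bdd_mul hc.aestronglyMeasurable (c := C) ?_
    have hae : ∀ᵐ t ∂circleMeasure, t ∈ Ioo 0 (2 * π) := by
      rw [ae_circleMeasure_iff]; exact ae_of_all _ fun t ht => ht
    filter_upwards [Measure.quasiMeasurePreserving_fst.ae hae,
      Measure.quasiMeasurePreserving_snd.ae hae] with x hx hy
    exact hC _ ⟨by linarith [hx.2, hy.1], by linarith [hx.1, hy.2]⟩
  refine ⟨hi.integral_prod_left, ?_⟩
  -- After Fubini the kernel is integrated in the other variable, where its evenness gives total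
  -- mass 1.
  rw [integral_integral_swap hi]
  congr 1; ext t
  rw [integral_mul_const]
  have : ∀ s, diskKernel r (t - s) = diskKernel r (s - t) := fun s => by
    rw [diskKernel, diskKernel, ← Real.cos_neg, neg_sub]
  simp only [this]
  rw [integral_circleMeasure, smul_eq_mul, integral_diskKernel h0 h1, one_mul]

/-- The integral means of a Poisson integral are bounded by the norm of the boundary function. -/
theorem HasBoundaryValues.integral_norm_rpow_le {g h : ℂ → ℂ} {G H : ℝ → ℂ}
    (hg : HasBoundaryValues g G) (hh : HasBoundaryValues h H) {p : ℝ} (hp : 1 ≤ p)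
    (hi : Integrable (fun t => ‖G t + conj (H t)‖ ^ p) circleMeasure) {r : ℝ} (h0 : 0 ≤ r)
    (h1 : r < 1) :
    ∫ t, ‖harmonicMap g h (circleMap 0 r t)‖ ^ p ∂circleMeasure ≤
      ∫ t, ‖G t + conj (H t)‖ ^ p ∂circleMeasure := by
  obtain ⟨i, e⟩ := integral_integral_diskKernel h0 h1 hi
  rw [← e]
  refine integral_mono (Continuous.integrable_circleMeasure ?_) i fun t₀ =>
    hg.norm_rpow_le hh hp hi h0 h1 t₀
  unfold harmonicMap
  refine Continuous.rpow_const (Continuous.norm ?_) fun _ => Or.inr (by linarith)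
  exact (hg.diff.continuousOn.comp_circleMap h0 h1).add
    (Complex.continuous_conj.comp (hh.diff.continuousOn.comp_circleMap h0 h1))

/-- Fatou's lemma along circles increasing to the unit circle. -/
theorem HasBoundaryValues.fatou {g h : ℂ → ℂ} {G H : ℝ → ℂ}
    (hg : HasBoundaryValues g G) (hh : HasBoundaryValues h H) {Φ : ℂ → ℂ → ℝ}
    (hΦ : Continuous fun x : ℂ × ℂ => Φ x.1 x.2) (hΦ0 : ∀ z w, 0 ≤ Φ z w) {K : ℝ}
    (hK : ∀ r ∈ Ioo (0 : ℝ) 1,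
      ∫ t, Φ (g (circleMap 0 r t)) (h (circleMap 0 r t)) ∂circleMeasure ≤ K) :
    Integrable (fun t => Φ (G t) (H t)) circleMeasure ∧
      ∫ t, Φ (G t) (H t) ∂circleMeasure ≤ K := by
  obtain ⟨r, -, hr1, hrt⟩ := exists_seq_strictMono_tendsto' (show (0 : ℝ) < 1 by norm_num)
  have hrt' : Tendsto r atTop (𝓝[<] 1) :=
    tendsto_nhdsWithin_iff.2 ⟨hrt, Eventually.of_forall fun n => (hr1 n).2⟩
  have hcont : ∀ n, Continuous fun t => Φ (g (circleMap 0 (r n) t)) (h (circleMap 0 (r n) t)) :=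
    fun n => hΦ.comp ((hg.diff.continuousOn.comp_circleMap (hr1 n).1.le (hr1 n).2).prodMk
      (hh.diff.continuousOn.comp_circleMap (hr1 n).1.le (hr1 n).2))
  have hK0 : 0 ≤ K := (integral_nonneg fun t => hΦ0 _ _).trans (hK (r 0) (hr1 0))
  have hlim : ∀ᵐ t ∂circleMeasure, Tendsto
      (fun n => Φ (g (circleMap 0 (r n) t)) (h (circleMap 0 (r n) t))) atTop
      (𝓝 (Φ (G t) (H t))) := by
    filter_upwards [hg.tendsto, hh.tendsto] with t h1 h2
    have := (hΦ.tendsto (G t, H t)).comp ((h1.comp hrt').prodMk_nhds (h2.comp hrt'))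
    refine this.congr fun n => ?_
    simp only [Function.comp_apply, ← circleMap_eq_ofReal_mul]
  have hmeas : AEStronglyMeasurable (fun t => Φ (G t) (H t)) circleMeasure :=
    aestronglyMeasurable_of_tendsto_ae _ (fun n => (hcont n).aestronglyMeasurable) hlim
  have hl : ∫⁻ t, ENNReal.ofReal (Φ (G t) (H t)) ∂circleMeasure ≤ ENNReal.ofReal K := by
    calc ∫⁻ t, ENNReal.ofReal (Φ (G t) (H t)) ∂circleMeasure
        = ∫⁻ t, liminf (fun n => ENNReal.ofReal
            (Φ (g (circleMap 0 (r n) t)) (h (circleMap 0 (r n) t)))) atTop ∂circleMeasure := by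
          refine lintegral_congr_ae ?_
          filter_upwards [hlim] with t ht
          exact ((ENNReal.continuous_ofReal.tendsto _).comp ht).liminf_eq.symm
      _ ≤ liminf (fun n => ∫⁻ t, ENNReal.ofReal
            (Φ (g (circleMap 0 (r n) t)) (h (circleMap 0 (r n) t))) ∂circleMeasure) atTop :=
          lintegral_liminf_le fun n => (ENNReal.continuous_ofReal.comp (hcont n)).measurable
      _ ≤ ENNReal.ofReal K := by
          refine liminf_le_of_le (by isBoundedDefault) fun b hb => ?_
          obtain ⟨n, hn⟩ := hb.exists
          refine hn.trans ?_
          rw [← ofReal_integral_eq_lintegral_ofReal (hcont n).integrable_circleMeasure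
            (ae_of_all _ fun t => hΦ0 _ _)]
          exact ENNReal.ofReal_le_ofReal (hK _ (hr1 n))
  have hint : Integrable (fun t => Φ (G t) (H t)) circleMeasure := by
    refine ⟨hmeas, ?_⟩
    rw [hasFiniteIntegral_iff_ofReal (ae_of_all _ fun t => hΦ0 _ _)]
    exact hl.trans_lt ENNReal.ofReal_lt_top
  refine ⟨hint, ?_⟩
  rw [← ofReal_integral_eq_lintegral_ofReal hint (ae_of_all _ fun t => hΦ0 _ _)] at hl
  exact (ENNReal.ofReal_le_ofReal_iff hK0).1 hl

/-! ### The inequality -/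

/-- The angle is π/2, so after multiplication by q ≥ 1 and clipping it lies in [π/2, π]. Only here
does the normalization Re(g(0)h(0)) = 0 affect the sign of the auxiliary term. -/
theorem angleFun_nonneg_of_re_eq_zero {q : ℝ} (hq : 1 ≤ q) {ζ : ℂ} (h : ζ.re = 0) :
    0 ≤ angleFun q ζ := by
  rw [angleFun, h, neg_zero, zero_div, Real.arccos_zero, neg_nonneg]
  refine mul_nonpos_of_nonneg_of_nonpos (by positivity) ?_
  refine Real.cos_nonpos_of_pi_div_two_le_of_le (le_min ?_ ?_) ((min_le_right _ _).trans ?_)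
  all_goals nlinarith [Real.pi_pos]

namespace HasBoundaryValues

variable {g h : ℂ → ℂ} {G H : ℝ → ℂ}

theorem integrable_norm_rpow (hg : HasBoundaryValues g G) (hh : HasBoundaryValues h H) {p K : ℝ}
    (hp : 0 < p) (hK : ∀ r ∈ Ioo (0 : ℝ) 1,
      ∫ t, ‖harmonicMap g h (circleMap 0 r t)‖ ^ p ∂circleMeasure ≤ K) :
    Integrable (fun t => ‖G t + conj (H t)‖ ^ p) circleMeasure ∧
      ∫ t, ‖G t + conj (H t)‖ ^ p ∂circleMeasure ≤ K :=
  hg.fatou hh (Φ := fun z w => ‖z + conj w‖ ^ p)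
    ((by fun_prop : Continuous fun x : ℂ × ℂ => ‖x.1 + conj x.2‖).rpow_const
      fun _ => Or.inr hp.le)
    (fun z w => by positivity) hK

/-- Fatou's lemma for |g|² + |h|² and contractivity of the Poisson integral for |f|²: their
difference is twice the real part of the product. This direction suffices for the equality case. -/
theorem re_le_integral_re (hg : HasBoundaryValues g G) (hh : HasBoundaryValues h H) :
    (g 0 * h 0).re ≤ ∫ t, (G t * H t).re ∂circleMeasure := by
  have i1 : Integrable (fun t => ‖G t‖ ^ 2) circleMeasure := hg.memLp.integrable_norm_pow (by simp)
  have i2 : Integrable (fun t => ‖H t‖ ^ 2) circleMeasure := hh.memLp.integrable_norm_pow (by simp)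
  have i3 : Integrable (fun t => (G t * H t).re) circleMeasure :=
    (hg.memLp.integrable_mul hh.memLp).re
  have e : ∀ t, ‖G t + conj (H t)‖ ^ (2 : ℝ) = ‖G t‖ ^ 2 + ‖H t‖ ^ 2 + 2 * (G t * H t).re :=
    fun t => by rw [Real.rpow_two, norm_add_conj_sq]
  have hi : Integrable (fun t => ‖G t + conj (H t)‖ ^ (2 : ℝ)) circleMeasure := by
    simp only [e]; exact (i1.add i2).add (i3.const_mul 2)
  have h1 := (hg.fatou hh (Φ := fun z w => ‖z‖ ^ 2 + ‖w‖ ^ 2) (by fun_prop)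
    (fun z w => by positivity)
    (K := ∫ t, ‖G t + conj (H t)‖ ^ (2 : ℝ) ∂circleMeasure - 2 * (g 0 * h 0).re)
    (fun r hr => by
      rw [circleAverage_norm_add_conj_sq hg.diff hh.diff hr.1.le hr.2]
      have := hg.integral_norm_rpow_le hh (by norm_num) hi hr.1.le hr.2
      simp only [Real.rpow_two] at this ⊢
      linarith)).2
  simp only [e] at h1
  have e2 := integral_add (i1.add i2) (i3.const_mul 2)
  simp only [Pi.add_apply] at e2
  rw [e2, integral_const_mul] at h1
  linarith

/-- The integrand is nonnegative as a whole, so Fatou's lemma applies although V changes sign. On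
each circle the |f|^p term is bounded by its boundary integral and the V term by its value at the
center. -/
theorem fatou_sub (hg : HasBoundaryValues g G) (hh : HasBoundaryValues h H) {p : ℝ} (hp : 1 ≤ p)
    (A : ℝ) {B : ℝ} (hB : 0 ≤ B) {V : ℂ → ℝ} (hA : 0 ≤ A) (hV : Continuous V)
    (hsub : ∀ F : ℂ → ℂ, DifferentiableOn ℂ F unitDisk → ∀ r ∈ Ioo (0 : ℝ) 1,
      V (F 0) ≤ Real.circleAverage (fun z => V (F z)) 0 r)
    (hpos : ∀ z w, 0 ≤ A * ‖z + conj w‖ ^ p - B * V (z * w))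
    (hi : Integrable (fun t => ‖G t + conj (H t)‖ ^ p) circleMeasure) :
    Integrable (fun t => A * ‖G t + conj (H t)‖ ^ p - B * V (G t * H t)) circleMeasure ∧
      ∫ t, (A * ‖G t + conj (H t)‖ ^ p - B * V (G t * H t)) ∂circleMeasure ≤
        A * ∫ t, ‖G t + conj (H t)‖ ^ p ∂circleMeasure - B * V (g 0 * h 0) := by
  have hcont : Continuous fun x : ℂ × ℂ => ‖x.1 + conj x.2‖ ^ p :=
    (by fun_prop : Continuous fun x : ℂ × ℂ => ‖x.1 + conj x.2‖).rpow_const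
      fun _ => Or.inr (by linarith)
  have hv : Continuous fun x : ℂ × ℂ => V (x.1 * x.2) := hV.comp (by fun_prop)
  refine hg.fatou hh (Φ := fun z w => A * ‖z + conj w‖ ^ p - B * V (z * w))
    ((continuous_const.mul hcont).sub (continuous_const.mul hv)) hpos fun r hr => ?_
  have cg := hg.diff.continuousOn.comp_circleMap hr.1.le hr.2
  have ch := hh.diff.continuousOn.comp_circleMap hr.1.le hr.2
  have i1 : Integrable (fun t => ‖g (circleMap 0 r t) + conj (h (circleMap 0 r t))‖ ^ p)
      circleMeasure := (hcont.comp (cg.prodMk ch)).integrable_circleMeasure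
  have i2 : Integrable (fun t => V (g (circleMap 0 r t) * h (circleMap 0 r t)))
      circleMeasure := (hv.comp (cg.prodMk ch)).integrable_circleMeasure
  rw [integral_sub (i1.const_mul A) (i2.const_mul B), integral_const_mul, integral_const_mul]
  have j1 := hg.integral_norm_rpow_le hh hp hi hr.1.le hr.2
  have j2 := hsub _ (hg.diff.mul hh.diff) r hr
  rw [circleAverage_eq_integral] at j2
  exact sub_le_sub (mul_le_mul_of_nonneg_left j1 hA) (mul_le_mul_of_nonneg_left j2 hB)

theorem riesz (hg : HasBoundaryValues g G) (hh : HasBoundaryValues h H) {p c : ℝ} (hp : 2 ≤ p)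
    (hc : 0 < c) (hi : Integrable (fun t => ‖G t + conj (H t)‖ ^ p) circleMeasure) :
    Integrable (fun t => (‖G t‖ ^ 2 + c * ‖H t‖ ^ 2) ^ (p / 2)) circleMeasure ∧
    ((g 0 * h 0).re = 0 →
      ∫ t, (‖G t‖ ^ 2 + c * ‖H t‖ ^ 2) ^ (p / 2) ∂circleMeasure ≤
        rieszConst p c ^ p * ∫ t, ‖G t + conj (H t)‖ ^ p ∂circleMeasure ∧
      (2 < p → ∫ t, (‖G t‖ ^ 2 + c * ‖H t‖ ^ 2) ^ (p / 2) ∂circleMeasure =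
        rieszConst p c ^ p * ∫ t, ‖G t + conj (H t)‖ ^ p ∂circleMeasure →
        ∀ᵐ t ∂circleMeasure, G t = 0 ∧ H t = 0)) := by
  obtain ⟨B, hB, hpt⟩ := pointwise_riesz hp hc
  have hq : 1 ≤ p / 2 := by linarith
  set A := rieszConst p c ^ p
  have hA : 0 ≤ A := Real.rpow_nonneg (rieszConst_nonneg p c hc.le) _
  have hN : ∀ z w : ℂ, 0 ≤ (‖z‖ ^ 2 + c * ‖w‖ ^ 2) ^ (p / 2) := fun z w => by positivity
  set X := ∫ t, ‖G t + conj (H t)‖ ^ p ∂circleMeasure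
  obtain ⟨iΦ, hΦ⟩ := hg.fatou_sub hh (by linarith : 1 ≤ p) A hB (V := angleFun (p / 2)) hA
    (continuous_angleFun (by linarith)) (fun F hF r hr =>
      angleFun_le_circleAverage hq hF hr.1 hr.2)
    (fun z w => by linarith [(hpt z w).1, hN z w]) hi
  have iN : Integrable (fun t => (‖G t‖ ^ 2 + c * ‖H t‖ ^ 2) ^ (p / 2)) circleMeasure := by
    refine iΦ.mono' ?_ (ae_of_all _ fun t => ?_)
    · have m1 : AEMeasurable (fun t => ‖G t‖ ^ 2 + c * ‖H t‖ ^ 2) circleMeasure :=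
        (hg.memLp.1.aemeasurable.norm.pow_const 2).add
          ((hh.memLp.1.aemeasurable.norm.pow_const 2).const_mul c)
      exact (m1.pow_const (p / 2)).aestronglyMeasurable
    · rw [Real.norm_of_nonneg (hN _ _)]
      linarith [(hpt (G t) (H t)).1]
  refine ⟨iN, fun h0 => ?_⟩
  have hv0 := mul_nonneg hB (angleFun_nonneg_of_re_eq_zero hq h0)
  have hle := integral_mono iN iΦ fun t => by
    show (‖G t‖ ^ 2 + c * ‖H t‖ ^ 2) ^ (p / 2) ≤ A * ‖G t + conj (H t)‖ ^ p - B * angleFun (p / 2) (G t * H t)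
    linarith [(hpt (G t) (H t)).1]
  refine ⟨by linarith, fun hp2 heq => ?_⟩
  have hz : ∫ t, ((A * ‖G t + conj (H t)‖ ^ p - B * angleFun (p / 2) (G t * H t)) -
      (‖G t‖ ^ 2 + c * ‖H t‖ ^ 2) ^ (p / 2)) ∂circleMeasure = 0 := by
    rw [integral_sub iΦ iN]; linarith
  replace hz := (integral_eq_zero_iff_of_nonneg (fun t => by
    have := (hpt (G t) (H t)).1
    simp only [Pi.zero_apply, Pi.sub_apply]; linarith) (iΦ.sub iN)).1 hz
  have hcase : ∀ᵐ t ∂circleMeasure, (G t = 0 ∧ H t = 0) ∨ (G t * H t).re < 0 := by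
    filter_upwards [hz] with t ht
    refine (hpt (G t) (H t)).2 hp2 ?_
    simp only [Pi.zero_apply, Pi.sub_apply] at ht
    linarith
  have i3 : Integrable (fun t => (G t * H t).re) circleMeasure :=
    (hg.memLp.integrable_mul hh.memLp).re
  have hneg : 0 ≤ᵐ[circleMeasure] fun t => -(G t * H t).re := by
    filter_upwards [hcase] with t ht
    rcases ht with ⟨h1, h2⟩ | h
    · simp [h1]
    · simp only [Pi.zero_apply]; linarith
  -- Re(GH) is nonpositive almost everywhere but has nonnegative integral, hence vanishes; this
  -- rules out the alternative Re(GH) < 0.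
  have hre := hg.re_le_integral_re hh
  rw [h0] at hre
  have hge := integral_nonneg_of_ae hneg
  have hz2 : ∫ t, -(G t * H t).re ∂circleMeasure = 0 := by
    rw [integral_neg] at hge ⊢; linarith
  replace hz2 := (integral_eq_zero_iff_of_nonneg_ae hneg i3.neg).1 hz2
  filter_upwards [hcase, hz2] with t ht h2
  rcases ht with h | h
  · exact h
  · simp only [Pi.zero_apply] at h2; linarith

theorem eq_zero (hg : HasBoundaryValues g G) (h : ∀ᵐ t ∂circleMeasure, G t = 0) :
    ∀ z ∈ unitDisk, g z = 0 := by
  intro z hz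
  rw [hg.poisson z hz]
  refine integral_eq_zero_of_ae ?_
  filter_upwards [h] with t ht
  rw [ht, mul_zero]; rfl

theorem hasRadialLimit (hg : HasBoundaryValues g G) :
    ∀ᵐ t : ℝ, HasRadialLimit g (circleMap 0 1 t) := by
  have h := ae_circleMeasure_iff.1 hg.tendsto
  -- The measure sees only one period; its translates cover the line up to the countable set of
  -- multiples of 2π.
  have h1 : ∀ᵐ t : ℝ, ∀ n : ℤ, t - 2 * π * n ∈ Ioo 0 (2 * π) →
      HasRadialLimit g (circleMap 0 1 (t - 2 * π * n)) := by
    rw [ae_all_iff]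
    intro n
    filter_upwards [(measurePreserving_sub_right volume (2 * π * n)).quasiMeasurePreserving.ae h]
      with t ht hm using ⟨_, ht hm⟩
  have h2 : ∀ᵐ t : ℝ, ∀ n : ℤ, t ≠ 2 * π * n := by
    rw [ae_all_iff]
    intro n
    exact Measure.ae_ne volume _
  filter_upwards [h1, h2] with t h1 h2
  have hpi := Real.two_pi_pos
  set n := ⌊t / (2 * π)⌋
  have a1 := Int.floor_le (t / (2 * π))
  have a2 := Int.lt_floor_add_one (t / (2 * π))
  rw [le_div_iff₀ hpi] at a1
  rw [div_lt_iff₀ hpi] at a2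
  have hne := h2 n
  have := h1 n ⟨by
    rcases (sub_nonneg.2 (show 2 * π * n ≤ t by linarith)).lt_or_eq with h | h
    · exact h
    · exact absurd (sub_eq_zero.1 h.symm) hne, by linarith⟩
  have e : circleMap 0 1 (t - 2 * π * n) = circleMap 0 1 t := by
    have := (periodic_circleMap 0 1).sub_int_mul_eq n (x := t)
    rwa [mul_comm] at this
  rwa [e] at this

end HasBoundaryValues

theorem weightedNorm_eq (p c : ℝ) (g h : ℂ → ℂ) : weightedNorm p c g h =
    (∫ t, (‖radialLimit g (circleMap 0 1 t)‖ ^ 2 + c * ‖radialLimit h (circleMap 0 1 t)‖ ^ 2) ^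
      (p / 2) ∂circleMeasure) ^ (1 / p) := by
  rw [weightedNorm, circleAverage_eq_integral]; rfl

theorem HasBoundaryValues.radialLimit_harmonicMap {g h : ℂ → ℂ} {G H : ℝ → ℂ}
    (hg : HasBoundaryValues g G) (hh : HasBoundaryValues h H) :
    ∀ᵐ t ∂circleMeasure,
      radialLimit (harmonicMap g h) (circleMap 0 1 t) = G t + conj (H t) := by
  filter_upwards [hg.tendsto, hh.tendsto] with t h1 h2
  exact (h1.add ((Complex.continuous_conj.tendsto _).comp h2)).limUnder_eq

theorem HasBoundaryValues.boundaryNorm_eq {g h : ℂ → ℂ} {G H : ℝ → ℂ}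
    (hg : HasBoundaryValues g G) (hh : HasBoundaryValues h H) (p : ℝ) :
    boundaryNorm p (harmonicMap g h) =
      (∫ t, ‖G t + conj (H t)‖ ^ p ∂circleMeasure) ^ (1 / p) := by
  rw [boundaryNorm, circleAverage_eq_integral]
  congr 1
  refine integral_congr_ae ?_
  filter_upwards [hg.radialLimit_harmonicMap hh] with t ht
  rw [boundaryDensity, ht]

namespace IsHardyPair

variable {p c : ℝ} {g h : ℂ → ℂ}

theorem integrable_norm_rpow (hp : 2 ≤ p) (H : IsHardyPair p g h) :
    Integrable (fun t => ‖radialLimit g (circleMap 0 1 t) +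
      conj (radialLimit h (circleMap 0 1 t))‖ ^ p) circleMeasure := by
  obtain ⟨hg, hh⟩ := H.hasBoundaryValues hp
  obtain ⟨K, hK⟩ := H.2.2.exists_circleAverage_le (by linarith)
  refine (hg.integrable_norm_rpow hh (by linarith) (K := K) fun r hr => ?_).1
  have := hK r hr
  rwa [circleAverage_eq_integral] at this

theorem circleIntegrable (hp : 2 ≤ p) (hc : 0 < c) (H : IsHardyPair p g h) :
    CircleIntegrable (weightedDensity p c g h) 0 1 ∧
      CircleIntegrable (boundaryDensity p (harmonicMap g h)) 0 1 := by
  obtain ⟨hg, hh⟩ := H.hasBoundaryValues hp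
  have hi := H.integrable_norm_rpow hp
  rw [circleIntegrable_iff_integrable, circleIntegrable_iff_integrable]
  refine ⟨(hg.riesz hh hp hc hi).1, hi.congr ?_⟩
  filter_upwards [hg.radialLimit_harmonicMap hh] with t ht
  rw [boundaryDensity, ht]

end IsHardyPair

theorem IsAdmissible.weightedNorm_le {p c : ℝ} {g h : ℂ → ℂ} (hp : 2 ≤ p) (hc : 0 < c)
    (H : IsAdmissible p g h) :
    weightedNorm p c g h ≤ rieszConst p c * boundaryNorm p (harmonicMap g h) := by
  obtain ⟨hg, hh⟩ := H.1.hasBoundaryValues hp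
  have hi := H.1.integrable_norm_rpow hp
  have h1 := ((hg.riesz hh hp hc hi).2 H.2).1
  have ha := rieszConst_nonneg p c hc.le
  rw [weightedNorm_eq, hg.boundaryNorm_eq hh]
  refine (Real.rpow_le_rpow (integral_nonneg fun t => by positivity) h1 (by positivity)).trans
    (le_of_eq ?_)
  rw [Real.mul_rpow (by positivity) (integral_nonneg fun t => by positivity), ← Real.rpow_mul ha,
    mul_one_div_cancel (by linarith), Real.rpow_one]

theorem IsAdmissible.weightedNorm_ne {p c : ℝ} {g h : ℂ → ℂ} (hp : 2 < p) (hc : 0 < c)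
    (H : IsAdmissible p g h) (hne : ∃ z ∈ unitDisk, harmonicMap g h z ≠ 0) :
    weightedNorm p c g h ≠ rieszConst p c * boundaryNorm p (harmonicMap g h) := by
  obtain ⟨hg, hh⟩ := H.1.hasBoundaryValues hp.le
  have hi := H.1.integrable_norm_rpow hp.le
  have ha := rieszConst_nonneg p c hc.le
  intro heq
  have h1 := ((hg.riesz hh hp.le hc hi).2 H.2).2 hp (by
    rw [weightedNorm_eq, hg.boundaryNorm_eq hh] at heq
    have := congrArg (· ^ p) heq
    beta_reduce at this
    rwa [Real.mul_rpow ha (Real.rpow_nonneg (integral_nonneg fun t => by positivity) _),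
      ← Real.rpow_mul (integral_nonneg fun t => by positivity),
      ← Real.rpow_mul (integral_nonneg fun t => by positivity),
      one_div_mul_cancel (by linarith), Real.rpow_one, Real.rpow_one] at this)
  obtain ⟨z, hz, hne⟩ := hne
  refine hne ?_
  rw [harmonicMap, hg.eq_zero (h1.mono fun t ht => ht.1) z hz,
    hh.eq_zero (h1.mono fun t ht => ht.2) z hz]
  simp

/-! ### The sector maps -/

/-- The Cayley map of the unit disk onto the right half-plane. -/
noncomputable def cayley (z : ℂ) : ℂ := (1 - z) / (1 + z)

theorem sectorMap_eq (γ : ℝ) (z : ℂ) : sectorMap γ z = cayley z ^ (γ : ℂ) := rfl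

theorem one_add_ne_zero {z : ℂ} (hz : z ∈ unitDisk) : 1 + z ≠ 0 := by
  intro h
  have : z = -1 := by linear_combination h
  rw [unitDisk, mem_ball_zero_iff, this] at hz
  simp at hz

theorem cayley_re (z : ℂ) : (cayley z).re = (1 - ‖z‖ ^ 2) / ‖1 + z‖ ^ 2 := by
  rw [cayley, Complex.div_re, ← Complex.normSq_eq_norm_sq, ← Complex.normSq_eq_norm_sq, ← add_div]
  congr 1
  simp only [Complex.normSq_apply, Complex.sub_re, Complex.sub_im, Complex.add_re, Complex.add_im,
    Complex.one_re, Complex.one_im]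
  ring

theorem cayley_re_pos {z : ℂ} (hz : z ∈ unitDisk) : 0 < (cayley z).re := by
  rw [cayley_re]
  have h1 : ‖z‖ < 1 := by simpa [unitDisk] using hz
  have h2 := norm_pos_iff.2 (one_add_ne_zero hz)
  have h3 := norm_nonneg z
  have : 0 < 1 - ‖z‖ ^ 2 := by nlinarith
  positivity

theorem differentiableOn_cayley : DifferentiableOn ℂ cayley unitDisk := fun _ hz =>
  ((differentiableAt_id.const_sub 1).div (differentiableAt_id.const_add 1)
    (one_add_ne_zero hz)).differentiableWithinAt

theorem differentiableOn_sectorMap (γ : ℝ) : DifferentiableOn ℂ (sectorMap γ) unitDisk :=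
  fun z hz => (differentiableOn_cayley z hz).cpow (differentiableWithinAt_const _)
    (Or.inl (cayley_re_pos hz))

theorem sectorMap_zero (γ : ℝ) : sectorMap γ 0 = 1 := by simp [sectorMap]

theorem norm_sectorMap (γ : ℝ) (z : ℂ) : ‖sectorMap γ z‖ = ‖cayley z‖ ^ γ :=
  Complex.norm_cpow_real _ _

theorem norm_sectorMap_rpow (γ p : ℝ) (z : ℂ) : ‖sectorMap γ z‖ ^ p = ‖cayley z‖ ^ (γ * p) := by
  rw [norm_sectorMap, Real.rpow_mul (norm_nonneg _)]

theorem cos_mul_norm_le_re_sectorMap {s : ℝ} (h0 : 0 ≤ s) (h1 : s ≤ 1) {z : ℂ}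
    (hz : z ∈ unitDisk) : Real.cos (s * π / 2) * ‖cayley z‖ ^ s ≤ (sectorMap s z).re := by
  rw [sectorMap_eq, Complex.cpow_ofReal_re, mul_comm]
  refine mul_le_mul_of_nonneg_left ?_ (by positivity)
  have h : |arg (cayley z)| ≤ π / 2 := abs_arg_le_pi_div_two_iff.2 (cayley_re_pos hz).le
  rw [← Real.cos_abs (arg (cayley z) * s), abs_mul, abs_of_nonneg h0]
  have hpi := Real.pi_pos
  refine Real.cos_le_cos_of_nonneg_of_le_pi (by positivity) ?_ ?_
  · nlinarith
  · nlinarith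

theorem cos_pos_of_lt_one {s : ℝ} (h0 : 0 ≤ s) (h1 : s < 1) : 0 < Real.cos (s * π / 2) := by
  have hpi := Real.pi_pos
  refine Real.cos_pos_of_mem_Ioo ⟨?_, ?_⟩ <;> nlinarith

/-- The s-th power of the half-plane map takes values in a sector of half-opening sπ/2, where the
modulus is at most the real part over cos(sπ/2); the mean of the real part is its value 1 at the
center. -/
theorem integral_norm_cayley_rpow_le {s : ℝ} (h0 : 0 ≤ s) (h1 : s < 1) {r : ℝ}
    (hr0 : 0 ≤ r) (hr : r < 1) :
    ∫ t, ‖cayley (circleMap 0 r t)‖ ^ s ∂circleMeasure ≤ (Real.cos (s * π / 2))⁻¹ := by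
  have hcos := cos_pos_of_lt_one h0 h1
  have h := circleAverage_re_mul (differentiableOn_sectorMap s)
    (differentiableOn_const (1 : ℂ)) hr0 hr
  simp only [mul_one, sectorMap_zero, Complex.one_re] at h
  have c1 := differentiableOn_cayley.continuousOn.comp_circleMap hr0 hr
  have c2 := (differentiableOn_sectorMap s).continuousOn.comp_circleMap hr0 hr
  have := integral_mono
    (((c1.norm.rpow_const fun _ => Or.inr h0).integrable_circleMeasure).const_mul
      (Real.cos (s * π / 2)))
    (Complex.continuous_re.comp c2).integrable_circleMeasure
    fun t => cos_mul_norm_le_re_sectorMap h0 h1.le (circleMap_mem_unitBall hr0 hr t)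
  rw [integral_const_mul] at this
  simp only [Function.comp_apply] at this
  rw [h] at this
  rwa [inv_eq_one_div, le_div_iff₀' hcos]

theorem one_add_rpow_le {x p : ℝ} (hx : 0 ≤ x) (hp : 0 ≤ p) :
    (1 + x) ^ p ≤ 2 ^ p * (1 + x ^ p) := by
  have hxp := Real.rpow_nonneg hx p
  have h2 := Real.rpow_nonneg (show (0 : ℝ) ≤ 2 by norm_num) p
  rcases le_total x 1 with h | h
  · calc (1 + x) ^ p ≤ 2 ^ p := Real.rpow_le_rpow (by linarith) (by linarith) hp
      _ ≤ _ := by nlinarith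
  · calc (1 + x) ^ p ≤ (2 * x) ^ p := Real.rpow_le_rpow (by linarith) (by linarith) hp
      _ = 2 ^ p * x ^ p := Real.mul_rpow (by norm_num) hx
      _ ≤ _ := by nlinarith

theorem isHardyPair_sector {p γ : ℝ} (hp : 1 ≤ p) (h0 : 0 ≤ γ) (h1 : γ * p < 1) (α β δ : ℂ) :
    IsHardyPair p (fun z => α * (sectorMap γ z - δ)) (fun z => β * (sectorMap γ z - δ)) := by
  have d : ∀ a : ℂ, DifferentiableOn ℂ (fun z => a * (sectorMap γ z - δ)) unitDisk := fun a =>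
    ((differentiableOn_sectorMap γ).sub_const δ).const_mul a
  refine ⟨d α, d β, ⟨_, _, d α, d β, fun z _ => rfl⟩, ?_⟩
  set f := harmonicMap (fun z => α * (sectorMap γ z - δ)) (fun z => β * (sectorMap γ z - δ))
  set C := (‖α‖ + ‖β‖) * (1 + ‖δ‖)
  have hC : 0 ≤ C := by positivity
  have hpt : ∀ z, ‖f z‖ ^ p ≤ C ^ p * (2 ^ p * (1 + ‖cayley z‖ ^ (γ * p))) := by
    intro z
    have hle : ‖f z‖ ≤ C * (1 + ‖sectorMap γ z‖) := by
      calc ‖f z‖ ≤ ‖α * (sectorMap γ z - δ)‖ + ‖conj (β * (sectorMap γ z - δ))‖ := norm_add_le _ _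
        _ = (‖α‖ + ‖β‖) * ‖sectorMap γ z - δ‖ := by
          rw [RCLike.norm_conj, norm_mul, norm_mul]; ring
        _ ≤ (‖α‖ + ‖β‖) * (‖sectorMap γ z‖ + ‖δ‖) := by gcongr; exact norm_sub_le _ _
        _ ≤ C * (1 + ‖sectorMap γ z‖) := by
          rw [show C * (1 + ‖sectorMap γ z‖) =
            (‖α‖ + ‖β‖) * ((1 + ‖δ‖) * (1 + ‖sectorMap γ z‖)) by simp only [C]; ring]
          gcongr
          nlinarith [norm_nonneg δ, norm_nonneg (sectorMap γ z),
            mul_nonneg (norm_nonneg δ) (norm_nonneg (sectorMap γ z))]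
    calc ‖f z‖ ^ p ≤ (C * (1 + ‖sectorMap γ z‖)) ^ p :=
          Real.rpow_le_rpow (norm_nonneg _) hle (by linarith)
      _ = C ^ p * (1 + ‖sectorMap γ z‖) ^ p := Real.mul_rpow hC (by positivity)
      _ ≤ C ^ p * (2 ^ p * (1 + ‖sectorMap γ z‖ ^ p)) := by
          gcongr
          exact one_add_rpow_le (norm_nonneg _) (by linarith)
      _ = _ := by rw [norm_sectorMap_rpow]
  refine ⟨(C ^ p * (2 ^ p * (1 + (Real.cos (γ * p * π / 2))⁻¹))) ^ (1 / p), ?_⟩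
  rintro _ ⟨r, hr, rfl⟩
  rw [integralMean, circleAverage_eq_integral]
  refine Real.rpow_le_rpow (integral_nonneg fun t => by positivity) ?_ (by positivity)
  have hs0 : 0 ≤ γ * p := by positivity
  have cf : Continuous fun t => f (circleMap 0 r t) :=
    ((d α).continuousOn.comp_circleMap hr.1.le hr.2).add
    (Complex.continuous_conj.comp ((d β).continuousOn.comp_circleMap hr.1.le hr.2))
  have cc : Continuous fun t => ‖cayley (circleMap 0 r t)‖ ^ (γ * p) :=
    (differentiableOn_cayley.continuousOn.comp_circleMap hr.1.le hr.2).norm.rpow_const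
      fun _ => Or.inr hs0
  refine (integral_mono (cf.norm.rpow_const fun _ => Or.inr (by linarith)).integrable_circleMeasure
    (Continuous.integrable_circleMeasure ?_) fun t => hpt _).trans ?_
  · exact continuous_const.mul (continuous_const.mul (continuous_const.add cc))
  · rw [integral_const_mul, integral_const_mul, integral_add (integrable_const _)
      cc.integrable_circleMeasure, integral_const, probReal_univ, one_smul]
    gcongr
    exact integral_norm_cayley_rpow_le hs0 h1 hr.1.le hr.2

/-! ### Boundary values of the sector maps -/

theorem ae_circleMap_ne : ∀ᵐ t ∂circleMeasure, circleMap 0 1 t ≠ 1 ∧ circleMap 0 1 t ≠ -1 := by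
  rw [ae_circleMeasure_iff]
  filter_upwards [Measure.ae_ne volume π] with t hπ ht
  have hs : Real.sin t ≠ 0 := by
    intro h
    obtain ⟨n, hn⟩ := Real.sin_eq_zero_iff.1 h
    have hpi := Real.pi_pos
    rw [← hn] at ht
    have h1 : (0 : ℝ) < n := by
      by_contra hneg; push Not at hneg; nlinarith [ht.1]
    have h2 : (n : ℝ) < 2 := by
      by_contra hneg; push Not at hneg; nlinarith [ht.2]
    have h3 : n = 1 := by
      have : 0 < n := by exact_mod_cast h1
      have : n < 2 := by exact_mod_cast h2
      omega
    apply hπ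
    rw [← hn, h3]; simp
  have him : (circleMap 0 1 t).im = Real.sin t := by
    simp [circleMap, Complex.exp_ofReal_mul_I_im]
  constructor <;> intro h <;> rw [h] at him <;> simp at him <;> exact hs him.symm

theorem cayley_boundary {ζ : ℂ} (h : ‖ζ‖ = 1) (h1 : ζ ≠ 1) (h2 : ζ ≠ -1) :
    (cayley ζ).re = 0 ∧ cayley ζ ≠ 0 := by
  constructor
  · rw [cayley_re, h]; simp
  · exact div_ne_zero (sub_ne_zero.2 h1.symm) fun h => h2 (by linear_combination h)

theorem continuousAt_sectorMap {γ : ℝ} {ζ : ℂ} (h : ‖ζ‖ = 1) (h1 : ζ ≠ 1) (h2 : ζ ≠ -1) :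
    ContinuousAt (sectorMap γ) ζ := by
  obtain ⟨hre, hne⟩ := cayley_boundary h h1 h2
  have hc : ContinuousAt cayley ζ := by
    refine ContinuousAt.div (by fun_prop) (by fun_prop) fun h => h2 (by linear_combination h)
  refine hc.cpow continuousAt_const (Or.inr fun him => hne (Complex.ext hre him))

theorem ContinuousAt.tendsto_radial {F : ℂ → ℂ} {ζ : ℂ} (hF : ContinuousAt F ζ) :
    Tendsto (fun r : ℝ => F (r * ζ)) (𝓝[<] 1) (𝓝 (F ζ)) := by
  have h : Tendsto (fun r : ℝ => (r : ℂ) * ζ) (𝓝[<] 1) (𝓝 ζ) := by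
    have : Continuous fun r : ℝ => (r : ℂ) * ζ := by fun_prop
    have := this.tendsto 1
    simp only [Complex.ofReal_one, one_mul] at this
    exact this.mono_left nhdsWithin_le_nhds
  exact hF.tendsto.comp h

theorem ae_radialLimit_sector (γ : ℝ) : ∀ᵐ t ∂circleMeasure, ∀ α δ : ℂ,
    radialLimit (fun z => α * (sectorMap γ z - δ)) (circleMap 0 1 t) =
      α * (sectorMap γ (circleMap 0 1 t) - δ) := by
  filter_upwards [ae_circleMap_ne] with t ht α δ
  refine Tendsto.limUnder_eq ?_
  have := continuousAt_sectorMap (γ := γ) (by simp) ht.1 ht.2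
  exact ContinuousAt.tendsto_radial (F := fun z => α * (sectorMap γ z - δ)) (by fun_prop)

/-- At such boundary points the Cayley map has argument ±π/2, so the square of its γ-th power has
argument ±γπ. -/
theorem sectorMap_sq_re {γ : ℝ} {ζ : ℂ} (h : ‖ζ‖ = 1) (h1 : ζ ≠ 1) (h2 : ζ ≠ -1) :
    (sectorMap γ ζ * sectorMap γ ζ).re = ‖sectorMap γ ζ‖ ^ 2 * Real.cos (γ * π) := by
  obtain ⟨hre, hne⟩ := cayley_boundary h h1 h2
  have e : sectorMap γ ζ * sectorMap γ ζ = cayley ζ ^ ((2 * γ : ℝ) : ℂ) := by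
    rw [sectorMap_eq, ← Complex.cpow_add _ _ hne]
    congr 1; push_cast; ring
  rw [e, Complex.cpow_ofReal_re, norm_sectorMap, mul_comm (2 : ℝ), Real.rpow_mul (norm_nonneg _),
    Real.rpow_two]
  congr 1
  have him : (cayley ζ).im ≠ 0 := fun him => hne (Complex.ext hre him)
  rcases lt_or_gt_of_ne him with hi | hi
  · rw [arg_eq_neg_pi_div_two_iff.2 ⟨hre, hi⟩, ← Real.cos_neg]; congr 1; ring
  · rw [arg_eq_pi_div_two_iff.2 ⟨hre, hi⟩]; congr 1; ring

theorem norm_sector_pair_sq {γ : ℝ} {ζ : ℂ} (h : ‖ζ‖ = 1) (h1 : ζ ≠ 1) (h2 : ζ ≠ -1) {α β : ℂ}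
    {m : ℝ} (hm : α * β = m) :
    ‖α * sectorMap γ ζ + conj (β * sectorMap γ ζ)‖ ^ 2 =
      (‖α‖ ^ 2 + ‖β‖ ^ 2 + 2 * m * Real.cos (γ * π)) * ‖sectorMap γ ζ‖ ^ 2 := by
  rw [norm_add_conj_sq, norm_mul, norm_mul,
    show α * sectorMap γ ζ * (β * sectorMap γ ζ) = (m : ℂ) * (sectorMap γ ζ * sectorMap γ ζ) by
      rw [← hm]; ring, Complex.re_ofReal_mul, sectorMap_sq_re h h1 h2]
  ring

/-- Apply `re_le_integral_re` to g = h = `sectorMap (s / 2)`: on the circle Re(g²) is exactly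
cos(sπ/2)|g|². The resulting lower bound blows up as s tends to 1. -/
theorem le_integral_norm_cayley_rpow {s : ℝ} (h0 : 0 ≤ s) (h1 : s < 1) :
    Integrable (fun t => ‖cayley (circleMap 0 1 t)‖ ^ s) circleMeasure ∧
      (Real.cos (s * π / 2))⁻¹ ≤ ∫ t, ‖cayley (circleMap 0 1 t)‖ ^ s ∂circleMeasure := by
  have hH := isHardyPair_sector (p := 2) (γ := s / 2) (by norm_num) (by linarith) (by linarith) 1 1 0
  obtain ⟨hg, -⟩ := hH.hasBoundaryValues le_rfl
  have hG : (fun t => radialLimit (fun z => 1 * (sectorMap (s / 2) z - 0)) (circleMap 0 1 t))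
      =ᵐ[circleMeasure] fun t => sectorMap (s / 2) (circleMap 0 1 t) := by
    filter_upwards [ae_radialLimit_sector (s / 2)] with t ht
    have := ht 1 0
    simp only [one_mul, sub_zero] at this ⊢
    exact this
  have hre := hg.re_le_integral_re hg
  simp only [one_mul, sub_zero, sectorMap_zero, Complex.one_re] at hre hG
  have hint := hg.memLp.integrable_norm_pow (by simp)
  simp only [one_mul, sub_zero] at hint
  have hsq : ∀ ζ, ‖sectorMap (s / 2) ζ‖ ^ 2 = ‖cayley ζ‖ ^ s := fun ζ => by
    rw [← Real.rpow_two, norm_sectorMap_rpow]; congr 1; ring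
  refine ⟨hint.congr ?_, ?_⟩
  · filter_upwards [hG] with t ht
    rw [ht, hsq]
  · rw [inv_le_iff_one_le_mul₀' (cos_pos_of_lt_one h0 h1), ← integral_const_mul]
    refine hre.trans (le_of_eq (integral_congr_ae ?_))
    filter_upwards [hG, ae_circleMap_ne] with t ht h2
    rw [ht, sectorMap_sq_re (by simp) h2.1 h2.2, hsq, mul_comm]
    congr 2; ring

/-! ### Norms of the sector pairs -/

/-- The `L^p` norm on the circle, for real exponents. -/
noncomputable def circleNorm (p : ℝ) (F : ℝ → ℂ) : ℝ :=
  (∫ t, ‖F t‖ ^ p ∂circleMeasure) ^ (1 / p)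

theorem circleNorm_const {p : ℝ} (hp : 0 < p) (z : ℂ) : circleNorm p (fun _ => z) = ‖z‖ := by
  rw [circleNorm, integral_const, probReal_univ, one_smul, ← Real.rpow_mul (norm_nonneg _),
    mul_one_div_cancel hp.ne', Real.rpow_one]

theorem circleNorm_eq_norm_toLp {p : ℝ} (hp : 0 < p) {F : ℝ → ℂ}
    (hF : MemLp F (ENNReal.ofReal p) circleMeasure) : circleNorm p F = ‖hF.toLp F‖ := by
  rw [Lp.norm_toLp, hF.eLpNorm_eq_integral_rpow_norm (by simpa using hp) ENNReal.ofReal_ne_top,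
    ENNReal.toReal_ofReal hp.le, ENNReal.toReal_ofReal, circleNorm, one_div]
  exact Real.rpow_nonneg (integral_nonneg fun t => by positivity) _

theorem abs_circleNorm_sub_le {p : ℝ} (hp : 1 ≤ p) {F F' : ℝ → ℂ}
    (hF : MemLp F (ENNReal.ofReal p) circleMeasure)
    (hF' : MemLp F' (ENNReal.ofReal p) circleMeasure) :
    |circleNorm p (fun t => F t - F' t) - circleNorm p F| ≤ circleNorm p F' := by
  have hp0 : 0 < p := by linarith
  have : Fact (1 ≤ ENNReal.ofReal p) := ⟨by simpa using hp⟩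
  have h1 : circleNorm p (fun t => F t - F' t) = ‖hF.toLp F - hF'.toLp F'‖ := by
    rw [← MemLp.toLp_sub, ← circleNorm_eq_norm_toLp hp0 (hF.sub hF')]; rfl
  rw [h1, circleNorm_eq_norm_toLp hp0 hF, circleNorm_eq_norm_toLp hp0 hF']
  refine (abs_norm_sub_norm_le _ _).trans (le_of_eq ?_)
  rw [sub_sub_cancel_left, norm_neg]

theorem circleNorm_of_norm_eq {p : ℝ} (hp : 0 < p) {F F' : ℝ → ℂ} {a : ℝ} (ha : 0 ≤ a)
    (h : ∀ᵐ t ∂circleMeasure, ‖F t‖ = a * ‖F' t‖) : circleNorm p F = a * circleNorm p F' := by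
  have : ∫ t, ‖F t‖ ^ p ∂circleMeasure = a ^ p * ∫ t, ‖F' t‖ ^ p ∂circleMeasure := by
    rw [← integral_const_mul]
    refine integral_congr_ae ?_
    filter_upwards [h] with t ht
    rw [ht, Real.mul_rpow ha (norm_nonneg _)]
  rw [circleNorm, circleNorm, this, Real.mul_rpow (by positivity)
    (integral_nonneg fun t => by positivity), ← Real.rpow_mul ha, mul_one_div_cancel hp.ne',
    Real.rpow_one]

theorem measurable_sectorMap_circleMap (γ : ℝ) :
    Measurable fun t => sectorMap γ (circleMap 0 1 t) := by
  have h : Measurable (circleMap 0 1) := (continuous_circleMap 0 1).measurable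
  unfold sectorMap
  exact ((measurable_const.sub h).div (measurable_const.add h)).pow_const _

theorem memLp_ofReal_iff {p : ℝ} (hp : 0 < p) {F : ℝ → ℂ}
    (hF : AEStronglyMeasurable F circleMeasure) :
    MemLp F (ENNReal.ofReal p) circleMeasure ↔ Integrable (fun t => ‖F t‖ ^ p) circleMeasure := by
  have := integrable_norm_rpow_iff hF (p := ENNReal.ofReal p) (by simpa using hp)
    ENNReal.ofReal_ne_top
  rwa [ENNReal.toReal_ofReal hp.le, Iff.comm] at this

/-- The `L^p` norm of the boundary function of a sector map. -/
noncomputable def sectorNorm (p γ : ℝ) : ℝ :=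
  circleNorm p fun t => sectorMap γ (circleMap 0 1 t)

theorem memLp_sectorMap {p γ : ℝ} (hp : 0 < p) (h0 : 0 ≤ γ) (h1 : γ * p < 1) :
    MemLp (fun t => sectorMap γ (circleMap 0 1 t)) (ENNReal.ofReal p) circleMeasure := by
  rw [memLp_ofReal_iff hp (measurable_sectorMap_circleMap γ).aestronglyMeasurable]
  simp only [norm_sectorMap_rpow]
  exact (le_integral_norm_cayley_rpow (by positivity) h1).1

theorem le_sectorNorm {p γ : ℝ} (hp : 0 < p) (h0 : 0 ≤ γ) (h1 : γ * p < 1) :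
    ((Real.cos (γ * p * π / 2))⁻¹) ^ (1 / p) ≤ sectorNorm p γ := by
  rw [sectorNorm, circleNorm]
  simp only [norm_sectorMap_rpow]
  have h0' : 0 ≤ γ * p := by positivity
  exact Real.rpow_le_rpow (inv_nonneg.2 (cos_pos_of_lt_one h0' h1).le)
    (le_integral_norm_cayley_rpow h0' h1).2 (by positivity)

theorem sectorNorm_pos {p γ : ℝ} (hp : 0 < p) (h0 : 0 ≤ γ) (h1 : γ * p < 1) :
    0 < sectorNorm p γ :=
  (Real.rpow_pos_of_pos (inv_pos.2 (cos_pos_of_lt_one (by positivity) h1)) _).trans_le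
    (le_sectorNorm hp h0 h1)

theorem eventually_mem_Ioo_one_div {p : ℝ} (hp : 0 < p) :
    ∀ᶠ γ in 𝓝[<] (1 / p), γ ∈ Ioo 0 (1 / p) := Ioo_mem_nhdsLT (by positivity)

theorem mul_lt_one_of_lt_one_div {p γ : ℝ} (hp : 0 < p) (h : γ < 1 / p) : γ * p < 1 := by
  rwa [lt_div_iff₀ hp] at h

theorem tendsto_inv_cos_atTop : Tendsto (fun s : ℝ => (Real.cos (s * π / 2))⁻¹) (𝓝[<] 1) atTop := by
  refine tendsto_inv_nhdsGT_zero.comp (tendsto_nhdsWithin_iff.2 ⟨?_, ?_⟩)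
  · have hc : Continuous fun s : ℝ => Real.cos (s * π / 2) := by fun_prop
    have := hc.tendsto 1
    rw [one_mul, Real.cos_pi_div_two] at this
    exact this.mono_left nhdsWithin_le_nhds
  · filter_upwards [Ioo_mem_nhdsLT (show (0 : ℝ) < 1 by norm_num)] with s hs
    exact cos_pos_of_lt_one hs.1.le hs.2

theorem tendsto_sectorNorm {p : ℝ} (hp : 0 < p) :
    Tendsto (sectorNorm p) (𝓝[<] (1 / p)) atTop := by
  have h1 : Tendsto (fun γ : ℝ => γ * p) (𝓝[<] (1 / p)) (𝓝[<] 1) := by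
    refine tendsto_nhdsWithin_iff.2 ⟨?_, ?_⟩
    · have hc : Continuous fun γ : ℝ => γ * p := by fun_prop
      have := hc.tendsto (1 / p)
      rw [one_div_mul_cancel hp.ne'] at this
      exact this.mono_left nhdsWithin_le_nhds
    · filter_upwards [eventually_mem_Ioo_one_div hp] with γ hγ
        using mul_lt_one_of_lt_one_div hp hγ.2
  have h2 := (tendsto_rpow_atTop (show 0 < 1 / p by positivity)).comp
    (tendsto_inv_cos_atTop.comp h1)
  refine tendsto_atTop_mono' _ ?_ h2
  filter_upwards [eventually_mem_Ioo_one_div hp] with γ hγ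
    using le_sectorNorm hp hγ.1.le (mul_lt_one_of_lt_one_div hp hγ.2)

section SectorPair

variable {p γ : ℝ} {α β : ℂ} {m : ℝ}

theorem weightedNorm_sector (hp : 0 < p) {c : ℝ} (hc : 0 ≤ c) (δ : ℂ) :
    weightedNorm p c (fun z => α * (sectorMap γ z - δ)) (fun z => β * (sectorMap γ z - δ)) =
      √(‖α‖ ^ 2 + c * ‖β‖ ^ 2) *
        circleNorm p (fun t => sectorMap γ (circleMap 0 1 t) - δ) := by
  set k := √(‖α‖ ^ 2 + c * ‖β‖ ^ 2)
  have hk : 0 ≤ k := Real.sqrt_nonneg _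
  have hk2 : k ^ 2 = ‖α‖ ^ 2 + c * ‖β‖ ^ 2 := Real.sq_sqrt (by positivity)
  rw [weightedNorm_eq, ← circleNorm_of_norm_eq hp hk (F := fun t =>
    (k : ℂ) * (sectorMap γ (circleMap 0 1 t) - δ)), circleNorm]
  · congr 1
    refine integral_congr_ae ?_
    filter_upwards [ae_radialLimit_sector γ] with t ht
    rw [ht, ht, rpow_eq_sq_rpow (norm_nonneg _) p]
    congr 1
    rw [norm_mul, norm_mul, norm_mul, Complex.norm_real, Real.norm_of_nonneg hk]
    linear_combination (-‖sectorMap γ (circleMap 0 1 t) - δ‖ ^ 2) * hk2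
  · exact ae_of_all _ fun t => by rw [norm_mul, Complex.norm_real, Real.norm_of_nonneg hk]

theorem norm_sector_pair (hm : α * β = m) : ∀ᵐ t ∂circleMeasure,
    ‖α * sectorMap γ (circleMap 0 1 t) + conj (β * sectorMap γ (circleMap 0 1 t))‖ =
      √(‖α‖ ^ 2 + ‖β‖ ^ 2 + 2 * m * Real.cos (γ * π)) * ‖sectorMap γ (circleMap 0 1 t)‖ := by
  filter_upwards [ae_circleMap_ne] with t ht
  have h := norm_sector_pair_sq (γ := γ) (by simp) ht.1 ht.2 hm
  rw [← Real.sqrt_sq (norm_nonneg (_ + _)), h, Real.sqrt_mul' _ (by positivity),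
    Real.sqrt_sq (norm_nonneg _)]

theorem radialLimit_sector_pair (δ : ℂ) : ∀ᵐ t ∂circleMeasure,
    radialLimit (harmonicMap (fun z => α * (sectorMap γ z - δ)) (fun z => β * (sectorMap γ z - δ)))
      (circleMap 0 1 t) =
    (α * sectorMap γ (circleMap 0 1 t) + conj (β * sectorMap γ (circleMap 0 1 t))) -
      (α * δ + conj (β * δ)) := by
  filter_upwards [ae_circleMap_ne] with t ht
  refine Tendsto.limUnder_eq ?_
  have hc := continuousAt_sectorMap (γ := γ) (by simp) ht.1 ht.2
  have := ContinuousAt.tendsto_radial (F := harmonicMap (fun z => α * (sectorMap γ z - δ))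
    (fun z => β * (sectorMap γ z - δ))) (ζ := circleMap 0 1 t) (by unfold harmonicMap; fun_prop)
  convert this using 2
  simp only [harmonicMap, mul_sub, map_sub]; ring

theorem boundaryNorm_sector (δ : ℂ) :
    boundaryNorm p (harmonicMap (fun z => α * (sectorMap γ z - δ))
      (fun z => β * (sectorMap γ z - δ))) =
    circleNorm p fun t =>
      (α * sectorMap γ (circleMap 0 1 t) + conj (β * sectorMap γ (circleMap 0 1 t))) -
        (α * δ + conj (β * δ)) := by
  rw [boundaryNorm, circleAverage_eq_integral, circleNorm]
  congr 1
  refine integral_congr_ae ?_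
  filter_upwards [radialLimit_sector_pair δ] with t ht
  rw [boundaryDensity, ht]

theorem aestronglyMeasurable_sector_pair : AEStronglyMeasurable (fun t =>
    α * sectorMap γ (circleMap 0 1 t) + conj (β * sectorMap γ (circleMap 0 1 t)))
    circleMeasure := by
  have h := measurable_sectorMap_circleMap γ
  exact ((h.const_mul α).add
    (Complex.continuous_conj.measurable.comp (h.const_mul β))).aestronglyMeasurable

/-- Without δ the norm is an exact multiple of `sectorNorm p γ`; subtracting a constant moves it by
at most the modulus of that constant. -/
theorem abs_boundaryNorm_sub_le (hp : 1 ≤ p) (h0 : 0 ≤ γ) (h1 : γ * p < 1) (hm : α * β = m)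
    (δ : ℂ) :
    |boundaryNorm p (harmonicMap (fun z => α * (sectorMap γ z - δ))
      (fun z => β * (sectorMap γ z - δ))) -
      √(‖α‖ ^ 2 + ‖β‖ ^ 2 + 2 * m * Real.cos (γ * π)) * sectorNorm p γ| ≤
      ‖α * δ + conj (β * δ)‖ := by
  have hp0 : 0 < p := by linarith
  rw [boundaryNorm_sector, sectorNorm,
    ← circleNorm_of_norm_eq hp0 (Real.sqrt_nonneg _) (norm_sector_pair hm)]
  have hS := memLp_sectorMap hp0 h0 h1
  have hT : MemLp (fun t => α * sectorMap γ (circleMap 0 1 t) +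
      conj (β * sectorMap γ (circleMap 0 1 t))) (ENNReal.ofReal p) circleMeasure :=
    MemLp.of_le_mul hS aestronglyMeasurable_sector_pair
      ((norm_sector_pair hm).mono fun t ht => ht.le)
  have := abs_circleNorm_sub_le hp hT (memLp_const (α * δ + conj (β * δ)))
  rwa [circleNorm_const hp0] at this

/-- Bounded errors disappear after division by N, which tends to infinity. Both the original family
(δ = 0) and the normalized one (δ = 1) are covered in this way. -/
theorem tendsto_ratio_of_abs_sub_le {ι : Type*} {l : Filter ι} {N u v κ : ι → ℝ} {k κ₀ C D : ℝ}
    (hN : Tendsto N l atTop) (hκ : Tendsto κ l (𝓝 κ₀)) (hκ0 : κ₀ ≠ 0)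
    (hu : ∀ᶠ i in l, |u i - N i| ≤ C) (hv : ∀ᶠ i in l, |v i - κ i * N i| ≤ D) :
    (∀ᶠ i in l, v i ≠ 0) ∧ Tendsto (fun i => k * u i / v i) l (𝓝 (k / κ₀)) := by
  have hinv : Tendsto (fun i => (N i)⁻¹) l (𝓝 0) := tendsto_inv_atTop_zero.comp hN
  have hpos : ∀ᶠ i in l, 0 < N i := hN.eventually_gt_atTop 0
  have h1 : Tendsto (fun i => u i / N i) l (𝓝 1) := by
    have : Tendsto (fun i => (u i - N i) * (N i)⁻¹) l (𝓝 0) := by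
      refine squeeze_zero_norm' ?_ ((hinv.const_mul C).trans (by rw [mul_zero]))
      filter_upwards [hu, hpos] with i hi hp
      rw [norm_mul, Real.norm_eq_abs, Real.norm_of_nonneg (inv_nonneg.2 hp.le)]
      exact mul_le_mul_of_nonneg_right hi (inv_nonneg.2 hp.le)
    have h2 := this.add_const 1
    rw [zero_add] at h2
    refine h2.congr' ?_
    filter_upwards [hpos] with i hp
    field_simp; ring
  have h2 : Tendsto (fun i => v i / N i) l (𝓝 κ₀) := by
    have : Tendsto (fun i => (v i - κ i * N i) * (N i)⁻¹) l (𝓝 0) := by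
      refine squeeze_zero_norm' ?_ ((hinv.const_mul D).trans (by rw [mul_zero]))
      filter_upwards [hv, hpos] with i hi hp
      rw [norm_mul, Real.norm_eq_abs, Real.norm_of_nonneg (inv_nonneg.2 hp.le)]
      exact mul_le_mul_of_nonneg_right hi (inv_nonneg.2 hp.le)
    have h2 := this.add hκ
    rw [zero_add] at h2
    refine h2.congr' ?_
    filter_upwards [hpos] with i hp
    field_simp; ring
  refine ⟨?_, ?_⟩
  · filter_upwards [h2.eventually_ne hκ0] with i hi h0
    exact hi (by rw [h0, zero_div])
  · have h3 := (h1.const_mul k).div h2 hκ0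
    rw [mul_one] at h3
    refine h3.congr' ?_
    filter_upwards [hpos] with i hp
    simp only [Pi.div_apply]
    field_simp

theorem tendsto_sector_ratio (hp : 1 ≤ p) {c : ℝ} (hc : 0 ≤ c) (hm : α * β = m)
    (hκ : 0 < ‖α‖ ^ 2 + ‖β‖ ^ 2 + 2 * m * Real.cos (π / p)) (δ : ℂ) :
    (∀ᶠ γ in 𝓝[<] (1 / p), boundaryNorm p (harmonicMap (fun z => α * (sectorMap γ z - δ))
      (fun z => β * (sectorMap γ z - δ))) ≠ 0) ∧
    Tendsto (fun γ =>
      weightedNorm p c (fun z => α * (sectorMap γ z - δ)) (fun z => β * (sectorMap γ z - δ)) /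
        boundaryNorm p (harmonicMap (fun z => α * (sectorMap γ z - δ))
          (fun z => β * (sectorMap γ z - δ)))) (𝓝[<] (1 / p))
      (𝓝 (√(‖α‖ ^ 2 + c * ‖β‖ ^ 2) / √(‖α‖ ^ 2 + ‖β‖ ^ 2 + 2 * m * Real.cos (π / p)))) := by
  have hp0 : 0 < p := by linarith
  have hev := eventually_mem_Ioo_one_div hp0
  have hκt : Tendsto (fun γ : ℝ => √(‖α‖ ^ 2 + ‖β‖ ^ 2 + 2 * m * Real.cos (γ * π)))
      (𝓝[<] (1 / p)) (𝓝 (√(‖α‖ ^ 2 + ‖β‖ ^ 2 + 2 * m * Real.cos (π / p)))) := by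
    have hcont : Continuous fun γ : ℝ => √(‖α‖ ^ 2 + ‖β‖ ^ 2 + 2 * m * Real.cos (γ * π)) := by
      fun_prop
    have := hcont.tendsto (1 / p)
    rw [show 1 / p * π = π / p by ring] at this
    exact this.mono_left nhdsWithin_le_nhds
  simp only [weightedNorm_sector hp0 hc]
  refine tendsto_ratio_of_abs_sub_le (tendsto_sectorNorm hp0) hκt (Real.sqrt_pos.2 hκ).ne'
    (C := ‖δ‖) ?_ (hev.mono fun γ hγ => abs_boundaryNorm_sub_le hp hγ.1.le
      (mul_lt_one_of_lt_one_div hp0 hγ.2) hm δ)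
  filter_upwards [hev] with γ hγ
  have := abs_circleNorm_sub_le hp
    (memLp_sectorMap hp0 hγ.1.le (mul_lt_one_of_lt_one_div hp0 hγ.2)) (memLp_const δ)
  rwa [circleNorm_const hp0] at this

/-- Integrability would bound ∫|·|^s uniformly in s < 1, by |·|^s ≤ 1 + |·|, against the blow-up of
1/cos(sπ/2). -/
theorem not_integrable_norm_cayley :
    ¬ Integrable (fun t => ‖cayley (circleMap 0 1 t)‖) circleMeasure := by
  intro hi
  have hb : ∀ᶠ s : ℝ in 𝓝[<] 1, (Real.cos (s * π / 2))⁻¹ ≤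
      ∫ t, (1 + ‖cayley (circleMap 0 1 t)‖) ∂circleMeasure := by
    filter_upwards [Ioo_mem_nhdsLT (show (0 : ℝ) < 1 by norm_num)] with s hs
    obtain ⟨i, h⟩ := le_integral_norm_cayley_rpow hs.1.le hs.2
    refine h.trans (integral_mono i ((integrable_const _).add hi) fun t => ?_)
    rcases le_total ‖cayley (circleMap 0 1 t)‖ 1 with hle | hle
    · have := Real.rpow_le_one (norm_nonneg _) hle hs.1.le
      have := norm_nonneg (cayley (circleMap 0 1 t))
      beta_reduce; linarith
    · have := Real.rpow_le_rpow_of_exponent_le hle hs.2.le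
      rw [Real.rpow_one] at this
      beta_reduce; linarith
  obtain ⟨s, h1, h2⟩ := (hb.and (tendsto_inv_cos_atTop.eventually_gt_atTop _)).exists
  exact absurd h1 (not_le.2 h2)

theorem not_memHarmonicHardy_sector (hp : 2 ≤ p) (hm : α * β = m)
    (hκ : 0 < ‖α‖ ^ 2 + ‖β‖ ^ 2 + 2 * m * Real.cos (π / p)) (δ : ℂ) :
    ¬ MemHarmonicHardy p (harmonicMap (fun z => α * (sectorMap (1 / p) z - δ))
      (fun z => β * (sectorMap (1 / p) z - δ))) := by
  have hp0 : 0 < p := by linarith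
  intro hM
  have d : ∀ a : ℂ, DifferentiableOn ℂ (fun z => a * (sectorMap (1 / p) z - δ)) unitDisk :=
    fun a => ((differentiableOn_sectorMap _).sub_const δ).const_mul a
  have H : IsHardyPair p (fun z => α * (sectorMap (1 / p) z - δ))
    (fun z => β * (sectorMap (1 / p) z - δ)) := ⟨d α, d β, hM⟩
  have hi := (circleIntegrable_iff_integrable _ _).1 (H.circleIntegrable hp one_pos).2
  set T := fun t => α * sectorMap (1 / p) (circleMap 0 1 t) +
    conj (β * sectorMap (1 / p) (circleMap 0 1 t))
  have hTm : AEStronglyMeasurable T circleMeasure := aestronglyMeasurable_sector_pair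
  set d₀ := α * δ + conj (β * δ)
  have hi2 : Integrable (fun t => ‖T t - d₀‖ ^ p) circleMeasure := by
    refine hi.congr ?_
    filter_upwards [radialLimit_sector_pair δ] with t ht
    rw [boundaryDensity, ht]
  have hT : MemLp T (ENNReal.ofReal p) circleMeasure := by
    have h1 := (memLp_ofReal_iff hp0 (F := fun t => T t - d₀)
      (hTm.sub aestronglyMeasurable_const)).2 hi2
    have h2 := h1.add (memLp_const d₀)
    refine (memLp_congr_ae (ae_of_all _ fun t => ?_)).1 h2
    simp
  set κ := √(‖α‖ ^ 2 + ‖β‖ ^ 2 + 2 * m * Real.cos (1 / p * π))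
  have hκ0 : 0 < κ := by
    refine Real.sqrt_pos.2 ?_
    rwa [show 1 / p * π = π / p by ring]
  -- At γ = 1/p the p-th power of the boundary modulus is κ^p times |cayley|, which is not
  -- integrable.
  have hi3 := (((memLp_ofReal_iff hp0 hTm).1 hT).const_mul ((κ ^ p)⁻¹))
  refine not_integrable_norm_cayley (hi3.congr ?_)
  filter_upwards [norm_sector_pair (γ := 1 / p) hm] with t ht
  have hκp : 0 < κ ^ p := Real.rpow_pos_of_pos hκ0 p
  simp only [T]
  rw [ht, Real.mul_rpow hκ0.le (norm_nonneg _), norm_sectorMap_rpow, one_div_mul_cancel hp0.ne',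
    Real.rpow_one, inv_mul_cancel_left₀ hκp.ne']

end SectorPair

/-! ### Mapping properties of the sector pairs -/

/-- On the half-plane |arg| ≤ π/2, so γ log stays in the strip |Im| < π, where exp is injective. -/
theorem injOn_sectorMap {γ : ℝ} (h0 : 0 < γ) (h1 : γ ≤ 1) : InjOn (sectorMap γ) unitDisk := by
  intro z hz w hw h
  have hγ : (γ : ℂ) ≠ 0 := by exact_mod_cast h0.ne'
  have hz0 : cayley z ≠ 0 := fun h => by have := cayley_re_pos hz; simp [h] at this
  have hw0 : cayley w ≠ 0 := fun h => by have := cayley_re_pos hw; simp [h] at this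
  have him : ∀ u ∈ unitDisk, |(Complex.log (cayley u) * γ).im| < π := fun u hu => by
    rw [mul_comm, Complex.im_ofReal_mul, Complex.log_im, abs_mul, abs_of_pos h0]
    have h2 := abs_arg_le_pi_div_two_iff.2 (cayley_re_pos hu).le
    have hpi := Real.pi_pos
    nlinarith [abs_nonneg (arg (cayley u))]
  rw [sectorMap_eq, sectorMap_eq, Complex.cpow_def_of_ne_zero hz0,
    Complex.cpow_def_of_ne_zero hw0] at h
  have h2 := Complex.exp_inj_of_neg_pi_lt_of_le_pi (abs_lt.1 (him z hz)).1
    (abs_lt.1 (him z hz)).2.le (abs_lt.1 (him w hw)).1 (abs_lt.1 (him w hw)).2.le h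
  have h3 : cayley z = cayley w := by
    rw [← Complex.exp_log hz0, mul_right_cancel₀ hγ h2, Complex.exp_log hw0]
  rw [cayley, cayley, div_eq_div_iff (one_add_ne_zero hz) (one_add_ne_zero hw)] at h3
  linear_combination (-1 / 2 : ℂ) * h3

/-- The real-linear map `w ↦ α w + conj (β w)`. -/
noncomputable def affineStretch (α β : ℂ) : ℂ →L[ℝ] ℂ :=
  (ContinuousLinearMap.mul ℝ ℂ α) + (Complex.conjCLE : ℂ →L[ℝ] ℂ).comp (ContinuousLinearMap.mul ℝ ℂ β)

theorem affineStretch_apply (α β w : ℂ) : affineStretch α β w = α * w + conj (β * w) := rfl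

theorem injective_affineStretch {α β : ℂ} (h : ‖α‖ ≠ ‖β‖) :
    Function.Injective (affineStretch α β) := by
  rw [injective_iff_map_eq_zero]
  intro w hw
  rw [affineStretch_apply] at hw
  have h1 : ‖α * w‖ = ‖β * w‖ := by
    rw [eq_neg_of_add_eq_zero_left hw, norm_neg, RCLike.norm_conj]
  rw [norm_mul, norm_mul] at h1
  by_contra hne
  exact h (mul_right_cancel₀ (norm_ne_zero_iff.2 hne) h1)

theorem isOpenMap_affineStretch {α β : ℂ} (h : ‖α‖ ≠ ‖β‖) : IsOpenMap (affineStretch α β) := by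
  refine (affineStretch α β).isOpenMap ?_
  exact LinearMap.injective_iff_surjective.1 (injective_affineStretch h)

theorem isOpenMap_domRestrict_of_injOn {g : ℂ → ℂ} (hg : DifferentiableOn ℂ g unitDisk)
    (hinj : InjOn g unitDisk) : IsOpenMap (unitDisk.domRestrict g) := by
  have hop : IsOpen unitDisk := Metric.isOpen_ball
  rcases (hg.analyticOnNhd hop).is_constant_or_isOpen
    (convex_ball (0 : ℂ) 1).isPreconnected with ⟨w, hw⟩ | h
  · exfalso
    have h0 : (0 : ℂ) ∈ unitDisk := by simp [unitDisk]
    have h1 : (1 / 2 : ℂ) ∈ unitDisk := by simp [unitDisk]; norm_num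
    have := hinj h0 h1 ((hw 0 h0).trans (hw _ h1).symm)
    norm_num at this
  · intro s hs
    have e : unitDisk.domRestrict g '' s = g '' (Subtype.val '' s) := by
      rw [image_image]; rfl
    rw [e]
    exact h _ (by rintro _ ⟨x, -, rfl⟩; exact x.2) (hop.isOpenMap_subtype_val s hs)

theorem hasFDerivAt_pair {g h : ℂ → ℂ} {z g' h' : ℂ} (hg : HasDerivAt g g' z)
    (hh : HasDerivAt h h' z) : HasFDerivAt (harmonicMap g h) (affineStretch g' h') z := by
  have h1 := hg.complexToReal_fderiv
  have h2 := (Complex.conjCLE : ℂ →L[ℝ] ℂ).hasFDerivAt.comp z hh.complexToReal_fderiv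
  refine (h1.add h2).congr_fderiv ?_
  ext v
  · simp [affineStretch]

theorem dz_harmonicMap {g h : ℂ → ℂ} {z g' h' : ℂ} (hg : HasDerivAt g g' z)
    (hh : HasDerivAt h h' z) : dz (harmonicMap g h) z = g' := by
  rw [dz, (hasFDerivAt_pair hg hh).fderiv, affineStretch_apply, affineStretch_apply, map_mul,
    map_mul, Complex.conj_I, map_one]
  linear_combination (-g' / 2 + conj h' / 2) * Complex.I_sq

theorem dzbar_harmonicMap {g h : ℂ → ℂ} {z g' h' : ℂ} (hg : HasDerivAt g g' z)
    (hh : HasDerivAt h h' z) : dzbar (harmonicMap g h) z = conj h' := by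
  rw [dzbar, (hasFDerivAt_pair hg hh).fderiv, affineStretch_apply, affineStretch_apply, map_mul,
    map_mul, Complex.conj_I, map_one]
  linear_combination (g' / 2 - conj h' / 2) * Complex.I_sq

theorem harmonicOnNhd_harmonicMap {g h : ℂ → ℂ} (hg : DifferentiableOn ℂ g unitDisk)
    (hh : DifferentiableOn ℂ h unitDisk) :
    InnerProductSpace.HarmonicOnNhd (harmonicMap g h) unitDisk := fun z hz =>
  (hg.analyticOnNhd Metric.isOpen_ball z hz).harmonicAt.add
    (hh.analyticOnNhd Metric.isOpen_ball z hz).harmonicAt_conj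

/-- The map is an invertible real-linear map after a univalent holomorphic one, so it is an open
embedding, and the ratio of its two complex derivatives has the constant modulus |β|/|α| or its
inverse. -/
theorem isQuasiconformalHarmonic_pair {g : ℂ → ℂ} (hg : DifferentiableOn ℂ g unitDisk)
    (hinj : InjOn g unitDisk) {α β : ℂ} {k : ℝ} (hk0 : 0 ≤ k) (hk1 : k < 1) (hne : ‖α‖ ≠ ‖β‖)
    (hk : ‖β‖ ≤ k * ‖α‖ ∨ ‖α‖ ≤ k * ‖β‖) :
    IsQuasiconformalHarmonic k (harmonicMap (fun z => α * g z) (fun z => β * g z)) where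
  nonneg := hk0
  lt_one := hk1
  harmonic := harmonicOnNhd_harmonicMap (hg.const_mul α) (hg.const_mul β)
  homeo := by
    have e : unitDisk.domRestrict (harmonicMap (fun z => α * g z) (fun z => β * g z)) =
        affineStretch α β ∘ unitDisk.domRestrict g := rfl
    rw [e]
    refine IsOpenEmbedding.of_continuous_injective_isOpenMap ?_ ?_ ?_
    · exact (affineStretch α β).continuous.comp hg.continuousOn.domRestrict
    · exact (injective_affineStretch hne).comp (injOn_iff_injective.1 hinj)
    · exact (isOpenMap_affineStretch hne).comp (isOpenMap_domRestrict_of_injOn hg hinj)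
  dilatation := by
    have hd : ∀ z ∈ unitDisk, HasDerivAt g (deriv g z) z := fun z hz =>
      (hg.differentiableAt (Metric.isOpen_ball.mem_nhds hz)).hasDerivAt
    refine hk.imp (fun h z hz => ?_) (fun h z hz => ?_) <;>
    · rw [dz_harmonicMap ((hd z hz).const_mul α) ((hd z hz).const_mul β),
        dzbar_harmonicMap ((hd z hz).const_mul α) ((hd z hz).const_mul β), RCLike.norm_conj,
        norm_mul, norm_mul, ← mul_assoc]
      exact mul_le_mul_of_nonneg_right h (norm_nonneg _)

theorem isQuasiconformalHarmonic_sector {γ : ℝ} (h0 : 0 < γ) (h1 : γ ≤ 1) {α β : ℂ} {k : ℝ}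
    (hk0 : 0 ≤ k) (hk1 : k < 1) (hne : ‖α‖ ≠ ‖β‖) (hk : ‖β‖ ≤ k * ‖α‖ ∨ ‖α‖ ≤ k * ‖β‖) (δ : ℂ) :
    IsQuasiconformalHarmonic k (harmonicMap (fun z => α * (sectorMap γ z - δ))
      (fun z => β * (sectorMap γ z - δ))) :=
  isQuasiconformalHarmonic_pair ((differentiableOn_sectorMap γ).sub_const δ)
    (fun _ hz _ hw h => injOn_sectorMap h0 h1 hz hw (sub_left_injective h)) hk0 hk1 hne hk

theorem tendstoLocallyUniformlyOn_of_continuousAt {F : ℝ → ℂ → ℂ} {s₀ : ℝ} {U : Set ℂ}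
    (h : ∀ z ∈ U, ContinuousAt (fun x : ℝ × ℂ => F x.1 x.2) (s₀, z)) :
    TendstoLocallyUniformlyOn F (F s₀) (𝓝 s₀) U := by
  rw [Metric.tendstoLocallyUniformlyOn_iff]
  intro ε hε z hz
  have h1 := Metric.continuousAt_iff'.1 (h z hz) (ε / 2) (half_pos hε)
  rw [nhds_prod_eq, Filter.eventually_prod_iff] at h1
  obtain ⟨P, hP, Q, hQ, hPQ⟩ := h1
  refine ⟨{w | Q w}, mem_nhdsWithin_of_mem_nhds hQ, hP.mono fun s hs w hw => ?_⟩
  have a := hPQ hs hw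
  have b := hPQ hP.self_of_nhds hw
  rw [dist_comm] at b
  calc dist (F s₀ w) (F s w) ≤ dist (F s₀ w) (F s₀ z) + dist (F s₀ z) (F s w) := dist_triangle _ _ _
    _ < ε := by rw [dist_comm] at a b; linarith

theorem tendstoLocallyUniformlyOn_sector (γ₀ : ℝ) (α β δ : ℂ) :
    TendstoLocallyUniformlyOn (fun γ => harmonicMap (fun z => α * (sectorMap γ z - δ))
      (fun z => β * (sectorMap γ z - δ)))
      (harmonicMap (fun z => α * (sectorMap γ₀ z - δ)) (fun z => β * (sectorMap γ₀ z - δ)))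
      (𝓝 γ₀) unitDisk := by
  refine tendstoLocallyUniformlyOn_of_continuousAt fun z hz => ?_
  have hc : ContinuousAt (fun x : ℝ × ℂ => sectorMap x.1 x.2) (γ₀, z) := by
    unfold sectorMap
    refine ContinuousAt.cpow (ContinuousAt.div (by fun_prop) (by fun_prop) (one_add_ne_zero hz))
      (Complex.continuous_ofReal.comp continuous_fst).continuousAt (Or.inl (cayley_re_pos hz))
  simp only [harmonicMap]
  exact (continuousAt_const.mul (hc.sub continuousAt_const)).add
    (Complex.continuous_conj.continuousAt.comp
      (continuousAt_const.mul (hc.sub continuousAt_const)))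

/-! ### Minimizing sequences -/

theorem cos_pi_div_pos {p : ℝ} (hp : 2 < p) : 0 < Real.cos (π / p) ∧ Real.cos (π / p) < 1 := by
  have hpi := Real.pi_pos
  have h1 : π / p < π / 2 := div_lt_div_of_pos_left hpi (by norm_num) hp
  have h0 : 0 < π / p := by positivity
  refine ⟨Real.cos_pos_of_mem_Ioo ⟨by linarith, h1⟩, ?_⟩
  rw [← Real.cos_zero]
  exact Real.cos_lt_cos_of_nonneg_of_le_pi le_rfl (by linarith) h0

theorem rieszConst_eq_of_sq {p c x y : ℝ} (hc : 0 ≤ c) (hx : 0 ≤ x)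
    (h : x / y = rieszConst p c ^ 2) : √x / √y = rieszConst p c := by
  rw [← Real.sqrt_div hx, h, Real.sqrt_sq (rieszConst_nonneg p c hc)]

theorem extremal_pair_pos {r m : ℝ} (hr : 0 < r) (hm1 : m < 1) :
    0 < 1 + r ^ 2 + 2 * -r * m := by nlinarith [sq_nonneg (1 - r)]

/-- By the relations for R the denominator equals 1/λ + R⁻²(c/λ), that is, the numerator divided by
λ. -/
theorem extremal_pair_ratio {p c : ℝ} (hp : 2 < p) (hc : 0 < c) :
    (1 + c * (extremalRadius p c)⁻¹ ^ 2) /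
      (1 + (extremalRadius p c)⁻¹ ^ 2 + 2 * -(extremalRadius p c)⁻¹ * Real.cos (π / p)) =
      rieszConst p c ^ 2 := by
  obtain ⟨hR, ha, -, h1, h2⟩ := extremal_relations hp hc
  have hpos := extremal_pair_pos (inv_pos.2 hR) (cos_pi_div_pos hp).2
  rw [div_eq_iff hpos.ne']
  set R := extremalRadius p c
  set S := rieszConst p c ^ 2
  have hS : S ≠ 0 := by linarith
  have e : 1 + R⁻¹ ^ 2 + 2 * -R⁻¹ * Real.cos (π / p) = 1 / S + R⁻¹ ^ 2 * (c / S) := by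
    rw [h1, h2]; field_simp; ring
  rw [e]; field_simp

/-- This separates the quasiconformal case from the degenerate one: the coefficients 1 and −1/R have
equal moduli exactly when R = 1. -/
theorem extremalRadius_eq_one_iff {p c : ℝ} (hp : 2 < p) (hc : 0 < c) :
    extremalRadius p c = 1 ↔ c = 1 := by
  obtain ⟨hR, ha, -, h1, h2⟩ := extremal_relations hp hc
  have hcos := cos_pi_div_pos hp
  set R := extremalRadius p c
  set S := rieszConst p c ^ 2
  have hS : 0 < S := by linarith
  constructor
  · intro h
    rw [h, div_one] at h1
    rw [h, one_mul, ← h1, div_left_inj' hS.ne'] at h2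
    exact h2
  · intro h
    rw [h, h1] at h2
    have h3 : Real.cos (π / p) / R = R * Real.cos (π / p) := by linarith
    rw [div_eq_iff hR.ne'] at h3
    have h4 : Real.cos (π / p) * (R ^ 2 - 1) = 0 := by linear_combination -h3
    have h5 := (mul_eq_zero.1 h4).resolve_left hcos.1.ne'
    nlinarith

theorem min_inv_lt_one {R : ℝ} (hne : R ≠ 1) : min R R⁻¹ < 1 := by
  rcases lt_or_gt_of_ne hne with h | h
  · exact (min_le_left _ _).trans_lt h
  · exact (min_le_right _ _).trans_lt (inv_lt_one_of_one_lt₀ h)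

theorem extremal_dilatation {R : ℝ} (hR : 0 < R) :
    R⁻¹ ≤ min R R⁻¹ * 1 ∨ 1 ≤ min R R⁻¹ * R⁻¹ := by
  rcases le_total R 1 with h | h
  · right
    rw [min_eq_left (h.trans ((one_le_inv₀ hR).2 h)), mul_inv_cancel₀ hR.ne']
  · left
    rw [mul_one, min_eq_right ((inv_le_one_of_one_le₀ h).trans h)]

theorem norm_ofReal_neg_inv {R : ℝ} (hR : 0 < R) : ‖((-R⁻¹ : ℝ) : ℂ)‖ = R⁻¹ := by
  rw [Complex.norm_real, norm_neg, Real.norm_of_nonneg (inv_nonneg.2 hR.le)]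

/-- Coefficients of an extremal pair of distinct moduli. -/
theorem exists_extremal_coefficients {p c : ℝ} (hp : 2 ≤ p) (hc : 0 < c) (hc1 : c ≠ 1) :
    ∃ (α β : ℂ) (m k : ℝ), α * β = m ∧
      0 < ‖α‖ ^ 2 + ‖β‖ ^ 2 + 2 * m * Real.cos (π / p) ∧
      √(‖α‖ ^ 2 + c * ‖β‖ ^ 2) / √(‖α‖ ^ 2 + ‖β‖ ^ 2 + 2 * m * Real.cos (π / p)) =
        rieszConst p c ∧
      0 ≤ k ∧ k < 1 ∧ ‖α‖ ≠ ‖β‖ ∧ (‖β‖ ≤ k * ‖α‖ ∨ ‖α‖ ≤ k * ‖β‖) := by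
  rcases hp.eq_or_lt with rfl | hp
  -- For p = 2 the cosine vanishes and the larger of 1 and c decides: a holomorphic or an
  -- antiholomorphic map is extremal, with dilatation bound k = 0.
  · have hsq := rieszConst_sq_two hc
    rcases lt_or_gt_of_ne hc1 with h | h
    · refine ⟨1, 0, 0, 0, by simp, by simp, ?_, le_rfl, one_pos, by simp, by simp⟩
      refine rieszConst_eq_of_sq hc.le (by positivity) ?_
      rw [hsq, max_eq_left h.le]; simp
    · refine ⟨0, 1, 0, 0, by simp, by simp, ?_, le_rfl, one_pos, by simp, by simp⟩
      refine rieszConst_eq_of_sq hc.le (by positivity) ?_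
      rw [hsq, max_eq_right h.le]; simp
  · have hR := (extremal_relations hp hc).1
    have hne := fun h => hc1 ((extremalRadius_eq_one_iff hp hc).1 h)
    refine ⟨1, ((-(extremalRadius p c)⁻¹ : ℝ) : ℂ), -(extremalRadius p c)⁻¹,
      min (extremalRadius p c) (extremalRadius p c)⁻¹, one_mul _, ?_, ?_, ?_,
      min_inv_lt_one hne, ?_, ?_⟩ <;>
      try simp only [norm_ofReal_neg_inv hR, norm_one, one_pow]
    · exact extremal_pair_pos (inv_pos.2 hR) (cos_pi_div_pos hp).2
    · exact rieszConst_eq_of_sq hc.le (by positivity) (extremal_pair_ratio hp hc)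
    · exact le_min hR.le (inv_nonneg.2 hR.le)
    · intro h
      exact hne (inv_eq_one.1 h.symm)
    · exact extremal_dilatation hR

theorem rieszConst_one_sq {p : ℝ} (hp : 2 ≤ p) :
    (1 + 1 * 1 ^ 2) / (1 ^ 2 + 1 ^ 2 + 2 * (-1 : ℝ) * Real.cos (π / p)) = rieszConst p 1 ^ 2 := by
  rcases hp.eq_or_lt with rfl | hp
  · rw [rieszConst_sq_two one_pos, Real.cos_pi_div_two]; norm_num
  · have := extremal_pair_ratio hp one_pos
    rw [(extremalRadius_eq_one_iff hp one_pos).2 rfl] at this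
    simpa using this

/-- Equal coefficients `I` keep the product at −1 and make the map w + w̄ real-valued, which the
pair 1, −1 does not. -/
theorem extremal_coefficients_one {p : ℝ} (hp : 2 ≤ p) :
    I * I = ((-1 : ℝ) : ℂ) ∧
      0 < ‖I‖ ^ 2 + ‖I‖ ^ 2 + 2 * (-1 : ℝ) * Real.cos (π / p) ∧
      √(‖I‖ ^ 2 + 1 * ‖I‖ ^ 2) / √(‖I‖ ^ 2 + ‖I‖ ^ 2 + 2 * (-1 : ℝ) * Real.cos (π / p)) =
        rieszConst p 1 := by
  have hcos : Real.cos (π / p) < 1 := by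
    rcases hp.eq_or_lt with rfl | hp
    · rw [Real.cos_pi_div_two]; norm_num
    · exact (cos_pi_div_pos hp).2
  refine ⟨by simp, ?_, rieszConst_eq_of_sq zero_le_one (by positivity) ?_⟩
  · rw [Complex.norm_I]; linarith
  · rw [Complex.norm_I, ← rieszConst_one_sq hp, one_pow]

theorem isAdmissible_sector {p γ : ℝ} (hp : 1 ≤ p) (h0 : 0 ≤ γ) (h1 : γ * p < 1) (α β : ℂ) :
    IsAdmissible p (fun z => α * (sectorMap γ z - 1)) (fun z => β * (sectorMap γ z - 1)) :=
  ⟨isHardyPair_sector hp h0 h1 α β 1, by simp [sectorMap_zero]⟩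

theorem exists_minimizing_exponents {p c : ℝ} (hp : 2 ≤ p) (hc : 0 < c) {α β : ℂ} {m : ℝ}
    (hm : α * β = m) (hκ : 0 < ‖α‖ ^ 2 + ‖β‖ ^ 2 + 2 * m * Real.cos (π / p))
    (hratio : √(‖α‖ ^ 2 + c * ‖β‖ ^ 2) / √(‖α‖ ^ 2 + ‖β‖ ^ 2 + 2 * m * Real.cos (π / p)) =
        rieszConst p c) :
    ∃ γ : ℕ → ℝ, Tendsto γ atTop (𝓝 (1 / p)) ∧ (∀ n, γ n ∈ Ioo 0 (1 / p)) ∧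
      (∀ n, boundaryNorm p (harmonicMap (fun z => α * (sectorMap (γ n) z - 1))
        (fun z => β * (sectorMap (γ n) z - 1))) ≠ 0) ∧
      Tendsto (fun n => weightedNorm p c (fun z => α * (sectorMap (γ n) z - 1))
        (fun z => β * (sectorMap (γ n) z - 1)) /
        boundaryNorm p (harmonicMap (fun z => α * (sectorMap (γ n) z - 1))
          (fun z => β * (sectorMap (γ n) z - 1)))) atTop (𝓝 (rieszConst p c)) := by
  obtain ⟨h1, h2⟩ := tendsto_sector_ratio (by linarith) hc.le hm hκ 1
  -- A sequence of exponents along which the quotient has a nonzero denominator at every index, not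
  -- merely eventually.
  obtain ⟨γ, hγ, hγ2⟩ := exists_seq_forall_of_frequently
    ((eventually_mem_Ioo_one_div (by linarith)).and h1).frequently
  rw [hratio] at h2
  exact ⟨γ, hγ.mono_right nhdsWithin_le_nhds, fun n => (hγ2 n).1, fun n => (hγ2 n).2, h2.comp hγ⟩

theorem rieszConst_le_of_forall {p c : ℝ} (hp : 2 ≤ p) (hc : 0 < c) {C : ℝ}
    (hC : ∀ g h : ℂ → ℂ, IsAdmissible p g h →
      weightedNorm p c g h ≤ C * boundaryNorm p (harmonicMap g h)) : rieszConst p c ≤ C := by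
  have key : ∀ (α β : ℂ) (m : ℝ), α * β = m →
      0 < ‖α‖ ^ 2 + ‖β‖ ^ 2 + 2 * m * Real.cos (π / p) →
      √(‖α‖ ^ 2 + c * ‖β‖ ^ 2) / √(‖α‖ ^ 2 + ‖β‖ ^ 2 + 2 * m * Real.cos (π / p)) =
        rieszConst p c → rieszConst p c ≤ C := by
    intro α β m hm hκ hr
    obtain ⟨γ, -, hγ, hne, ht⟩ := exists_minimizing_exponents hp hc hm hκ hr
    refine le_of_tendsto' ht fun n => ?_
    have hpos : 0 < boundaryNorm p (harmonicMap (fun z => α * (sectorMap (γ n) z - 1))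
        (fun z => β * (sectorMap (γ n) z - 1))) := by
      refine lt_of_le_of_ne (Real.rpow_nonneg ?_ _) (hne n).symm
      rw [circleAverage_eq_integral]
      exact integral_nonneg fun t => Real.rpow_nonneg (norm_nonneg _) _
    rw [div_le_iff₀ hpos]
    exact hC _ _ (isAdmissible_sector (by linarith) (hγ n).1.le
      (mul_lt_one_of_lt_one_div (by linarith) (hγ n).2) α β)
  by_cases hc1 : c = 1
  · subst hc1
    obtain ⟨hm, hκ, hr⟩ := extremal_coefficients_one hp
    exact key _ _ _ hm hκ hr
  · obtain ⟨α, β, m, k, hm, hκ, hr, -⟩ := exists_extremal_coefficients hp hc hc1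
    exact key α β m hm hκ hr

theorem theorem1 (p c : ℝ) (hp : 2 ≤ p) (hc : 0 < c) :
    -- boundary values exist almost everywhere and both integrals converge
    (∀ g h : ℂ → ℂ, IsHardyPair p g h →
      (∀ᵐ t : ℝ, HasRadialLimit g (circleMap 0 1 t) ∧ HasRadialLimit h (circleMap 0 1 t)) ∧
      CircleIntegrable (weightedDensity p c g h) 0 1 ∧
      CircleIntegrable (boundaryDensity p (harmonicMap g h)) 0 1) ∧
    -- the inequality
    (∀ g h : ℂ → ℂ, IsAdmissible p g h →
      weightedNorm p c g h ≤ rieszConst p c * boundaryNorm p (harmonicMap g h)) ∧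
    -- the constant is the best one
    (∀ C : ℝ, (∀ g h : ℂ → ℂ, IsAdmissible p g h →
        weightedNorm p c g h ≤ C * boundaryNorm p (harmonicMap g h)) → rieszConst p c ≤ C) ∧
    -- equality is never attained, except for the zero map
    (2 < p → ∀ g h : ℂ → ℂ, IsAdmissible p g h → (∃ z ∈ unitDisk, harmonicMap g h z ≠ 0) →
      weightedNorm p c g h ≠ rieszConst p c * boundaryNorm p (harmonicMap g h)) ∧
    -- a minimizing sequence converging to a quasiconformal harmonic map outside `h^p`
    (c ≠ 1 → ∃ (g h : ℕ → ℂ → ℂ) (G H : ℂ → ℂ) (k : ℝ),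
      (∀ n, IsAdmissible p (g n) (h n) ∧ boundaryNorm p (harmonicMap (g n) (h n)) ≠ 0 ∧
        IsQuasiconformalHarmonic k (harmonicMap (g n) (h n))) ∧
      Tendsto (fun n => weightedNorm p c (g n) (h n) / boundaryNorm p (harmonicMap (g n) (h n)))
        atTop (𝓝 (rieszConst p c)) ∧
      DifferentiableOn ℂ G unitDisk ∧ DifferentiableOn ℂ H unitDisk ∧
      TendstoLocallyUniformlyOn (fun n => harmonicMap (g n) (h n)) (harmonicMap G H)
        atTop unitDisk ∧
      IsQuasiconformalHarmonic k (harmonicMap G H) ∧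
      ¬ MemHarmonicHardy p (harmonicMap G H)) ∧
    -- for `c = 1`, a minimizing sequence converging to a real harmonic function outside `h^p`
    (c = 1 → ∃ (g h : ℕ → ℂ → ℂ) (G H : ℂ → ℂ),
      (∀ n, IsAdmissible p (g n) (h n) ∧ boundaryNorm p (harmonicMap (g n) (h n)) ≠ 0 ∧
        ∀ z ∈ unitDisk, (harmonicMap (g n) (h n) z).im = 0) ∧
      Tendsto (fun n => weightedNorm p c (g n) (h n) / boundaryNorm p (harmonicMap (g n) (h n)))
        atTop (𝓝 (rieszConst p c)) ∧
      DifferentiableOn ℂ G unitDisk ∧ DifferentiableOn ℂ H unitDisk ∧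
      TendstoLocallyUniformlyOn (fun n => harmonicMap (g n) (h n)) (harmonicMap G H)
        atTop unitDisk ∧
      (∀ z ∈ unitDisk, (harmonicMap G H z).im = 0) ∧
      ¬ MemHarmonicHardy p (harmonicMap G H)) ∧
    -- the explicit minimizing family `g_γ + \overline{a g_γ}` as `γ` increases to `1 / p`
    (2 < p → ∀ (a : ℂ) (f : ℝ → ℂ → ℂ), a = ((-1 / extremalRadius p c : ℝ) : ℂ) →
      (∀ γ z, f γ z = sectorMap γ z + conj (a * sectorMap γ z)) →
      (∀ γ ∈ Ioo 0 (1 / p), MemHarmonicHardy p (f γ) ∧ boundaryNorm p (f γ) ≠ 0) ∧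
      Tendsto (fun γ => weightedNorm p c (sectorMap γ) (fun z => a * sectorMap γ z) /
          boundaryNorm p (f γ)) (𝓝[<] (1 / p)) (𝓝 (rieszConst p c)) ∧
      -- the normalization `f_γ - f_γ(0)`, with both analytic parts vanishing at the origin
      (∀ γ ∈ Ioo 0 (1 / p),
        IsAdmissible p (fun z => sectorMap γ z - 1) (fun z => a * (sectorMap γ z - 1))) ∧
      Tendsto (fun γ =>
          weightedNorm p c (fun z => sectorMap γ z - 1) (fun z => a * (sectorMap γ z - 1)) /
          boundaryNorm p (fun z => f γ z - f γ 0)) (𝓝[<] (1 / p)) (𝓝 (rieszConst p c)) ∧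
      TendstoLocallyUniformlyOn f (f (1 / p)) (𝓝[<] (1 / p)) unitDisk ∧
      ¬ MemHarmonicHardy p (f (1 / p)) ∧
      (c ≠ 1 → ∀ γ ∈ Ioc 0 (1 / p),
        IsQuasiconformalHarmonic (min (extremalRadius p c) (extremalRadius p c)⁻¹) (f γ)) ∧
      (c = 1 → ∀ γ ∈ Ioc 0 (1 / p), ∀ z ∈ unitDisk, (I * f γ z).im = 0)) := by
  have hp0 : 0 < p := by linarith
  have hp1 : 1 ≤ p := by linarith
  have hle1 : 1 / p ≤ 1 := by rw [div_le_one hp0]; exact hp1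
  have hpos1 : 0 < 1 / p := by positivity
  have dS : ∀ (γ : ℝ) (α δ : ℂ), DifferentiableOn ℂ (fun z => α * (sectorMap γ z - δ)) unitDisk :=
    fun γ α δ => ((differentiableOn_sectorMap γ).sub_const δ).const_mul α
  refine ⟨fun g h H => ?_, fun g h H => H.weightedNorm_le hp hc,
    fun C hC => rieszConst_le_of_forall hp hc hC, fun hp2 g h H hne => H.weightedNorm_ne hp2 hc hne,
    fun hc1 => ?_, fun hc1 => ?_, fun hp2 a f ha hf => ?_⟩
  · obtain ⟨hg, hh⟩ := H.hasBoundaryValues hp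
    exact ⟨hg.hasRadialLimit.and hh.hasRadialLimit, H.circleIntegrable hp hc⟩
  · obtain ⟨α, β, m, k, hm, hκ, hr, hk0, hk1, hne, hk⟩ := exists_extremal_coefficients hp hc hc1
    obtain ⟨γ, hγt, hγ, hb, ht⟩ := exists_minimizing_exponents hp hc hm hκ hr
    refine ⟨fun n z => α * (sectorMap (γ n) z - 1), fun n z => β * (sectorMap (γ n) z - 1),
      fun z => α * (sectorMap (1 / p) z - 1), fun z => β * (sectorMap (1 / p) z - 1), k,
      fun n => ⟨isAdmissible_sector hp1 (hγ n).1.le (mul_lt_one_of_lt_one_div hp0 (hγ n).2) α β,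
        hb n, isQuasiconformalHarmonic_sector (hγ n).1 ((hγ n).2.le.trans hle1) hk0 hk1 hne hk 1⟩,
      ht, dS _ _ _, dS _ _ _, ?_,
      isQuasiconformalHarmonic_sector hpos1 hle1 hk0 hk1 hne hk 1,
      not_memHarmonicHardy_sector hp hm hκ 1⟩
    exact fun u hu x hx => (tendstoLocallyUniformlyOn_sector (1 / p) α β 1 u hu x hx).imp
      fun t h => ⟨h.1, hγt.eventually h.2⟩
  · subst hc1
    obtain ⟨hm, hκ, hr⟩ := extremal_coefficients_one hp
    obtain ⟨γ, hγt, hγ, hb, ht⟩ := exists_minimizing_exponents hp hc hm hκ hr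
    have him : ∀ w : ℂ, (w + conj w).im = 0 := fun w => by simp
    refine ⟨fun n z => I * (sectorMap (γ n) z - 1), fun n z => I * (sectorMap (γ n) z - 1),
      fun z => I * (sectorMap (1 / p) z - 1), fun z => I * (sectorMap (1 / p) z - 1),
      fun n => ⟨isAdmissible_sector hp1 (hγ n).1.le (mul_lt_one_of_lt_one_div hp0 (hγ n).2) I I,
        hb n, fun z _ => him _⟩,
      ht, dS _ _ _, dS _ _ _, ?_, fun z _ => him _, not_memHarmonicHardy_sector hp hm hκ 1⟩
    exact fun u hu x hx => (tendstoLocallyUniformlyOn_sector (1 / p) I I 1 u hu x hx).imp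
      fun t h => ⟨h.1, hγt.eventually h.2⟩
  · have hR := (extremal_relations hp2 hc).1
    have hnorm : ‖a‖ = (extremalRadius p c)⁻¹ := by
      rw [ha, neg_div, one_div]; exact norm_ofReal_neg_inv hR
    have hm : 1 * a = ((-(extremalRadius p c)⁻¹ : ℝ) : ℂ) := by
      rw [ha, one_mul, neg_div, one_div]
    have hκ' : ∀ s : ℝ, s < 1 →
        0 < ‖(1 : ℂ)‖ ^ 2 + ‖a‖ ^ 2 + 2 * -(extremalRadius p c)⁻¹ * s := fun s hs => by
      rw [norm_one, one_pow, hnorm]; exact extremal_pair_pos (inv_pos.2 hR) hs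
    have hκ := hκ' _ (cos_pi_div_pos hp2).2
    have hr : √(‖(1 : ℂ)‖ ^ 2 + c * ‖a‖ ^ 2) /
        √(‖(1 : ℂ)‖ ^ 2 + ‖a‖ ^ 2 + 2 * -(extremalRadius p c)⁻¹ * Real.cos (π / p)) =
          rieszConst p c := by
      rw [norm_one, one_pow, hnorm]
      exact rieszConst_eq_of_sq hc.le (by positivity) (extremal_pair_ratio hp2 hc)
    -- The family is the sector pair with α = 1, β = a and shift δ = 0; the normalized family is the
    -- same pair with δ = 1.
    have hf0 : f = fun γ => harmonicMap (fun z => 1 * (sectorMap γ z - 0))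
        (fun z => a * (sectorMap γ z - 0)) := by
      funext γ z
      rw [hf]; simp only [harmonicMap, one_mul, sub_zero]
    have hf1 : ∀ γ, (fun z => f γ z - f γ 0) = harmonicMap (fun z => 1 * (sectorMap γ z - 1))
        (fun z => a * (sectorMap γ z - 1)) := by
      intro γ
      funext z
      rw [hf, hf, sectorMap_zero]
      simp only [harmonicMap, one_mul, map_mul, map_sub, map_one]; ring
    obtain ⟨-, ht0⟩ := tendsto_sector_ratio hp1 hc.le hm hκ 0
    obtain ⟨-, ht1⟩ := tendsto_sector_ratio hp1 hc.le hm hκ 1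
    rw [hr] at ht0 ht1
    refine ⟨fun γ hγ => ?_, ?_, fun γ hγ => ?_, ?_, ?_, ?_, fun hc1 γ hγ => ?_,
      fun hc1 γ hγ z hz => ?_⟩
    · have h1 := mul_lt_one_of_lt_one_div hp0 hγ.2
      rw [hf0]
      refine ⟨(isHardyPair_sector hp1 hγ.1.le h1 1 a 0).2.2, ?_⟩
      have hb := abs_boundaryNorm_sub_le hp1 hγ.1.le h1 hm 0
      simp only [mul_zero, map_zero, add_zero, norm_zero] at hb
      have hb2 := sub_eq_zero.1 (abs_nonpos_iff.1 hb)
      beta_reduce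
      rw [hb2]
      have hpi := Real.pi_pos
      have hcos : Real.cos (γ * π) < 1 := by
        rw [← Real.cos_zero]
        refine Real.cos_lt_cos_of_nonneg_of_le_pi le_rfl ?_ (mul_pos hγ.1 hpi)
        nlinarith [hγ.2]
      exact (mul_pos (Real.sqrt_pos.2 (hκ' _ hcos)) (sectorNorm_pos hp0 hγ.1.le h1)).ne'
    · rw [hf0]
      simpa only [one_mul, sub_zero] using ht0
    · have := isAdmissible_sector hp1 hγ.1.le (mul_lt_one_of_lt_one_div hp0 hγ.2) 1 a
      simpa only [one_mul] using this
    · simp only [hf1]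
      simpa only [one_mul] using ht1
    · rw [hf0]
      exact fun u hu x hx => (tendstoLocallyUniformlyOn_sector (1 / p) 1 a 0 u hu x hx).imp
        fun t h => ⟨h.1, h.2.filter_mono nhdsWithin_le_nhds⟩
    · rw [hf0]
      exact not_memHarmonicHardy_sector hp hm hκ 0
    · have hne := fun h => hc1 ((extremalRadius_eq_one_iff hp2 hc).1 h)
      rw [hf0]
      refine isQuasiconformalHarmonic_sector hγ.1 (hγ.2.trans hle1)
        (le_min hR.le (inv_nonneg.2 hR.le)) (min_inv_lt_one hne) ?_ ?_ 0
      · rw [norm_one, hnorm]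
        exact fun h => hne (inv_eq_one.1 h.symm)
      · rw [norm_one, hnorm]
        exact extremal_dilatation hR
    · have ha1 : a = -1 := by
        rw [ha, (extremalRadius_eq_one_iff hp2 hc).2 hc1]; simp
      rw [hf, ha1]
      simp
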